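/- **Setting.** Let $I$ be a finite set and $A=(a_{ij})_{i,j\in I}$ a symmetrizable generalized Cartan matrix. Fix a finite-dimensional complex vector space $\mathfrak h$, linearly independent simple roots $\alpha_i\in\mathfrak h^*$ and simple coroots $\alpha_i^\vee\in\mathfrak h$ with $\alpha_j(\alpha_i^\vee)=a_{ij}$, a non-degenerate symmetric bilinear form $(\cdot,\cdot)$ on $\mathfrak h^*$ with $(\alpha_i,\alpha_i)\in 2\mathbb Z_{>0}$ and $\lambda(\alpha_i^\vee)=2(\lambda,\alpha_i)/(\alpha_i,\alpha_i)$ for all $\lambda\in\mathfrak h^*$, and a lattice $P\subset\mathfrak h^*$ (the $\mathbb Z$-span of a basis of $\mathfrak h^*$) with $\alpha_i\in P$, $\lambda(\alpha_i^\vee)\in\mathbb Z$ for $\lambda\in P$, and $(P,P)\subset\frac1d\mathbb Z$ for some $d\in\mathbb Z_{>0}$. Let $W$ be the Weyl group, i.e. the Coxeter group with generators $s_i$, $i\in I$, attached to $A$; it acts on $\mathfrak h^*$ by $s_i\lambda=\lambda-\lambda(\alpha_i^\vee)\alpha_i$. For $J\subset I$ put $W_J=\langle s_i: i\in J\rangle$.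 Let $\Bbbk$ be a field of characteristic zero containing an element $q^{1/2d}$ transcendental over $\mathbb Q$; put $q_i=q^{(\alpha_i,\alpha_i)/2}$, $(n)_v=\frac{v^n-v^{-n}}{v-v^{-1}}$, $(n)_v!=\prod_{s=1}^n(s)_v$, $X_i^{(n)}=X_i^n/(n)_{q_i}!$. Let $U_q(\mathfrak g)$ be the $\Bbbk$-algebra generated by $E_i,F_i$ ($i\in I$) and $K_\lambda$ ($\lambda\in\frac12P$) with the relations $K_0=1$, $K_\lambda K_\mu=K_{\lambda+\mu}$, $K_\lambda E_i=q^{(\lambda,\alpha_i)}E_iK_\lambda$, $K_\lambda F_i=q^{-(\lambda,\alpha_i)}F_iK_\lambda$, $[E_i,F_j]=\delta_{ij}\frac{K_{\alpha_i}-K_{-\alpha_i}}{q_i-q_i^{-1}}$ and, for $i\ne j$, $\sum_{r+s=1-a_{ij}}(-1)^rE_i^{(r)}E_jE_i^{(s)}=0=\sum_{r+s=1-a_{ij}}(-1)^rF_i^{(r)}F_jF_i^{(s)}$. An object of $\mathscr O^{int}_q(\mathfrak g)$ is a $U_q(\mathfrak g)$-module $V=\bigoplus_{\beta\in P}V(\beta)$,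 $V(\beta)=\{m: K_\lambda m=q^{(\lambda,\beta)}m\ \forall\lambda\in\frac12P\}$, on which all $E_i,F_i$ act locally nilpotently and such that for each $m\in V$ there is $N$ with $xm=0$ for every $x\in U_q^+(\mathfrak g)$ homogeneous of degree $\sum_i\nu_i\alpha_i$ ($\nu_i\in\mathbb Z_{\ge0}$) with $\sum_i\nu_i\ge N$, where $U_q^+(\mathfrak g)$ is the subalgebra generated by the $E_i$, graded by $\deg E_i=\alpha_i$. Let $J(V)=\{i\in I: F_i(V)=0\}$ and $V_+=\bigcap_i\ker E_i$. For $v\in V$ write $v=\sum_\lambda v(\lambda)$ with $v(\lambda)\in V(\lambda)$, $\operatorname{supp}v=\{\lambda: v(\lambda)\neq0\}$. For $\lambda\in P$ dominant, $u\in V_+(\lambda)=V_+\cap V(\lambda)$ and a reduced word $\mathbf i=(i_1,\dots,i_m)$ of $w\in W$ put $F_{\mathbf i,\lambda}=F_{i_1}^{(a_1)}\cdots F_{i_m}^{(a_m)}$ with $a_k=(s_{i_{k+1}}\cdots s_{i_m}\lambda)(\alpha_{i_k}^\vee)$, and $[u]_w=F_{\mathbf i,\lambda}u$, computed with one fixed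 reduced word of each $w$. For $v\in V_+$ put $[v]_{W}=\{[v(\lambda)]_w: \lambda\in\operatorname{supp}v,\ w\in W\}$, and $J(U_q(\mathfrak g)v)=\{i: F_i\,U_q(\mathfrak g)v=0\}$. **Theorem.** Let $V$ be a non-zero object of $\mathscr O^{int}_q(\mathfrak g)$. 1. For each $i\in I$ there is a unique $\Bbbk$-linear map $\sigma^i=\sigma^i_V:V\to V$ with $\sigma^i(E_i^{(k)}u)=E_i^{(l-k)}u$ for all $0\le k\le l$ and all $u\in\ker F_i\cap\ker(K_{\alpha_i}-q_i^{-l})$. It is invertible, $(\sigma^i)^2=1$, and $\sigma^i=1$ if and only if $i\in J(V)$. 2. Let $\mathsf W(V)\subset\operatorname{GL}_\Bbbk(V)$ be the subgroup generated by the $\sigma^i$, $i\in I$. There is a group homomorphism $\psi_V:\mathsf W(V)\to W$ with $\psi_V(\sigma^i)=1$ if $i\in J(V)$ and $\psi_V(\sigma^i)=s_i$ otherwise. Its image is $W_{I\setminus J(V)}$, and it is surjective if and only if $J(V)=\emptyset$. 3. Let $v\in V_+\setminus\{0\}$. For $\lambda\in\operatorname{supp}v$ the vectors $[v(\lambda)]_w$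 do not depend on the choice of reduced words, and $\sigma^i([v(\lambda)]_w)=[v(\lambda)]_{s_iw}$ for all $i\in I$, $w\in W$. The group $W$ acts on the set $[v]_W$ by $w\cdot[v(\lambda)]_{u}=[v(\lambda)]_{wu}$; the set $[v]_W$ is $\mathsf W(V)$-invariant, and each $g\in\mathsf W(V)$ acts on $[v]_W$ as $\psi_V(g)$ does. The kernel of the action of $W$ on $[v]_W$ is $W_{J(U_q(\mathfrak g)v)}$; the images of $\mathsf W(V)$ and of $W$ in $\operatorname{Bij}([v]_W)$ coincide, and the action maps $W_{I\setminus J(U_q(\mathfrak g)v)}$ isomorphically onto this image. 4. There is $v\in V_+\setminus\{0\}$ with $J(U_q(\mathfrak g)v)=J(V)$. -/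

import Mathlib

namespace CrystalWeyl

/-- The datum attached to a symmetrizable generalized Cartan matrix `A = (a i j)`: a finite
dimensional complex vector space `h`, linearly independent simple roots in `h^*` and simple
coroots in `h`, a nondegenerate symmetric form on `h^*` and a weight lattice `P` in `h^*`. -/
structure CartanDatum (I : Type*) (h : Type*) [AddCommGroup h] [Module ℂ h] where
  /-- the generalized Cartan matrix -/
  a : I → I → ℤ
  a_self : ∀ i, a i i = 2
  a_nonpos : ∀ i j, i ≠ j → a i j ≤ 0
  a_zero : ∀ i j, a i j = 0 → a j i = 0
  symmetrizable : ∃ e : I → ℤ, (∀ i, 0 < e i) ∧ ∀ i j, e i * a i j = e j * a j i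
  /-- the simple roots -/
  root : I → Module.Dual ℂ h
  root_indep : LinearIndependent ℂ root
  /-- the simple coroots -/
  coroot : I → h
  coroot_indep : LinearIndependent ℂ coroot
  /-- the symmetric nondegenerate bilinear form on `h^*` -/
  form : LinearMap.BilinForm ℂ (Module.Dual ℂ h)
  form_symm : form.IsSymm
  form_nondeg : form.Nondegenerate
  /-- the weight lattice -/
  P : AddSubgroup (Module.Dual ℂ h)
  P_lattice : ∃ b : Module.Basis (Fin (Module.finrank ℂ (Module.Dual ℂ h))) ℂ (Module.Dual ℂ h),
    P = AddSubgroup.closure (Set.range b)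
  root_coroot : ∀ i j, root j (coroot i) = (a i j : ℂ)
  form_root : ∀ i, ∃ n : ℤ, 0 < n ∧ form (root i) (root i) = 2 * (n : ℂ)
  apply_coroot : ∀ (lam : Module.Dual ℂ h) (i : I),
    lam (coroot i) = 2 * form lam (root i) / form (root i) (root i)
  root_mem : ∀ i, root i ∈ P
  coroot_int : ∀ lam ∈ P, ∀ i, ∃ n : ℤ, lam (coroot i) = (n : ℂ)
  /-- the positive integer `d` with `(P, P) ⊆ (1/d) ℤ` -/
  d : ℕ
  d_pos : 0 < d
  form_int : ∀ lam ∈ P, ∀ mu ∈ P, ∃ n : ℤ, form lam mu = (n : ℂ) / (d : ℂ)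

section Quantum

variable {I : Type*} {h : Type*} [AddCommGroup h] [Module ℂ h] {k : Type*} [Field k]

/-! ### Weyl group -/

/-- The order of `s_i s_j`, for `i ≠ j`, as a function of `a i j * a j i`
(the value `0` stands for infinite order). -/
def coxeterEntry (p : ℤ) : ℕ :=
  if p = 0 then 2 else if p = 1 then 3 else if p = 2 then 4 else if p = 3 then 6 else 0

theorem coxeterEntry_ne_one (p : ℤ) : coxeterEntry p ≠ 1 := by
  unfold coxeterEntry; split_ifs <;> decide

open Classical in
/-- The Coxeter matrix of the Weyl group. -/
noncomputable def coxeterMatrix (D : CartanDatum I h) : CoxeterMatrix I where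
  M := fun i j => if i = j then 1 else coxeterEntry (D.a i j * D.a j i)
  isSymm := by
    refine Matrix.IsSymm.ext fun i j => ?_
    by_cases hij : i = j
    · subst hij; rfl
    · simp [hij, Ne.symm hij, mul_comm]
  diagonal := by intro i; simp
  off_diagonal := by
    intro i j hij
    simpa [hij] using coxeterEntry_ne_one _

/-- The Weyl group, as an abstract Coxeter group. -/
abbrev WeylGroup (D : CartanDatum I h) := (coxeterMatrix D).Group

/-- The Weyl group with its Coxeter generators. -/
noncomputable abbrev weyl (D : CartanDatum I h) :
    CoxeterSystem (coxeterMatrix D) (WeylGroup D) :=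
  (coxeterMatrix D).toCoxeterSystem

/-- The parabolic subgroup `W_J`, generated by the `s_i`, `i ∈ J`. -/
noncomputable def parabolic (D : CartanDatum I h) (J : Set I) : Subgroup (WeylGroup D) :=
  Subgroup.closure ((weyl D).simple '' J)

/-- The simple reflection `s_i` acting on `h^*`. -/
def reflect (D : CartanDatum I h) (i : I) (lam : Module.Dual ℂ h) : Module.Dual ℂ h :=
  lam - lam (D.coroot i) • D.root i

/-- `s_{i₁} ⋯ s_{iₘ} λ` for a word `(i₁, …, iₘ)`. -/
def reflectWord (D : CartanDatum I h) (om : List I) (lam : Module.Dual ℂ h) :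
    Module.Dual ℂ h :=
  om.foldr (fun i mu => reflect D i mu) lam

/-- The integer `λ(α_i^∨)`, for `λ ∈ P`. -/
noncomputable def corootPairing (D : CartanDatum I h) (lam : Module.Dual ℂ h) (i : I) : ℤ :=
  ⌊(lam (D.coroot i)).re⌋

theorem corootPairing_spec (D : CartanDatum I h) {lam : Module.Dual ℂ h} (hlam : lam ∈ D.P)
    (i : I) : (corootPairing D lam i : ℂ) = lam (D.coroot i) := by
  obtain ⟨n, hn⟩ := D.coroot_int lam hlam i
  simp [corootPairing, hn]

/-! ### Quantum group -/

/-- `(n)_v = (v^n - v^{-n}) / (v - v^{-1})`. -/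
noncomputable def qInt (v : k) (n : ℕ) : k := (v ^ n - (v ^ n)⁻¹) / (v - v⁻¹)

/-- `(n)_v!`. -/
noncomputable def qFact (v : k) (n : ℕ) : k := ∏ s ∈ Finset.range n, qInt v (s + 1)

/-- The divided power `x^{(n)} = x^n / (n)_v!`. -/
noncomputable def divPow {R : Type*} [Ring R] [Algebra k R] (v : k) (x : R) (n : ℕ) : R :=
  (qFact v n)⁻¹ • x ^ n

/-- `q^x` for `x ∈ (1/2d) ℤ`, where `r = q^{1/2d}`. -/
noncomputable def qPow (D : CartanDatum I h) (r : k) (x : ℂ) : k :=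
  r ^ ⌊((2 * (D.d : ℂ)) * x).re⌋

theorem qPow_spec (D : CartanDatum I h) (r : k) (n : ℤ) :
    qPow D r ((n : ℂ) / (2 * (D.d : ℂ))) = r ^ n := by
  have hd : (2 * (D.d : ℂ)) ≠ 0 := by
    have := D.d_pos
    simp; omega
  rw [qPow, mul_div_cancel₀ _ hd]
  simp

/-- `q_i = q^{(α_i, α_i)/2}`. -/
noncomputable def qi (D : CartanDatum I h) (r : k) (i : I) : k :=
  qPow D r (D.form (D.root i) (D.root i) / 2)

/-- The group `(1/2) P`. -/
def halfP (D : CartanDatum I h) : AddSubgroup (Module.Dual ℂ h) :=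
  D.P.comap (nsmulAddMonoidHom 2)

/-- The simple root `α_i` as an element of `(1/2) P`. -/
def rootHalf (D : CartanDatum I h) (i : I) : halfP D :=
  ⟨D.root i, D.P.nsmul_mem (D.root_mem i) 2⟩

/-- The symbols generating the quantum group. -/
inductive Gen (D : CartanDatum I h)
  | E (i : I) : Gen D
  | F (i : I) : Gen D
  | K (lam : halfP D) : Gen D

/-- Free generators. -/
noncomputable abbrev fE (D : CartanDatum I h) (k : Type*) [Field k] (i : I) :
    FreeAlgebra k (Gen D) := FreeAlgebra.ι k (Gen.E i)
/-- Free generators. -/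
noncomputable abbrev fF (D : CartanDatum I h) (k : Type*) [Field k] (i : I) :
    FreeAlgebra k (Gen D) := FreeAlgebra.ι k (Gen.F i)
/-- Free generators. -/
noncomputable abbrev fK (D : CartanDatum I h) (k : Type*) [Field k] (lam : halfP D) :
    FreeAlgebra k (Gen D) := FreeAlgebra.ι k (Gen.K lam)

/-- The left-hand side `∑_{r+s=N} (-1)^r x^{(r)} y x^{(s)}` of the quantum Serre relations. -/
noncomputable def serre {R : Type*} [Ring R] [Algebra k R] (v : k) (x y : R) (N : ℕ) : R :=
  ∑ n ∈ Finset.range (N + 1), (-1 : R) ^ n * divPow v x n * y * divPow v x (N - n)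

/-- The defining relations of the quantum group. -/
inductive Rel (D : CartanDatum I h) (r : k) :
    FreeAlgebra k (Gen D) → FreeAlgebra k (Gen D) → Prop
  | K_zero : Rel D r (fK D k 0) 1
  | K_add (lam mu : halfP D) : Rel D r (fK D k (lam + mu)) (fK D k lam * fK D k mu)
  | K_E (lam : halfP D) (i : I) :
      Rel D r (fK D k lam * fE D k i) (qPow D r (D.form lam (D.root i)) • (fE D k i * fK D k lam))
  | K_F (lam : halfP D) (i : I) :
      Rel D r (fK D k lam * fF D k i)
        (qPow D r (-(D.form lam (D.root i))) • (fF D k i * fK D k lam))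
  | E_F_self (i : I) :
      Rel D r (fE D k i * fF D k i - fF D k i * fE D k i)
        ((qi D r i - (qi D r i)⁻¹)⁻¹ • (fK D k (rootHalf D i) - fK D k (-(rootHalf D i))))
  | E_F (i j : I) : i ≠ j → Rel D r (fE D k i * fF D k j) (fF D k j * fE D k i)
  | serre_E (i j : I) : i ≠ j →
      Rel D r (serre (qi D r i) (fE D k i) (fE D k j) (1 - D.a i j).toNat) 0
  | serre_F (i j : I) : i ≠ j →
      Rel D r (serre (qi D r i) (fF D k i) (fF D k j) (1 - D.a i j).toNat) 0

/-- The Drinfeld–Jimbo quantum group `U_q(g)` over `k`, where `r = q^{1/2d}`. -/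
abbrev Uq (D : CartanDatum I h) (r : k) := RingQuot (Rel D r)

/-- The generator `E_i`. -/
noncomputable def E (D : CartanDatum I h) (r : k) (i : I) : Uq D r :=
  RingQuot.mkAlgHom k (Rel D r) (fE D k i)
/-- The generator `F_i`. -/
noncomputable def F (D : CartanDatum I h) (r : k) (i : I) : Uq D r :=
  RingQuot.mkAlgHom k (Rel D r) (fF D k i)
/-- The generator `K_λ`. -/
noncomputable def K (D : CartanDatum I h) (r : k) (lam : halfP D) : Uq D r :=
  RingQuot.mkAlgHom k (Rel D r) (fK D k lam)

/-- The homogeneous component `U_q^+(g)(ν)`, for `ν = ∑ ν_i α_i`: it is spanned by the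
products of `E_i`'s in which each `E_i` occurs `ν_i` times. -/
noncomputable def UqPlus [DecidableEq I] (D : CartanDatum I h) (r : k) (nu : I → ℕ) :
    Submodule k (Uq D r) :=
  Submodule.span k {x | ∃ om : List I, (∀ i, om.count i = nu i) ∧ x = (om.map (E D r)).prod}

/-! ### Integrable modules -/

variable {V : Type*} [AddCommGroup V] [Module k V]

/-- The weight space `V(β)`. -/
def weightSpace (D : CartanDatum I h) (r : k) (V : Type*) [AddCommGroup V] [Module k V]
    [Module (Uq D r) V] [IsScalarTower k (Uq D r) V] (be : D.P) : Submodule k V where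
  carrier := {m | ∀ lam : halfP D,
    K D r lam • m = qPow D r (D.form (lam : Module.Dual ℂ h) (be : Module.Dual ℂ h)) • m}
  zero_mem' := by intro lam; simp
  add_mem' := by
    intro x y hx hy lam
    rw [smul_add, smul_add, hx lam, hy lam]
  smul_mem' := by
    intro c x hx lam
    rw [smul_comm, hx lam, smul_comm]

/-- The module `V` is an object of `𝒪_q^int(g)`. -/
structure IsObjectO [Fintype I] [DecidableEq I] (D : CartanDatum I h) (r : k)
    (V : Type*) [AddCommGroup V] [Module k V]
    [Module (Uq D r) V] [IsScalarTower k (Uq D r) V] : Prop where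
  weight_indep : iSupIndep (weightSpace D r V)
  weight_span : ⨆ be, weightSpace D r V be = ⊤
  E_nilp : ∀ (i : I) (m : V), ∃ n : ℕ, E D r i ^ n • m = 0
  F_nilp : ∀ (i : I) (m : V), ∃ n : ℕ, F D r i ^ n • m = 0
  /-- `U_q^+(ν)` kills `m` as soon as `ρ^∨(ν) = ∑ ν_i` is large -/
  bounded : ∀ m : V, ∃ N : ℕ, ∀ nu : I → ℕ, N ≤ ∑ i, nu i → ∀ x ∈ UqPlus D r nu, x • m = 0

section Module

variable (D : CartanDatum I h) (r : k) [Module (Uq D r) V] [IsScalarTower k (Uq D r) V]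

/-- `f` sends `E_i^{(k)} u` to `E_i^{(l-k)} u` whenever `0 ≤ k ≤ l`, `F_i u = 0` and
`K_{α_i} u = q_i^{-l} u`. -/
def IsSigma (i : I) (f : V →ₗ[k] V) : Prop :=
  ∀ (l n : ℕ), n ≤ l → ∀ u : V, F D r i • u = 0 →
    K D r (rootHalf D i) • u = (qi D r i ^ l)⁻¹ • u →
    f (divPow (qi D r i) (E D r i) n • u) = divPow (qi D r i) (E D r i) (l - n) • u

/-- `J(V) = {i : F_i(V) = 0}`. -/
def JV (V : Type*) [AddCommGroup V] [Module k V] [Module (Uq D r) V] : Set I :=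
  {i | ∀ v : V, F D r i • v = 0}

/-- `J(U_q(g) v)`, for the submodule generated by `v`. -/
def JGen (v : V) : Set I := {i | ∀ x : Uq D r, F D r i • x • v = 0}

/-- `v ∈ V_+`, that is, `E_i v = 0` for all `i`. -/
def IsHighest (v : V) : Prop := ∀ i, E D r i • v = 0

open Classical in
/-- The family `β ↦ v(β)` of weight components of `v` (zero if `v` is not a sum of weight
vectors); its support is `supp v`. -/
noncomputable def weightComp (v : V) : D.P →₀ V :=
  if H : ∃ c : D.P →₀ V, (∀ be, c be ∈ weightSpace D r V be) ∧ (c.sum fun _ x => x) = v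
  then H.choose else 0

/-- For a word `(i₁, …, iₘ)`, the monomial `F_{i₁}^{(a₁)} ⋯ F_{iₘ}^{(aₘ)}` with
`aₖ = (s_{iₖ₊₁} ⋯ s_{iₘ} λ)(α_{iₖ}^∨)`; these are nonnegative integers if the word is reduced
and `λ` is dominant. -/
noncomputable def monomialF (lam : Module.Dual ℂ h) : List I → Uq D r
  | [] => 1
  | i :: om => divPow (qi D r i) (F D r i) (corootPairing D (reflectWord D om lam) i).toNat *
      monomialF lam om

/-- A reduced word of `w`. -/
noncomputable def reducedWord (D : CartanDatum I h) (w : WeylGroup D) : List I :=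
  ((weyl D).exists_isReduced w).choose

/-- The extremal vector `[v]_w = F_{w,λ} v`, for `v` of weight `λ`. -/
noncomputable def extremal (lam : D.P) (v : V) (w : WeylGroup D) : V :=
  monomialF D r (lam : Module.Dual ℂ h) (reducedWord D w) • v

/-- `[v(λ)]_w` -/
noncomputable def extremalComp (v : V) (lam : D.P) (w : WeylGroup D) : V :=
  extremal D r lam (weightComp D r v lam) w

/-- The set `[v]_W` of all `[v(λ)]_w`, `λ ∈ supp v`, `w ∈ W`. -/
def extremalSet (v : V) : Set V :=
  {x | ∃ lam ∈ (weightComp D r v).support, ∃ w : WeylGroup D, x = extremalComp D r v lam w}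

end Module

end Quantum

end CrystalWeyl

/-!
The proof reduces everything to the rank one and rank two subalgebras of the quantum group.

**Rank one.** For each `i` the module is an integrable module over quantum `sl₂`, graded by the
eigenvalues of `K_{α_i}` (`IsObjectO.quantumSl2`). It is spanned by the strings `E^{(m)} u` with `u`
a lowest weight vector, and `σ^i` is the operator reversing each string
(`QuantumSl2.sigma`, `QuantumSl2.ext_strings`). On a highest weight vector of weight `n` it acts as
`F^{(n)}` (`QuantumSl2.sigma_highest`), so `σ^i` sends `[u]_w` to `[u]_{s_i w}` as soon as `E_i`
kills `[u]_w` when `ℓ(s_i w) > ℓ(w)`.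

**Independence of the reduced word.** By Matsumoto's theorem (`eq_of_wordProd_eq`) it suffices to
compare two words differing by a braid move, which is an identity between two products of divided
powers of `F_i, F_j` on a vector `u` killed by `E_i` and `E_j`. Both sides are vectors of an extremal
weight. Divided powers of `E_i` and `E_j` are injective there, and they peel off the outer letters of
both products; the terms that could obstruct this vanish, because their weights, moved by the
dihedral group, would not lie below the weight of `u` (`IsRankTwo.verma_A2`, `IsRankTwo.verma_B2`,
`IsRankTwo.verma_G2`). The same weight argument for the whole Weyl group gives the vanishing of
`E_i [u]_w` (`E_smul_monomialF_smul`).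

**The Weyl group.** The abstract Coxeter group acts on `h^*`, and `w α_i` is a nonnegative
combination of simple roots when `ℓ(w s_i) > ℓ(w)` (`act_root_mem_Qplus`). Hence an element fixing
a reflection-stable set of weights lies in the parabolic subgroup generated by the simple
reflections fixing that set (`mem_parabolic_of_fixes`). The weight of `[v(λ)]_w` is `w λ`, so the
kernel of the action on `[v]_W` is the parabolic subgroup of those `i` for which `α_i^∨` vanishes on
all orbits `W λ`, and this set of indices is `J(U_q(g) v)` (`mem_JGen_iff`). It is a union of
components of the Dynkin diagram, so the complementary parabolic subgroup acts faithfully.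

**The homomorphism.** A sum of highest weight vectors of distinct weights, enough of them to detect
every `i` with `F_i ≠ 0`, satisfies `J(U_q(g) v) = J(V)` (`exists_JGen_eq_JV`). For this `v` the group
generated by the `σ^i` and the subgroup `W_{I ∖ J(V)}` have the same image in `Bij([v]_W)`, and the
second one embeds; this defines `ψ_V` (`exists_psi`).
-/


namespace CrystalWeyl

/-! ### Quantum integers -/

section QuantumInteger

variable {k : Type*} [Field k]

/-- A nonzero element which is not a root of unity. -/
structure IsGeneric (q : k) : Prop where
  ne_zero : q ≠ 0
  zpow_ne_one : ∀ n : ℤ, n ≠ 0 → q ^ n ≠ 1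

/-- The quantum integer `(n)_q` for an arbitrary integer `n`. -/
noncomputable def qz (q : k) (n : ℤ) : k := (q ^ n - q ^ (-n)) / (q - q⁻¹)

theorem qz_natCast (q : k) (n : ℕ) : qz q n = qInt q n := by
  simp [qz, qInt]

theorem qz_neg (q : k) (n : ℤ) : qz q (-n) = -qz q n := by
  simp only [qz, neg_neg]; rw [← neg_div, neg_sub]

variable {q : k}

theorem IsGeneric.zpow_sub_ne_zero (hq : IsGeneric q) {n : ℤ} (hn : n ≠ 0) :
    q ^ n - q ^ (-n) ≠ 0 := by
  intro h0
  have h1 : q ^ (n + n) = 1 := by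
    rw [zpow_add₀ hq.ne_zero]
    nth_rewrite 1 [sub_eq_zero.1 h0]
    rw [← zpow_add₀ hq.ne_zero]; simp
  exact hq.zpow_ne_one _ (by omega) h1

theorem IsGeneric.qz_ne_zero (hq : IsGeneric q) {n : ℤ} (hn : n ≠ 0) : qz q n ≠ 0 := by
  refine div_ne_zero (hq.zpow_sub_ne_zero hn) ?_
  simpa using hq.zpow_sub_ne_zero one_ne_zero

theorem IsGeneric.qz_one (hq : IsGeneric q) : qz q 1 = 1 := by
  have := hq.zpow_sub_ne_zero one_ne_zero
  simp only [zpow_one, zpow_neg] at this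
  simp [qz, div_self this]

theorem qFact_succ (q : k) (n : ℕ) : qFact q (n + 1) = qz q ((n : ℤ) + 1) * qFact q n := by
  rw [qFact, Finset.prod_range_succ, mul_comm, qFact, ← qz_natCast]; simp

@[simp] theorem qFact_zero (q : k) : qFact q 0 = 1 := by simp [qFact]

theorem IsGeneric.qFact_ne_zero (hq : IsGeneric q) (n : ℕ) : qFact q n ≠ 0 := by
  induction n with
  | zero => simp
  | succ n ih => rw [qFact_succ]; exact mul_ne_zero (hq.qz_ne_zero (by omega)) ih

theorem IsGeneric.qz_add_qz (hq : IsGeneric q) (h n : ℤ) :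
    qz q (n + 1) * qz q (h - n) + qz q (h - 2 * (n + 1)) = qz q (n + 2) * qz q (h - (n + 1)) := by
  have h1 := hq.zpow_sub_ne_zero one_ne_zero
  have h0 := hq.ne_zero
  simp only [zpow_one, zpow_neg] at h1
  have e1 : ∀ a b : ℤ, q ^ (a + b) = q ^ a * q ^ b := fun a b => zpow_add₀ h0 a b
  have hA : q ^ h ≠ 0 := zpow_ne_zero _ h0
  have hB : q ^ n ≠ 0 := zpow_ne_zero _ h0
  have key : (q ^ (n + 1) - q ^ (-(n + 1))) * (q ^ (h - n) - q ^ (-(h - n))) +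
      (q ^ (h - 2 * (n + 1)) - q ^ (-(h - 2 * (n + 1)))) * (q - q⁻¹) =
      (q ^ (n + 2) - q ^ (-(n + 2))) * (q ^ (h - (n + 1)) - q ^ (-(h - (n + 1)))) := by
    rw [show h - 2 * (n + 1) = h + (-n) + (-n) + (-1) + (-1) by ring,
      show n + 2 = n + 1 + 1 by ring]
    simp only [sub_eq_add_neg, neg_add, neg_neg, e1, zpow_neg, zpow_one]
    generalize q ^ h = A at *
    generalize q ^ n = B at *
    field_simp
    ring
  simp only [qz]
  rw [div_mul_div_comm, div_mul_div_comm, ← key, add_div, mul_div_mul_right _ _ h1]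

end QuantumInteger

/-! ### Divided powers -/

section DivPow

variable {k : Type*} [Field k] {R : Type*} [Ring R] [Algebra k R] {q : k}

@[simp] theorem divPow_zero (q : k) (x : R) : divPow q x 0 = 1 := by simp [divPow]

theorem IsGeneric.divPow_one (hq : IsGeneric q) (x : R) : divPow q x 1 = x := by
  simp [divPow, qFact_succ, hq.qz_one]

theorem IsGeneric.mul_divPow (hq : IsGeneric q) (x : R) (n : ℕ) :
    x * divPow q x n = qz q ((n : ℤ) + 1) • divPow q x (n + 1) := by
  have h1 := hq.qFact_ne_zero n
  have h2 : qz q ((n : ℤ) + 1) ≠ 0 := hq.qz_ne_zero (by omega)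
  rw [divPow, divPow, qFact_succ, smul_smul, mul_smul_comm, pow_succ']
  congr 1
  field_simp

/-- The Gaussian binomial coefficient, for `m ≤ n`. -/
noncomputable def qChoose (q : k) (n m : ℕ) : k := qFact q n / (qFact q m * qFact q (n - m))

theorem IsGeneric.qChoose_ne_zero (hq : IsGeneric q) (n m : ℕ) : qChoose q n m ≠ 0 :=
  div_ne_zero (hq.qFact_ne_zero _) (mul_ne_zero (hq.qFact_ne_zero _) (hq.qFact_ne_zero _))

theorem qChoose_symm (q : k) {n m : ℕ} (h : m ≤ n) : qChoose q n (n - m) = qChoose q n m := by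
  rw [qChoose, qChoose, Nat.sub_sub_self h, mul_comm]

theorem IsGeneric.divPow_mul_divPow (hq : IsGeneric q) (x : R) {m n : ℕ} (h : m ≤ n) :
    divPow q x m * divPow q x (n - m) = qChoose q n m • divPow q x n := by
  have h1 := hq.qFact_ne_zero n
  rw [divPow, divPow, divPow, qChoose, smul_mul_smul_comm, smul_smul, ← pow_add,
    Nat.add_sub_cancel' h]
  congr 1
  field_simp

theorem map_divPow {S : Type*} [Ring S] [Algebra k S] (f : R →ₐ[k] S) (q : k) (x : R) (n : ℕ) :
    f (divPow q x n) = divPow q (f x) n := by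
  simp [divPow]

end DivPow

/-! ### Integrable modules over quantum `sl₂` -/

section Sl2

variable {k : Type*} [Field k] {V : Type*} [AddCommGroup V] [Module k V]

/-- The operators `E`, `F` and the `ℤ`-grading by the subspaces `Wt h` make `V` an integrable
module over quantum `sl₂`: the grading records the eigenvalues `q ^ h` of `K`. -/
structure QuantumSl2 (q : k) (E F : Module.End k V) (Wt : ℤ → Submodule k V) : Prop where
  generic : IsGeneric q
  E_mem : ∀ {h : ℤ} {v : V}, v ∈ Wt h → E v ∈ Wt (h + 2)
  F_mem : ∀ {h : ℤ} {v : V}, v ∈ Wt h → F v ∈ Wt (h - 2)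
  comm : ∀ {h : ℤ} {v : V}, v ∈ Wt h → E (F v) = F (E v) + qz q h • v
  E_nilp : ∀ v : V, ∃ n : ℕ, (E ^ n) v = 0
  F_nilp : ∀ v : V, ∃ n : ℕ, (F ^ n) v = 0
  indep : iSupIndep Wt
  span : ⨆ h, Wt h = ⊤

namespace QuantumSl2

variable {q : k} {E F : Module.End k V} {Wt : ℤ → Submodule k V}

/-- The Chevalley involution exchanges `E` and `F` and negates weights. -/
theorem flip (S : QuantumSl2 q E F Wt) : QuantumSl2 q F E (fun h => Wt (-h)) where
  generic := S.generic
  E_mem {h v} hv := by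
    have := S.F_mem hv
    rwa [show -h - 2 = -(h + 2) by ring] at this
  F_mem {h v} hv := by
    have := S.E_mem hv
    rwa [show -h + 2 = -(h - 2) by ring] at this
  comm {h v} hv := by
    rw [S.comm hv, qz_neg]; simp
  E_nilp := S.F_nilp
  F_nilp := S.E_nilp
  indep := S.indep.comp neg_injective
  span := by
    rw [← S.span]
    exact (Equiv.neg ℤ).iSup_comp (g := Wt)

theorem divPow_eq_zero_iff (S : QuantumSl2 q E F Wt) (X : Module.End k V) (n : ℕ) (v : V) :
    divPow q X n v = 0 ↔ (X ^ n) v = 0 := by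
  simp [divPow, S.generic.qFact_ne_zero n]

theorem E_divPow (S : QuantumSl2 q E F Wt) (X : Module.End k V) (n : ℕ) (v : V) :
    X (divPow q X n v) = qz q ((n : ℤ) + 1) • divPow q X (n + 1) v := by
  rw [← Module.End.mul_apply, S.generic.mul_divPow, LinearMap.smul_apply]

theorem divPow_divPow (S : QuantumSl2 q E F Wt) (X : Module.End k V) {m n : ℕ} (h : m ≤ n)
    (v : V) : divPow q X m (divPow q X (n - m) v) = qChoose q n m • divPow q X n v := by
  rw [← Module.End.mul_apply, S.generic.divPow_mul_divPow _ h, LinearMap.smul_apply]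

theorem E_pow_mem (S : QuantumSl2 q E F Wt) {h : ℤ} {v : V} (hv : v ∈ Wt h) (n : ℕ) :
    (E ^ n) v ∈ Wt (h + 2 * n) := by
  induction n with
  | zero => simpa using hv
  | succ n ih =>
    rw [pow_succ', Module.End.mul_apply]
    have := S.E_mem ih
    rwa [show h + 2 * (n : ℤ) + 2 = h + 2 * ((n + 1 : ℕ) : ℤ) by push_cast; ring] at this

theorem divPow_E_mem (S : QuantumSl2 q E F Wt) {h : ℤ} {v : V} (hv : v ∈ Wt h) (n : ℕ) :
    divPow q E n v ∈ Wt (h + 2 * n) :=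
  (Wt _).smul_mem _ (S.E_pow_mem hv n)

theorem divPow_F_mem (S : QuantumSl2 q E F Wt) {h : ℤ} {v : V} (hv : v ∈ Wt h) (n : ℕ) :
    divPow q F n v ∈ Wt (h - 2 * n) := by
  have := S.flip.divPow_E_mem (h := -h) (v := v) (by simpa using hv) n
  rwa [show -(-h + 2 * (n : ℤ)) = h - 2 * n by ring] at this

/-- `E F^{(n+1)} = F^{(n+1)} E + F^{(n)} (h - n)` on the weight space of weight `h`. -/
theorem E_divPow_F (S : QuantumSl2 q E F Wt) {h : ℤ} {v : V} (hv : v ∈ Wt h) (n : ℕ) :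
    E (divPow q F (n + 1) v) = divPow q F (n + 1) (E v) + qz q (h - n) • divPow q F n v := by
  induction n with
  | zero =>
    simp [S.generic.divPow_one, S.comm hv]
  | succ n ih =>
    have hc : qz q ((n : ℤ) + 1 + 1) ≠ 0 := S.generic.qz_ne_zero (by omega)
    have hF := S.divPow_F_mem hv (n + 1)
    apply smul_right_injective V hc
    have key : qz q ((n : ℤ) + 1 + 1) • E (divPow q F (n + 1 + 1) v) =
        E (F (divPow q F (n + 1) v)) := by
      rw [S.E_divPow]; push_cast; rw [map_smul]
    show qz q ((n : ℤ) + 1 + 1) • E (divPow q F (n + 1 + 1) v) = qz q ((n : ℤ) + 1 + 1) • _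
    rw [key, S.comm hF, ih, map_add, S.E_divPow, map_smul, S.E_divPow, smul_add, smul_smul,
      smul_smul, add_assoc, ← add_smul]
    push_cast
    congr 2
    have := S.generic.qz_add_qz h n
    rw [show (n : ℤ) + 1 + 1 = n + 2 by ring, ← this]
    ring

/-- For a highest weight vector `v` of weight `n`, `E^{(m)} F^{(n)} v = F^{(n-m)} v`. -/
theorem divPow_E_divPow_F (S : QuantumSl2 q E F Wt) {n : ℕ} {v : V} (hv : v ∈ Wt n)
    (hE : E v = 0) {m : ℕ} (hm : m ≤ n) :
    divPow q E m (divPow q F n v) = divPow q F (n - m) v := by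
  induction m with
  | zero => simp
  | succ m ih =>
    have hc : qz q ((m : ℤ) + 1) ≠ 0 := S.generic.qz_ne_zero (by omega)
    apply smul_right_injective V hc
    show qz q ((m : ℤ) + 1) • _ = qz q ((m : ℤ) + 1) • _
    rw [← S.E_divPow, ih (by omega)]
    obtain ⟨j, rfl⟩ : ∃ j, n = m + 1 + j := ⟨n - (m + 1), by omega⟩
    rw [show m + 1 + j - m = j + 1 by omega, show m + 1 + j - (m + 1) = j by omega,
      S.E_divPow_F hv, hE, map_zero, zero_add]
    congr 2
    push_cast; ring

theorem divPow_F_divPow_E (S : QuantumSl2 q E F Wt) {n : ℕ} {v : V} (hv : v ∈ Wt (-n))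
    (hF : F v = 0) {m : ℕ} (hm : m ≤ n) :
    divPow q F m (divPow q E n v) = divPow q E (n - m) v :=
  S.flip.divPow_E_divPow_F hv hF hm

theorem divPow_E_divPow_F_self (S : QuantumSl2 q E F Wt) {n : ℕ} {v : V} (hv : v ∈ Wt n)
    (hE : E v = 0) : divPow q E n (divPow q F n v) = v := by
  rw [S.divPow_E_divPow_F hv hE le_rfl]; simp

/-- A nonzero highest weight vector of weight `h` generates a module of dimension `h + 1`. -/
theorem highest_weight (S : QuantumSl2 q E F Wt) {h : ℤ} {v : V} (hv : v ∈ Wt h)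
    (hE : E v = 0) (hv0 : v ≠ 0) :
    ∃ n : ℕ, h = n ∧ (F ^ (n + 1)) v = 0 ∧ ∀ m ≤ n, (F ^ m) v ≠ 0 := by
  classical
  have hex := S.F_nilp v
  obtain ⟨n, hn⟩ : ∃ n, Nat.find hex = n + 1 := by
    refine Nat.exists_eq_succ_of_ne_zero fun h0 => hv0 ?_
    simpa [h0] using Nat.find_spec hex
  have h1 : (F ^ (n + 1)) v = 0 := hn ▸ Nat.find_spec hex
  have h2 : ∀ m ≤ n, (F ^ m) v ≠ 0 := fun m hm => Nat.find_min hex (by omega)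
  refine ⟨n, ?_, h1, h2⟩
  have h3 := S.E_divPow_F hv n
  rw [(S.divPow_eq_zero_iff F _ v).2 h1, hE, map_zero, map_zero, zero_add, eq_comm,
    smul_eq_zero, S.divPow_eq_zero_iff] at h3
  by_contra hne
  exact S.generic.qz_ne_zero (n := h - n) (by omega) (h3.resolve_right (h2 n le_rfl))

theorem lowest_weight (S : QuantumSl2 q E F Wt) {h : ℤ} {v : V} (hv : v ∈ Wt h)
    (hF : F v = 0) (hv0 : v ≠ 0) :
    ∃ n : ℕ, h = -n ∧ (E ^ (n + 1)) v = 0 ∧ ∀ m ≤ n, (E ^ m) v ≠ 0 := by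
  obtain ⟨n, h1, h2⟩ := S.flip.highest_weight (h := -h) (by simpa using hv) hF hv0
  exact ⟨n, by omega, h2⟩

/-- `E F` is injective on the spaces of positive weight: otherwise `E^{(n)} y` would be nonzero for
all `n`. -/
theorem eq_zero_of_E_F_eq_zero (S : QuantumSl2 q E F Wt) {h : ℤ} (hh : 0 < h) {y : V}
    (hy : y ∈ Wt h) (hE : E (F y) = 0) : y = 0 := by
  by_contra hy0
  have key : ∀ n : ℕ, divPow q E n y ≠ 0 := by
    intro n
    induction n with
    | zero => simpa using hy0
    | succ n ih =>
      intro h0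
      have := S.flip.E_divPow_F (h := -h) (v := y) (by simpa using hy) n
      have h1 : divPow q E (n + 1) (F y) = 0 := by
        rw [S.divPow_eq_zero_iff, pow_succ, Module.End.mul_apply, hE, map_zero]
      rw [h0, map_zero, h1, zero_add, eq_comm, smul_eq_zero] at this
      exact this.elim (S.generic.qz_ne_zero (by omega)) ih
  obtain ⟨n, hn⟩ := S.E_nilp y
  exact key n ((S.divPow_eq_zero_iff E n y).2 hn)

/-- The lowest weight vectors of weight `-l`. -/
def lowest (F : Module.End k V) (Wt : ℤ → Submodule k V) (l : ℕ) : Submodule k V :=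
  Wt (-(l : ℤ)) ⊓ LinearMap.ker F

/-- The vectors `E^{(m)} u`, with `u` a lowest weight vector, which have weight `h`. -/
def strings (q : k) (E F : Module.End k V) (Wt : ℤ → Submodule k V) (h : ℤ) : Set V :=
  {x | ∃ m j : ℕ, (m : ℤ) - j = h ∧ ∃ u ∈ lowest F Wt (m + j), x = divPow q E m u}

theorem strings_subset (S : QuantumSl2 q E F Wt) (h : ℤ) : strings q E F Wt h ⊆ Wt h := by
  rintro _ ⟨m, j, rfl, u, hu, rfl⟩
  have := S.divPow_E_mem hu.1 m
  rwa [show -((m + j : ℕ) : ℤ) + 2 * (m : ℤ) = m - j by push_cast; ring] at this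

/-- Complete reducibility: every weight vector is a combination of vectors `E^{(m)} u` with `u`
a lowest weight vector. -/
theorem mem_span_strings (S : QuantumSl2 q E F Wt) {h : ℤ} {v : V} (hv : v ∈ Wt h) :
    v ∈ Submodule.span k (strings q E F Wt h) := by
  obtain ⟨n, hn⟩ := S.F_nilp v
  induction n generalizing h v with
  | zero => simp_all
  | succ n ih =>
    rw [pow_succ, Module.End.mul_apply] at hn
    have h1 := ih (S.F_mem hv) hn
    -- an element of `span (strings (h - 2))` is in the image of `F` up to highest weight vectors
    have h2 : ∃ s ∈ Submodule.span k (strings q E F Wt h), ∃ x, E x = 0 ∧ F v = F s + x := by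
      clear hn
      generalize F v = y at h1
      induction h1 using Submodule.span_induction with
      | mem y hy =>
        obtain ⟨m, j, hmj, u, hu, rfl⟩ := hy
        rcases j with _ | j
        · refine ⟨0, zero_mem _, _, ?_, by simp; rfl⟩
          by_cases hu0 : u = 0
          · simp [hu0]
          obtain ⟨n, hn1, hn2, -⟩ := S.lowest_weight hu.1 hu.2 hu0
          obtain rfl : m = n := by push_cast at hn1; omega
          rw [S.E_divPow, (S.divPow_eq_zero_iff E _ u).2 hn2, smul_zero]
        · have hc : qz q ((j : ℤ) + 1) ≠ 0 := S.generic.qz_ne_zero (by omega)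
          refine ⟨(qz q ((j : ℤ) + 1))⁻¹ • divPow q E (m + 1) u,
            Submodule.smul_mem _ _ (Submodule.subset_span ⟨m + 1, j, ?_, u, ?_, rfl⟩), 0,
            map_zero _, ?_⟩
          · push_cast at hmj ⊢; omega
          · rwa [show m + 1 + j = m + (j + 1) by ring]
          · have h3 := S.flip.E_divPow_F (h := ((m + (j + 1) : ℕ) : ℤ)) (v := u) hu.1 m
            have h4 : F u = 0 := hu.2
            rw [h4, map_zero, zero_add] at h3
            rw [map_smul, h3, smul_smul, add_zero,
              show (((m + (j + 1) : ℕ) : ℤ) - m) = j + 1 by push_cast; ring,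
              inv_mul_cancel₀ hc, one_smul]
      | zero => exact ⟨0, zero_mem _, 0, map_zero _, by simp⟩
      | add y z _ _ hy hz =>
        obtain ⟨s, hs, x, hx, rfl⟩ := hy
        obtain ⟨s', hs', x', hx', rfl⟩ := hz
        exact ⟨s + s', add_mem hs hs', x + x', by simp [hx, hx'], by
          rw [map_add]; abel⟩
      | smul c y _ hy =>
        obtain ⟨s, hs, x, hx, rfl⟩ := hy
        exact ⟨c • s, Submodule.smul_mem _ _ hs, c • x, by simp [hx], by simp⟩
    obtain ⟨s, hs, x, hx, hsx⟩ := h2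
    have hsW : s ∈ Wt h := (Submodule.span_le.2 (S.strings_subset h)) hs
    have hd : v - s ∈ Wt h := sub_mem hv hsW
    have hFd : F (v - s) = x := by rw [map_sub, hsx, add_sub_cancel_left]
    suffices v - s ∈ Submodule.span k (strings q E F Wt h) by
      simpa using add_mem this hs
    by_cases hd0 : v - s = 0
    · rw [hd0]; exact zero_mem _
    have hx0 : x = 0 := by
      by_cases hh : 0 < h
      · rw [← hFd, S.eq_zero_of_E_F_eq_zero hh hd (by rw [hFd, hx]), map_zero]
      · by_contra hx0
        obtain ⟨n, hn, -⟩ := S.highest_weight (hFd ▸ S.F_mem hd) hx hx0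
        omega
    obtain ⟨l, hl, -⟩ := S.lowest_weight hd (hFd.trans hx0) hd0
    refine Submodule.subset_span ⟨0, l, by simp [hl], v - s, ⟨?_, hFd.trans hx0⟩, by simp⟩
    simpa [← hl] using hd

theorem span_iUnion_strings (S : QuantumSl2 q E F Wt) :
    Submodule.span k (⋃ h, strings q E F Wt h) = ⊤ := by
  rw [eq_top_iff, ← S.span]
  exact iSup_le fun h v hv => Submodule.span_mono (Set.subset_iUnion _ h) (S.mem_span_strings hv)

theorem F_pow_divPow_E_of_lt (S : QuantumSl2 q E F Wt) {l m n : ℕ} {u : V}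
    (hu : u ∈ lowest F Wt l) (hml : m ≤ l) (hmn : m < n) : divPow q F n (divPow q E m u) = 0 := by
  have h1 := S.divPow_F_divPow_E hu.1 hu.2 (m := l - m) (by omega)
  rw [show l - (l - m) = m by omega] at h1
  rw [← h1]
  have h2 : (F ^ (l + 1)) (divPow q E l u) = 0 := by
    by_cases hu0 : u = 0
    · simp [hu0]
    obtain ⟨n, hn1, hn2, hn3⟩ := S.lowest_weight hu.1 hu.2 hu0
    obtain rfl : l = n := by omega
    rw [pow_succ', Module.End.mul_apply]
    have h3 := S.divPow_F_divPow_E hu.1 hu.2 le_rfl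
    rw [Nat.sub_self, divPow_zero, Module.End.one_apply] at h3
    have h4 : F (divPow q F l (divPow q E l u)) = 0 := by rw [h3]; exact hu.2
    rw [divPow, LinearMap.smul_apply, map_smul, smul_eq_zero] at h4
    exact h4.resolve_left (inv_ne_zero (S.generic.qFact_ne_zero _))
  rw [S.divPow_eq_zero_iff, divPow, LinearMap.smul_apply, map_smul, ← Module.End.mul_apply,
    ← pow_add, show n + (l - m) = (n - m - 1) + (l + 1) by omega, pow_add, Module.End.mul_apply,
    h2, map_zero, smul_zero]

theorem divPow_F_divPow_E_self (S : QuantumSl2 q E F Wt) {l m : ℕ} {u : V}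
    (hu : u ∈ lowest F Wt l) (hml : m ≤ l) :
    divPow q F m (divPow q E m u) = qChoose q l m • u := by
  have h1 := S.divPow_F_divPow_E hu.1 hu.2 (m := l - m) (by omega)
  rw [show l - (l - m) = m by omega] at h1
  rw [← h1, S.divPow_divPow F hml, S.divPow_F_divPow_E hu.1 hu.2 le_rfl]
  simp

/-! #### The involution -/

/-- The finitely supported families `(u_{m,j})` of lowest weight vectors, with `u_{m,j}` of weight
`-(m + j)`. The family encodes the vector `∑ E^{(m)} u_{m,j}`. -/
noncomputable def families (F : Module.End k V) (Wt : ℤ → Submodule k V) : Submodule k (ℕ × ℕ →₀ V) :=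
  ⨅ p : ℕ × ℕ, (lowest F Wt (p.1 + p.2)).comap (Finsupp.lapply p)

theorem mem_families {c : ℕ × ℕ →₀ V} :
    c ∈ families F Wt ↔ ∀ p, c p ∈ lowest F Wt (p.1 + p.2) := by
  simp [families, Submodule.mem_iInf]

/-- The linear map `(u_{m,j}) ↦ ∑ E^{(m)} u_{m,j}`. -/
noncomputable def assemble (q : k) (E F : Module.End k V) (Wt : ℤ → Submodule k V) :
    families F Wt →ₗ[k] V :=
  (Finsupp.lsum k fun p : ℕ × ℕ => divPow q E p.1).comp (families F Wt).subtype

theorem assemble_apply (c : families F Wt) :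
    assemble q E F Wt c = (c : ℕ × ℕ →₀ V).sum fun p u => divPow q E p.1 u := by
  simp [assemble]

theorem single_mem_families {m j : ℕ} {u : V} (hu : u ∈ lowest F Wt (m + j)) :
    Finsupp.single (m, j) u ∈ families F Wt := by
  rw [mem_families]
  intro p
  rw [Finsupp.single_apply]
  split_ifs with h
  · rw [← h]; exact hu
  · exact zero_mem _

theorem assemble_single {m j : ℕ} {u : V} (hu : u ∈ lowest F Wt (m + j)) :
    assemble q E F Wt ⟨_, single_mem_families hu⟩ = divPow q E m u := by
  rw [assemble_apply]
  exact Finsupp.sum_single_index (map_zero _)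

/-- The strings are independent: applying `F^{(K)}`, with `K` the largest power of `E` in a relation,
leaves the terms with `E^{(K)}` only, turned into lowest weight vectors of distinct weights. -/
theorem assemble_injective (S : QuantumSl2 q E F Wt) :
    Function.Injective (assemble q E F Wt) := by
  rw [← LinearMap.ker_eq_bot, LinearMap.ker_eq_bot']
  rintro ⟨c, hc⟩ h0
  rw [assemble_apply] at h0
  rw [mem_families] at hc
  by_contra hne
  have hs : c.support.Nonempty := by
    rw [Finsupp.support_nonempty_iff]; rintro rfl; exact hne rfl
  -- apply `F^{(K)}` with `K` the largest exponent which occurs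
  obtain ⟨p, hp, hmax⟩ := c.support.exists_max_image (fun p => p.1) hs
  have h1 : ∑ x ∈ c.support, divPow q F p.1 (divPow q E x.1 (c x)) = 0 := by
    have := congrArg (fun x => divPow q F p.1 x) h0
    rwa [Finsupp.sum, map_sum, map_zero] at this
  classical
  rw [← Finset.sum_filter_add_sum_filter_not c.support (fun x => x.1 = p.1),
    Finset.sum_eq_zero (s := c.support.filter fun x => ¬ x.1 = p.1), add_zero] at h1
  · have h2 : ∑ j ∈ (c.support.filter fun x => x.1 = p.1).image
        (fun x => -((x.1 + x.2 : ℕ) : ℤ)),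
        qChoose q (-j).toNat p.1 • c (p.1, (-j).toNat - p.1) = 0 := by
      rw [Finset.sum_image, ← h1]
      · refine Finset.sum_congr rfl fun x hx => ?_
        obtain ⟨-, hx⟩ := Finset.mem_filter.1 hx
        have := S.divPow_F_divPow_E_self (hc x) (Nat.le_add_right x.1 x.2)
        rw [← hx, this, neg_neg, Int.toNat_natCast, Nat.add_sub_cancel_left]
      · intro x hx y hy hxy
        have hx := (Finset.mem_filter.1 hx).2
        have hy := (Finset.mem_filter.1 hy).2
        simp only at hxy
        exact Prod.ext (hx.trans hy.symm) (by omega)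
    have h3 := (iSupIndep_iff_finsetSum_eq_zero_imp_eq_zero _).1 S.indep _ _ ?_ h2
      (-((p.1 + p.2 : ℕ) : ℤ)) (Finset.mem_image.2 ⟨p, by simp [Finsupp.mem_support_iff.1 hp],
        rfl⟩)
    · rw [neg_neg, Int.toNat_natCast, Nat.add_sub_cancel_left, smul_eq_zero] at h3
      exact h3.elim (S.generic.qChoose_ne_zero _ _) (Finsupp.mem_support_iff.1 hp)
    · intro j hj
      obtain ⟨x, hx, rfl⟩ := Finset.mem_image.1 hj
      obtain ⟨-, hx⟩ := Finset.mem_filter.1 hx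
      refine Submodule.smul_mem _ _ ?_
      rw [neg_neg, Int.toNat_natCast, ← hx, Nat.add_sub_cancel_left]
      exact (hc x).1
  · intro x hx
    obtain ⟨hx1, hx2⟩ := Finset.mem_filter.1 hx
    exact S.F_pow_divPow_E_of_lt (hc x) (Nat.le_add_right _ _) (lt_of_le_of_ne (hmax x hx1) hx2)

theorem assemble_surjective (S : QuantumSl2 q E F Wt) :
    Function.Surjective (assemble q E F Wt) := by
  rw [← LinearMap.range_eq_top, eq_top_iff, ← S.span_iUnion_strings, Submodule.span_le]
  rintro x hx
  obtain ⟨h, m, j, rfl, u, hu, rfl⟩ := Set.mem_iUnion.1 hx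
  exact ⟨_, assemble_single hu⟩

/-- The exchange `u_{m,j} ↔ u_{j,m}`. -/
noncomputable def swapFamilies (F : Module.End k V) (Wt : ℤ → Submodule k V) :
    families F Wt ≃ₗ[k] families F Wt :=
  (Finsupp.domLCongr (Equiv.prodComm ℕ ℕ)).ofSubmodules _ _ (by
    ext c
    constructor
    · rintro ⟨c, hc, rfl⟩
      refine mem_families.2 fun p => ?_
      have := mem_families.1 hc p.swap
      simpa [add_comm] using this
    · intro hc
      refine ⟨Finsupp.domLCongr (R := k) (Equiv.prodComm ℕ ℕ) c, mem_families.2 fun p => ?_, ?_⟩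
      · have := mem_families.1 hc p.swap
        simpa [add_comm] using this
      · ext p; simp)

theorem swapFamilies_swapFamilies (c : families F Wt) :
    swapFamilies F Wt (swapFamilies F Wt c) = c := by
  apply Subtype.ext
  ext p
  simp [swapFamilies]

/-- The involution `σ` of an integrable module, which turns each `sl₂`-string upside down. -/
noncomputable def sigma (S : QuantumSl2 q E F Wt) : V ≃ₗ[k] V :=
  let e := LinearEquiv.ofBijective _ ⟨S.assemble_injective, S.assemble_surjective⟩
  e.symm.trans ((swapFamilies F Wt).trans e)

theorem sigma_sigma (S : QuantumSl2 q E F Wt) (v : V) : S.sigma (S.sigma v) = v := by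
  simp [sigma, swapFamilies_swapFamilies]

theorem sigma_string (S : QuantumSl2 q E F Wt) {m j : ℕ} {u : V}
    (hu : u ∈ lowest F Wt (m + j)) : S.sigma (divPow q E m u) = divPow q E j u := by
  have hu' : u ∈ lowest F Wt (j + m) := by rwa [add_comm]
  have h1 : swapFamilies F Wt ⟨_, single_mem_families hu⟩ = ⟨_, single_mem_families hu'⟩ := by
    apply Subtype.ext
    simp [swapFamilies, Finsupp.domLCongr]
  rw [sigma, ← assemble_single hu, ← assemble_single hu', ← h1]
  simp only [LinearEquiv.trans_apply]
  have h2 : (LinearEquiv.ofBijective _ ⟨S.assemble_injective, S.assemble_surjective⟩).symm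
      (assemble q E F Wt ⟨_, single_mem_families hu⟩) = ⟨_, single_mem_families hu⟩ :=
    (LinearEquiv.symm_apply_eq _).2 rfl
  rw [h2]; rfl

/-- A linear map is determined by its values on the vectors `E^{(m)} u`. -/
theorem ext_strings (S : QuantumSl2 q E F Wt) {f g : V →ₗ[k] V}
    (hfg : ∀ m j : ℕ, ∀ u ∈ lowest F Wt (m + j), f (divPow q E m u) = g (divPow q E m u)) :
    f = g := by
  refine LinearMap.ext_on S.span_iUnion_strings fun x hx => ?_
  obtain ⟨h, m, j, rfl, u, hu, rfl⟩ := Set.mem_iUnion.1 hx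
  exact hfg m j u hu

theorem sigma_highest (S : QuantumSl2 q E F Wt) {n : ℕ} {v : V} (hv : v ∈ Wt n) (hE : E v = 0) :
    S.sigma v = divPow q F n v := by
  have h1 := S.divPow_E_divPow_F_self hv hE
  have hmem : divPow q F n v ∈ lowest F Wt (n + 0) := by
    constructor
    · have := S.divPow_F_mem hv n
      rwa [show (n : ℤ) - 2 * n = -((n + 0 : ℕ) : ℤ) by push_cast; ring] at this
    · by_cases hv0 : v = 0
      · simp [hv0]
      obtain ⟨m, hm1, hm2, -⟩ := S.highest_weight hv hE hv0
      obtain rfl : n = m := by omega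
      rw [SetLike.mem_coe, LinearMap.mem_ker, S.E_divPow F, (S.divPow_eq_zero_iff F _ v).2 hm2, smul_zero]
  have := S.sigma_string hmem
  rw [h1] at this
  simpa using this

/-! #### Injectivity of divided powers -/

/-- `E^{(n)}` is injective on the weight space of weight `-n`. -/
theorem divPow_E_injective (S : QuantumSl2 q E F Wt) {n : ℕ} {v : V} (hv : v ∈ Wt (-n))
    (h0 : divPow q E n v = 0) : v = 0 := by
  -- `v = ∑ E^{(m)} u_m`, with `u_m` a lowest weight vector of weight `-(2m + n)`
  obtain ⟨c, hc, rfl⟩ : ∃ c : ℕ →₀ V, (∀ m, c m ∈ lowest F Wt (m + (m + n))) ∧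
      (c.sum fun m u => divPow q E m u) = v := by
    have h1 := S.mem_span_strings hv
    clear h0 hv
    induction h1 using Submodule.span_induction with
    | mem x hx =>
      obtain ⟨m, j, hmj, u, hu, rfl⟩ := hx
      obtain rfl : j = m + n := by omega
      refine ⟨Finsupp.single m u, fun m' => ?_,
        Finsupp.sum_single_index (h := fun m u => divPow q E m u) (map_zero _)⟩
      rw [Finsupp.single_apply]
      split_ifs with h
      · rw [← h]; exact hu
      · exact zero_mem _
    | zero => exact ⟨0, fun _ => zero_mem _, by simp⟩
    | add x y _ _ hx hy =>
      obtain ⟨c, hc, rfl⟩ := hx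
      obtain ⟨d, hd, rfl⟩ := hy
      exact ⟨c + d, fun m => add_mem (hc m) (hd m),
        Finsupp.sum_add_index' (h := fun m u => divPow q E m u) (by simp) (by simp)⟩
    | smul a x _ hx =>
      obtain ⟨c, hc, rfl⟩ := hx
      refine ⟨a • c, fun m => Submodule.smul_mem _ a (hc m), ?_⟩
      rw [Finsupp.sum_smul_index' (h := fun m u => divPow q E m u) (by simp), Finsupp.smul_sum]
      simp
  by_contra hne
  have hs : c.support.Nonempty := by
    rw [Finsupp.support_nonempty_iff]; rintro rfl; exact hne (by simp)
  obtain ⟨K, hK, hmax⟩ := c.support.exists_max_image id hs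
  have hE : ∀ m, divPow q E n (divPow q E m (c m)) =
      qChoose q (m + n) n • divPow q E (m + n) (c m) := fun m => by
    have := S.divPow_divPow E (Nat.le_add_left n m) (c m)
    rwa [Nat.add_sub_cancel] at this
  have h1 : divPow q F (K + n) (divPow q E n (divPow q E K (c K))) = 0 := by
    rw [← map_zero (divPow q F (K + n)), ← h0, Finsupp.sum, map_sum, map_sum]
    symm
    apply Finset.sum_eq_single_of_mem K hK
    intro m hm hmK
    have hlt : m < K := lt_of_le_of_ne (hmax m hm) hmK
    rw [hE, map_smul, S.F_pow_divPow_E_of_lt (hc m) (by omega)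
      (Nat.add_lt_add_right hlt n), smul_zero]
  rw [hE, map_smul, S.divPow_F_divPow_E_self (hc K) (by omega), smul_eq_zero, smul_eq_zero] at h1
  exact (h1.resolve_left (S.generic.qChoose_ne_zero _ _)).elim (S.generic.qChoose_ne_zero _ _)
    (Finsupp.mem_support_iff.1 hK)

/-- `F^{(n)}` is injective on the weight space of weight `n`. -/
theorem divPow_F_injective (S : QuantumSl2 q E F Wt) {n : ℕ} {v : V} (hv : v ∈ Wt n)
    (h0 : divPow q F n v = 0) : v = 0 :=
  S.flip.divPow_E_injective (by simpa using hv) h0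

/-- If `y` has weight `m - 2 j` and `E^{(j)} y` is a highest weight vector, then `F^{(m-j)}` moves `y`
down to weight `-m` and `E^{(m)}` brings it back to the top of the string. The components of `y` on
shorter strings do not contribute. -/
theorem divPow_E_divPow_F_of_string (S : QuantumSl2 q E F Wt) {m j : ℕ} (hj : j ≤ m) {y : V}
    (hy : y ∈ Wt ((m : ℤ) - 2 * j)) (hE : (E ^ (j + 1)) y = 0) :
    divPow q E m (divPow q F (m - j) y) = divPow q E j y := by
  set z := divPow q E j y with hz
  have hzW : z ∈ Wt m := by
    have := S.divPow_E_mem hy j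
    rwa [show (m : ℤ) - 2 * j + 2 * j = m by ring] at this
  have hEz : E z = 0 := by
    rw [hz, S.E_divPow, (S.divPow_eq_zero_iff E _ y).2 hE, smul_zero]
  -- `y` differs from a multiple of `F^{(j)} z` by a vector killed by `E^j`
  have hc := S.generic.qChoose_ne_zero m j
  have h1 : divPow q E j (divPow q F j z) = qChoose q m j • z := by
    have := S.divPow_E_divPow_F hzW hEz (m := m - j) (by omega)
    rw [show m - (m - j) = j by omega] at this
    rw [← this, S.divPow_divPow E hj, S.divPow_E_divPow_F_self hzW hEz]
  have h2 : divPow q F (m - j) (divPow q F j z) = qChoose q m j • divPow q F m z := by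
    have := S.divPow_divPow F (m := m - j) (n := m) (by omega) z
    rwa [show m - (m - j) = j by omega, qChoose_symm q hj] at this
  have kill : ∀ n : ℕ, ∀ i : ℕ, ∀ h : ℤ, ∀ x ∈ Wt h, (E ^ i) x = 0 → (E ^ (i + n)) ((F ^ n) x) = 0 := by
    intro n
    induction n with
    | zero => intro i h x _ hx; simpa using hx
    | succ n ih =>
      intro i h x hx hEx
      rw [pow_succ F, Module.End.mul_apply, show i + (n + 1) = i + 1 + n by ring]
      refine ih (i + 1) _ _ (S.F_mem hx) ?_
      rw [← S.divPow_eq_zero_iff] at hEx ⊢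
      have h3 := S.flip.E_divPow_F (h := -h) (v := x) (by simpa using hx) i
      have h4 : divPow q E (i + 1) x = 0 := by
        rw [S.divPow_eq_zero_iff] at hEx ⊢
        rw [pow_succ', Module.End.mul_apply, hEx, map_zero]
      rw [h4, hEx, map_zero, smul_zero, add_zero] at h3
      exact h3.symm
  set w := y - (qChoose q m j)⁻¹ • divPow q F j z with hw
  have hwW : w ∈ Wt ((m : ℤ) - 2 * j) := sub_mem hy (Submodule.smul_mem _ _ (S.divPow_F_mem hzW j))
  have hwE : (E ^ j) w = 0 := by
    rw [← S.divPow_eq_zero_iff, hw, map_sub, map_smul, h1, smul_smul, inv_mul_cancel₀ hc,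
      one_smul, ← hz, sub_self]
  have h3 : divPow q E m (divPow q F (m - j) w) = 0 := by
    rw [S.divPow_eq_zero_iff, divPow, LinearMap.smul_apply, map_smul]
    have := kill (m - j) j _ w hwW hwE
    rw [Nat.add_sub_cancel' hj] at this
    rw [this, smul_zero]
  rw [hw, map_sub, map_sub, map_smul, map_smul, h2, map_smul, S.divPow_E_divPow_F_self hzW hEz,
    smul_smul, inv_mul_cancel₀ hc, one_smul, sub_eq_zero] at h3
  exact h3

end QuantumSl2

end Sl2

end CrystalWeyl

namespace CrystalWeyl

/-! ### The Weyl group and the root system -/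

section Weyl

variable {I : Type*} {h : Type*} [AddCommGroup h] [Module ℂ h] (D : CartanDatum I h)

/-- The simple reflection as an endomorphism of `h^*`. -/
def reflectHom (i : I) : Module.End ℂ (Module.Dual ℂ h) where
  toFun := reflect D i
  map_add' x y := by simp only [reflect, LinearMap.add_apply]; module
  map_smul' c x := by simp only [reflect, LinearMap.smul_apply, RingHom.id_apply, smul_eq_mul]; module

theorem reflectHom_apply (i : I) (lam : Module.Dual ℂ h) :
    reflectHom D i lam = lam - lam (D.coroot i) • D.root i := rfl

theorem reflectHom_root_self (i : I) : reflectHom D i (D.root i) = -D.root i := by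
  rw [reflectHom_apply, D.root_coroot, D.a_self]
  push_cast; module

theorem reflectHom_reflectHom (i : I) (lam : Module.Dual ℂ h) :
    reflectHom D i (reflectHom D i lam) = lam := by
  rw [reflectHom_apply D i lam, map_sub, map_smul, reflectHom_root_self, reflectHom_apply]
  module

theorem reflectHom_add_left (i j : I) (lam : Module.Dual ℂ h) (x y : ℂ) :
    reflectHom D i (lam + x • D.root i + y • D.root j) =
      lam + (-x - lam (D.coroot i) - D.a i j * y) • D.root i + y • D.root j := by
  simp only [reflectHom_apply, LinearMap.add_apply, LinearMap.smul_apply, D.root_coroot, D.a_self,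
    smul_eq_mul]
  push_cast; module

theorem reflectHom_add_right (i j : I) (lam : Module.Dual ℂ h) (x y : ℂ) :
    reflectHom D j (lam + x • D.root i + y • D.root j) =
      lam + x • D.root i + (-y - lam (D.coroot j) - D.a j i * x) • D.root j := by
  rw [add_right_comm, reflectHom_add_left, add_right_comm]

/-- The four kinds of rank two Cartan matrices of finite type, and the others. -/
theorem cartan_cases {i j : I} (hij : i ≠ j) :
    (D.a i j = 0 ∧ D.a j i = 0 ∧ (coxeterMatrix D) i j = 2) ∨
    (D.a i j = -1 ∧ D.a j i = -1 ∧ (coxeterMatrix D) i j = 3) ∨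
    (D.a i j = -1 ∧ D.a j i = -2 ∧ (coxeterMatrix D) i j = 4) ∨
    (D.a i j = -2 ∧ D.a j i = -1 ∧ (coxeterMatrix D) i j = 4) ∨
    (D.a i j = -1 ∧ D.a j i = -3 ∧ (coxeterMatrix D) i j = 6) ∨
    (D.a i j = -3 ∧ D.a j i = -1 ∧ (coxeterMatrix D) i j = 6) ∨
    (4 ≤ D.a i j * D.a j i ∧ (coxeterMatrix D) i j = 0) := by
  have h1 := D.a_nonpos i j hij
  have h2 := D.a_nonpos j i hij.symm
  have hM : (coxeterMatrix D) i j = coxeterEntry (D.a i j * D.a j i) := by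
    simp [coxeterMatrix, hij]
  rw [hM]
  by_cases h0 : D.a i j = 0
  · have := D.a_zero i j h0
    left; simp [h0, this, coxeterEntry]
  have h0' : D.a j i ≠ 0 := fun h => h0 (D.a_zero j i h)
  generalize D.a i j = A at *
  generalize D.a j i = B at *
  by_cases h4 : 4 ≤ A * B
  · iterate 6 right
    refine ⟨h4, ?_⟩
    unfold coxeterEntry
    rw [if_neg, if_neg, if_neg, if_neg] <;> omega
  · have hA : -3 ≤ A := by nlinarith [show A ≤ -1 by omega, show B ≤ -1 by omega]
    have hB : -3 ≤ B := by nlinarith [show A ≤ -1 by omega, show B ≤ -1 by omega]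
    interval_cases A <;> interval_cases B <;> simp_all [coxeterEntry]

theorem reflectHom_isLiftable : (coxeterMatrix D).IsLiftable (reflectHom D) := by
  intro i j
  by_cases hij : i = j
  · subst hij
    rw [(coxeterMatrix D).diagonal, pow_one]
    ext1 lam
    exact reflectHom_reflectHom D i lam
  · have base : ∀ lam : Module.Dual ℂ h, lam = lam + (0 : ℂ) • D.root i + (0 : ℂ) • D.root j :=
      fun lam => by simp
    rcases cartan_cases D hij with ⟨h1, h2, h3⟩ | ⟨h1, h2, h3⟩ | ⟨h1, h2, h3⟩ | ⟨h1, h2, h3⟩ |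
      ⟨h1, h2, h3⟩ | ⟨h1, h2, h3⟩ | ⟨h1, h3⟩ <;> rw [h3]
    on_goal 7 => exact pow_zero _
    all_goals
      ext1 lam
      rw [Module.End.one_apply]
      conv_lhs => rw [base lam]
      simp only [pow_succ, pow_zero, one_mul, Module.End.mul_apply, reflectHom_add_left,
        reflectHom_add_right, h1, h2]
      conv_rhs => rw [base lam]
      congr 3 <;> push_cast <;> ring

/-- The action of the Weyl group on `h^*`. -/
noncomputable def act : WeylGroup D →* Module.End ℂ (Module.Dual ℂ h) :=
  (weyl D).lift ⟨reflectHom D, reflectHom_isLiftable D⟩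

theorem act_simple (i : I) : act D ((weyl D).simple i) = reflectHom D i :=
  (weyl D).lift_apply_simple _ i

theorem act_simple_mul (i : I) (w : WeylGroup D) (lam : Module.Dual ℂ h) :
    act D ((weyl D).simple i * w) lam = reflectHom D i (act D w lam) := by
  rw [map_mul, act_simple, Module.End.mul_apply]

theorem act_mul_apply (w w' : WeylGroup D) (lam : Module.Dual ℂ h) :
    act D (w * w') lam = act D w (act D w' lam) := by
  rw [map_mul, Module.End.mul_apply]

theorem act_inv_act (w : WeylGroup D) (lam : Module.Dual ℂ h) :
    act D w⁻¹ (act D w lam) = lam := by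
  rw [← act_mul_apply, inv_mul_cancel, map_one, Module.End.one_apply]

theorem reflectWord_eq (om : List I) (lam : Module.Dual ℂ h) :
    reflectWord D om lam = act D ((weyl D).wordProd om) lam := by
  induction om with
  | nil => simp [reflectWord]
  | cons i om ih =>
    rw [(weyl D).wordProd_cons, act_simple_mul, ← ih]; rfl

/-- The monoid `Q₊` of nonnegative integral combinations of simple roots. -/
def Qplus : AddSubmonoid (Module.Dual ℂ h) := AddSubmonoid.closure (Set.range D.root)

theorem root_mem_Qplus (i : I) : D.root i ∈ Qplus D := AddSubmonoid.subset_closure ⟨i, rfl⟩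

/-- Coordinates with respect to the simple roots, extended to `h^*`. -/
theorem exists_coord (i : I) :
    ∃ f : Module.Dual ℂ h →ₗ[ℂ] ℂ, f (D.root i) = 1 ∧ ∀ j, j ≠ i → f (D.root j) = 0 := by
  classical
  let b := Module.Basis.extend D.root_indep.linearIndepOn_id
  refine ⟨b.coord ⟨D.root i, D.root_indep.linearIndepOn_id.subset_extend _ ⟨i, rfl⟩⟩, ?_, ?_⟩
  · have := b.coord_apply ⟨D.root i, D.root_indep.linearIndepOn_id.subset_extend _ ⟨i, rfl⟩⟩
      (b ⟨D.root i, D.root_indep.linearIndepOn_id.subset_extend _ ⟨i, rfl⟩⟩)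
    rw [Module.Basis.repr_self, Finsupp.single_eq_same] at this
    rw [← this]; simp [b]
  · intro j hj
    have := b.coord_apply ⟨D.root i, D.root_indep.linearIndepOn_id.subset_extend _ ⟨i, rfl⟩⟩
      (b ⟨D.root j, D.root_indep.linearIndepOn_id.subset_extend _ ⟨j, rfl⟩⟩)
    rw [Module.Basis.repr_self, Finsupp.single_eq_of_ne] at this
    · rw [← this]; simp [b]
    · intro h; exact hj (D.root_indep.injective (congrArg Subtype.val h)).symm

/-- A linear form on `h^*` which takes the value `1` on `α_i` and `0` on the other simple roots; on
the span of the simple roots it is the coefficient of `α_i`. -/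
noncomputable def coord (i : I) : Module.Dual ℂ h →ₗ[ℂ] ℂ := (exists_coord D i).choose

@[simp] theorem coord_root_self (i : I) : coord D i (D.root i) = 1 := (exists_coord D i).choose_spec.1

theorem coord_root_of_ne {i j : I} (hij : j ≠ i) : coord D i (D.root j) = 0 :=
  (exists_coord D i).choose_spec.2 j hij

theorem coord_of_mem_Qplus (i : I) {x : Module.Dual ℂ h} (hx : x ∈ Qplus D) :
    ∃ n : ℕ, coord D i x = n := by
  induction hx using AddSubmonoid.closure_induction with
  | mem x hx =>
    obtain ⟨j, rfl⟩ := hx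
    by_cases hij : j = i
    · exact ⟨1, by simp [hij]⟩
    · exact ⟨0, by simp [coord_root_of_ne D hij]⟩
  | zero => exact ⟨0, by simp⟩
  | add x y _ _ hx hy =>
    obtain ⟨n, hn⟩ := hx
    obtain ⟨m, hm⟩ := hy
    exact ⟨n + m, by simp [hn, hm]⟩

theorem eq_zero_of_mem_Qplus {x : Module.Dual ℂ h} (hx : x ∈ Qplus D)
    (h0 : ∀ i, coord D i x = 0) : x = 0 := by
  by_contra hne
  have : ∀ y ∈ Qplus D, y ≠ 0 → ∃ i, coord D i y ≠ 0 := by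
    intro y hy
    induction hy using AddSubmonoid.closure_induction with
    | mem y hy => obtain ⟨j, rfl⟩ := hy; exact fun _ => ⟨j, by simp⟩
    | zero => exact fun h => absurd rfl h
    | add y z hy hz ihy ihz =>
      intro hyz
      have : y ≠ 0 ∨ z ≠ 0 := by
        by_contra hc; push Not at hc; exact hyz (by rw [hc.1, hc.2, add_zero])
      have sum_ne : ∀ i, coord D i y ≠ 0 ∨ coord D i z ≠ 0 → coord D i (y + z) ≠ 0 := by
        intro i hi
        obtain ⟨n, hn⟩ := coord_of_mem_Qplus D i hy
        obtain ⟨m, hm⟩ := coord_of_mem_Qplus D i hz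
        rw [map_add, hn, hm]
        rw [hn, hm] at hi
        norm_cast at hi ⊢
        omega
      rcases this with h | h
      · obtain ⟨i, hi⟩ := ihy h; exact ⟨i, sum_ne i (Or.inl hi)⟩
      · obtain ⟨i, hi⟩ := ihz h; exact ⟨i, sum_ne i (Or.inr hi)⟩
  obtain ⟨i, hi⟩ := this x hx hne
  exact hi (h0 i)

theorem eq_zero_of_mem_Qplus_of_neg_mem {x : Module.Dual ℂ h} (hx : x ∈ Qplus D)
    (hx' : -x ∈ Qplus D) : x = 0 := by
  refine eq_zero_of_mem_Qplus D hx fun i => ?_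
  obtain ⟨n, hn⟩ := coord_of_mem_Qplus D i hx
  obtain ⟨m, hm⟩ := coord_of_mem_Qplus D i hx'
  rw [map_neg, hn] at hm
  have : (n : ℤ) + m = 0 := by
    have : ((n : ℂ) + m) = 0 := by rw [← hm]; ring
    exact_mod_cast this
  rw [hn]; norm_cast; omega

theorem act_root_ne_zero (w : WeylGroup D) (i : I) : act D w (D.root i) ≠ 0 := by
  intro h0
  have := act_inv_act D w (D.root i)
  rw [h0, map_zero] at this
  exact D.root_indep.ne_zero i this.symm

/-! #### Dihedral subgroups -/

/-- The coefficients of `… s_i s_t α_i` (with `n` reflections) on `α_i` and `α_t`, where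
`A = -a_{it}` and `B = -a_{ti}`. -/
def dihedral (A B : ℤ) : ℕ → ℤ × ℤ
  | 0 => (1, 0)
  | n + 1 => if Even n then ((dihedral A B n).1, B * (dihedral A B n).1 - (dihedral A B n).2)
      else (A * (dihedral A B n).2 - (dihedral A B n).1, (dihedral A B n).2)

theorem act_alternatingWord_root (i t : I) (n : ℕ) :
    act D ((weyl D).wordProd (CoxeterSystem.alternatingWord i t n)) (D.root i) =
      ((dihedral (-D.a i t) (-D.a t i) n).1 : ℂ) • D.root i +
      ((dihedral (-D.a i t) (-D.a t i) n).2 : ℂ) • D.root t := by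
  induction n with
  | zero => simp [CoxeterSystem.alternatingWord, dihedral]
  | succ n ih =>
    rw [CoxeterSystem.alternatingWord_succ', (weyl D).wordProd_cons, act_simple_mul, ih, dihedral]
    split_ifs with hn
    · have := reflectHom_add_right D i t 0 ((dihedral (-D.a i t) (-D.a t i) n).1 : ℂ)
        ((dihedral (-D.a i t) (-D.a t i) n).2 : ℂ)
      rw [zero_add, LinearMap.zero_apply] at this
      rw [this]
      push_cast; module
    · have := reflectHom_add_left D i t 0 ((dihedral (-D.a i t) (-D.a t i) n).1 : ℂ)
        ((dihedral (-D.a i t) (-D.a t i) n).2 : ℂ)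
      rw [zero_add, LinearMap.zero_apply] at this
      rw [this]
      push_cast; module

/-- In an infinite dihedral group the coefficients stay nonnegative; the induction also needs the
inequality between them that makes the next reflection increase one of them. -/
theorem dihedral_nonneg_of_four_le {A B : ℤ} (hA : 0 ≤ A) (hB : 0 ≤ B) (hAB : 4 ≤ A * B) (n : ℕ) :
    0 ≤ (dihedral A B n).1 ∧ 0 ≤ (dihedral A B n).2 ∧
      (if Even n then A * (dihedral A B n).2 ≤ 2 * (dihedral A B n).1
        else B * (dihedral A B n).1 ≤ 2 * (dihedral A B n).2) := by
  induction n with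
  | zero => simp [dihedral]
  | succ n ih =>
    obtain ⟨h1, h2, h3⟩ := ih
    rw [dihedral]
    by_cases hn : Even n
    · rw [if_pos hn] at h3 ⊢
      rw [if_neg (by simpa [Nat.even_add_one] using hn)]
      generalize (dihedral A B n).1 = p at *
      generalize (dihedral A B n).2 = s at *
      have h4 : B * (A * s) ≤ B * (2 * p) := mul_le_mul_of_nonneg_left h3 hB
      have h5 : 4 * s ≤ A * B * s := mul_le_mul_of_nonneg_right hAB h2
      refine ⟨h1, ?_, ?_⟩ <;> simp only <;> nlinarith
    · rw [if_neg hn] at h3 ⊢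
      rw [if_pos (by simpa [Nat.even_add_one] using hn)]
      generalize (dihedral A B n).1 = p at *
      generalize (dihedral A B n).2 = s at *
      have h4 : A * (B * p) ≤ A * (2 * s) := mul_le_mul_of_nonneg_left h3 hA
      have h5 : 4 * p ≤ A * B * p := mul_le_mul_of_nonneg_right hAB h1
      refine ⟨?_, h2, ?_⟩ <;> simp only <;> nlinarith

/-- Within a reduced alternating word the images of `α_i` are nonnegative combinations of `α_i` and
`α_t`. -/
theorem dihedral_nonneg {i t : I} (hit : i ≠ t) {n : ℕ}
    (hn : (coxeterMatrix D) i t = 0 ∨ n < (coxeterMatrix D) i t) :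
    0 ≤ (dihedral (-D.a i t) (-D.a t i) n).1 ∧ 0 ≤ (dihedral (-D.a i t) (-D.a t i) n).2 := by
  rcases cartan_cases D hit with ⟨h1, h2, h3⟩ | ⟨h1, h2, h3⟩ | ⟨h1, h2, h3⟩ | ⟨h1, h2, h3⟩ |
      ⟨h1, h2, h3⟩ | ⟨h1, h2, h3⟩ | ⟨h1, h3⟩ <;> rw [h3] at hn
  on_goal 7 =>
    have ha := D.a_nonpos i t hit
    have hb := D.a_nonpos t i hit.symm
    have := dihedral_nonneg_of_four_le (A := -D.a i t) (B := -D.a t i) (by omega) (by omega)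
      (by rw [neg_mul_neg]; exact h1) n
    exact ⟨this.1, this.2.1⟩
  all_goals
    rw [h1, h2]
    have hn := hn.resolve_left (by norm_num)
    interval_cases n <;> simp [dihedral, Nat.even_add_one]

/-- Every `w` with right descent `t` is a reduced product of some `v`, of which neither `i` nor `t` is
a right descent, and a nonempty alternating word in `i` and `t` ending with `t`. -/
theorem exists_maximal_alternating_suffix {w : WeylGroup D} (i : I) {t : I}
    (ht : (weyl D).IsRightDescent w t) :
    ∃ (n : ℕ) (v : WeylGroup D), 1 ≤ n ∧
      w = v * (weyl D).wordProd (CoxeterSystem.alternatingWord i t n) ∧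
      (weyl D).length w = (weyl D).length v + n ∧
      ¬ (weyl D).IsRightDescent v i ∧ ¬ (weyl D).IsRightDescent v t := by
  classical
  set cs := weyl D
  let p : ℕ → Prop := fun n =>
    cs.length (w * (cs.wordProd (CoxeterSystem.alternatingWord i t n))⁻¹) + n = cs.length w
  have hp1 : p 1 := by
    have := cs.isRightDescent_iff.1 ht
    simpa [p, CoxeterSystem.alternatingWord] using this
  have hbd : ∀ n, p n → n ≤ cs.length w := fun n hn => by simp only [p] at hn; omega
  set n := Nat.findGreatest p (cs.length w) with hn
  have hpn : p n := Nat.findGreatest_spec (hbd 1 hp1) hp1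
  have hmax : ¬ p (n + 1) := fun hc => by
    have := Nat.le_findGreatest (hbd _ hc) hc
    omega
  have h1n : 1 ≤ n := Nat.le_findGreatest (hbd 1 hp1) hp1
  refine ⟨n, w * (cs.wordProd (CoxeterSystem.alternatingWord i t n))⁻¹, h1n, by simp, hpn.symm, ?_⟩
  set v := w * (cs.wordProd (CoxeterSystem.alternatingWord i t n))⁻¹ with hv
  have hpn' : cs.length v + n = cs.length w := hpn
  have hy : ¬ cs.IsRightDescent v (if Even n then t else i) := by
    intro hc
    apply hmax
    have h1 := cs.isRightDescent_iff.1 hc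
    simp only [p]
    rw [CoxeterSystem.alternatingWord_succ', cs.wordProd_cons, mul_inv_rev, cs.inv_simple,
      ← mul_assoc, ← hv]
    omega
  have hx : ¬ cs.IsRightDescent v (if Even (n - 1) then t else i) := by
    intro hc
    have h1 := cs.isRightDescent_iff.1 hc
    have h2 : w = v * cs.simple (if Even (n - 1) then t else i) *
        cs.wordProd (CoxeterSystem.alternatingWord i t (n - 1)) := by
      rw [mul_assoc, ← cs.wordProd_cons, ← CoxeterSystem.alternatingWord_succ',
        Nat.sub_add_cancel h1n]
      simp [hv]
    have h3 := cs.length_mul_le (v * cs.simple (if Even (n - 1) then t else i))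
      (cs.wordProd (CoxeterSystem.alternatingWord i t (n - 1)))
    have h4 := cs.length_wordProd_le (CoxeterSystem.alternatingWord i t (n - 1))
    rw [CoxeterSystem.length_alternatingWord] at h4
    rw [← h2] at h3
    omega
  by_cases he : Even n
  · have : ¬ Even (n - 1) := by
      rw [Nat.even_sub h1n]; simp [he]
    rw [if_pos he] at hy
    rw [if_neg this] at hx
    exact ⟨hx, hy⟩
  · have : Even (n - 1) := by
      rw [Nat.even_sub h1n]; simp [he]
    rw [if_neg he] at hy
    rw [if_pos this] at hx
    exact ⟨hy, hx⟩

/-- If `ℓ(w s_i) > ℓ(w)`, then `w α_i` is a nonnegative combination of simple roots: write `w` as `v`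
times an alternating word, which sends `α_i` to a combination of `α_i` and `α_t`, and use induction
for `v`. -/
theorem act_root_mem_Qplus {w : WeylGroup D} {i : I} (hi : ¬ (weyl D).IsRightDescent w i) :
    act D w (D.root i) ∈ Qplus D := by
  induction hl : (weyl D).length w using Nat.strong_induction_on generalizing w i with
  | _ l ih =>
  subst hl
  by_cases hw : w = 1
  · rw [hw, map_one]; exact root_mem_Qplus D i
  obtain ⟨t, ht⟩ := (weyl D).exists_rightDescent_of_ne_one hw
  have hit : i ≠ t := fun h => hi (h ▸ ht)
  obtain ⟨n, v, hn, hwv, hlen, hvi, hvt⟩ := exists_maximal_alternating_suffix D i ht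
  have hnM : (coxeterMatrix D) i t = 0 ∨ n < (coxeterMatrix D) i t := by
    by_contra hc
    push Not at hc
    have h1 := (weyl D).not_isRightDescent_iff.1 hi
    have h2 := (weyl D).not_isReduced_alternatingWord t i (m := n + 1)
      (by rw [(coxeterMatrix D).symmetric]; exact hc.1)
      (by rw [(coxeterMatrix D).symmetric]; omega)
    have h3 := (weyl D).length_wordProd_le (CoxeterSystem.alternatingWord t i (n + 1))
    have h4 := (weyl D).length_mul_le v
      ((weyl D).wordProd (CoxeterSystem.alternatingWord t i (n + 1)))
    rw [CoxeterSystem.IsReduced] at h2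
    rw [CoxeterSystem.length_alternatingWord] at h2 h3
    rw [CoxeterSystem.alternatingWord_succ, (weyl D).wordProd_concat, ← mul_assoc, ← hwv] at h4
    rw [CoxeterSystem.alternatingWord_succ, (weyl D).wordProd_concat] at h2 h3
    omega
  rw [hwv, act_mul_apply, act_alternatingWord_root]
  obtain ⟨h1, h2⟩ := dihedral_nonneg D hit hnM
  obtain ⟨a, ha⟩ := Int.eq_ofNat_of_zero_le h1
  obtain ⟨b, hb⟩ := Int.eq_ofNat_of_zero_le h2
  rw [ha, hb, map_add, map_smul, map_smul]
  simp only [Int.cast_natCast, Nat.cast_smul_eq_nsmul]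
  exact add_mem ((Qplus D).nsmul_mem (ih _ (by omega) hvi rfl) _)
    ((Qplus D).nsmul_mem (ih _ (by omega) hvt rfl) _)

theorem neg_act_root_mem_Qplus {w : WeylGroup D} {i : I} (hi : (weyl D).IsRightDescent w i) :
    -act D w (D.root i) ∈ Qplus D := by
  have h1 := (weyl D).isRightDescent_iff_not_isRightDescent_mul.1 hi
  have h2 := act_root_mem_Qplus D h1
  rwa [act_mul_apply, act_simple, reflectHom_root_self, map_neg] at h2

/-- If `s_i` and `s_t` both shorten `w` from the right, then `w` ends with the longest element of
the dihedral group they generate. -/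
theorem exists_longest_suffix {w : WeylGroup D} {i t : I} (hit : i ≠ t)
    (hi : (weyl D).IsRightDescent w i) (ht : (weyl D).IsRightDescent w t) :
    (coxeterMatrix D) i t ≠ 0 ∧ ∃ v : WeylGroup D,
      w = v * (weyl D).wordProd (CoxeterSystem.alternatingWord i t ((coxeterMatrix D) i t)) ∧
      (weyl D).length w = (weyl D).length v + (coxeterMatrix D) i t := by
  obtain ⟨n, v, hn, hwv, hlen, hvi, hvt⟩ := exists_maximal_alternating_suffix D i ht
  have h0 : ¬ ((coxeterMatrix D) i t = 0 ∨ n < (coxeterMatrix D) i t) := by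
    intro hnM
    obtain ⟨h1, h2⟩ := dihedral_nonneg D hit hnM
    obtain ⟨a, ha⟩ := Int.eq_ofNat_of_zero_le h1
    obtain ⟨b, hb⟩ := Int.eq_ofNat_of_zero_le h2
    refine act_root_ne_zero D w i (eq_zero_of_mem_Qplus_of_neg_mem D ?_
      (neg_act_root_mem_Qplus D hi))
    rw [hwv, act_mul_apply, act_alternatingWord_root, ha, hb, map_add, map_smul, map_smul]
    simp only [Int.cast_natCast, Nat.cast_smul_eq_nsmul]
    exact add_mem ((Qplus D).nsmul_mem (act_root_mem_Qplus D hvi) _)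
      ((Qplus D).nsmul_mem (act_root_mem_Qplus D hvt) _)
  push Not at h0
  have hle : n ≤ (coxeterMatrix D) i t := by
    by_contra hc
    push Not at hc
    have h2 := (weyl D).not_isReduced_alternatingWord i t h0.1 hc
    have h3 := (weyl D).length_wordProd_le (CoxeterSystem.alternatingWord i t n)
    have h4 := (weyl D).length_mul_le v ((weyl D).wordProd (CoxeterSystem.alternatingWord i t n))
    rw [CoxeterSystem.IsReduced] at h2
    rw [CoxeterSystem.length_alternatingWord] at h2 h3
    rw [← hwv] at h4
    omega
  obtain rfl : n = (coxeterMatrix D) i t := le_antisymm hle h0.2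
  exact ⟨h0.1, v, hwv, hlen⟩

/-- **Matsumoto's theorem** for the Weyl group: a function on reduced words which is compatible
with prepending letters and takes the same value on the two sides of each braid relation only
depends on the product of the word. -/
theorem eq_of_wordProd_eq {X : Type*} (G : List I → X)
    (hcons : ∀ i a b, (weyl D).IsReduced (i :: a) → (weyl D).IsReduced (i :: b) →
      (weyl D).wordProd a = (weyl D).wordProd b → G a = G b → G (i :: a) = G (i :: b))
    (hbraid : ∀ i j c, i ≠ j → (coxeterMatrix D) i j ≠ 0 →
      (weyl D).IsReduced ((CoxeterSystem.alternatingWord i j ((coxeterMatrix D) i j)).reverse ++ c) →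
      (weyl D).IsReduced ((CoxeterSystem.alternatingWord j i ((coxeterMatrix D) i j)).reverse ++ c) →
      G ((CoxeterSystem.alternatingWord i j ((coxeterMatrix D) i j)).reverse ++ c) =
        G ((CoxeterSystem.alternatingWord j i ((coxeterMatrix D) i j)).reverse ++ c))
    {a b : List I} (ha : (weyl D).IsReduced a) (hb : (weyl D).IsReduced b)
    (hab : (weyl D).wordProd a = (weyl D).wordProd b) : G a = G b := by
  set cs := weyl D with hcs
  induction hl : a.length using Nat.strong_induction_on generalizing a b with
  | _ l ih =>
  subst hl
  have hlen : a.length = b.length := by rw [← ha.eq, ← hb.eq, hab]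
  -- words with the same first letter
  have same : ∀ i a' b', a'.length + 1 = a.length → cs.IsReduced (i :: a') →
      cs.IsReduced (i :: b') → cs.wordProd (i :: a') = cs.wordProd (i :: b') →
      G (i :: a') = G (i :: b') := by
    intro i a' b' hla h1 h2 h3
    rw [cs.wordProd_cons, cs.wordProd_cons, mul_right_inj] at h3
    exact hcons i a' b' h1 h2 h3 (ih a'.length (by omega) (by simpa using h1.drop 1)
      (by simpa using h2.drop 1) h3 rfl)
  rcases a with _ | ⟨i, a⟩
  · rw [List.length_nil, eq_comm, List.length_eq_zero_iff] at hlen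
    rw [hlen]
  rcases b with _ | ⟨j, b⟩
  · simp at hlen
  by_cases hij : i = j
  · subst hij
    exact same i a b (by simp) ha hb hab
  have left : ∀ (x : I) (c : List I), cs.IsReduced (x :: c) →
      cs.IsRightDescent (cs.wordProd (x :: c))⁻¹ x := by
    intro x c hc
    rw [cs.isRightDescent_inv_iff, CoxeterSystem.IsLeftDescent, hc.eq, cs.wordProd_cons,
      cs.simple_mul_simple_cancel_left]
    have := cs.length_wordProd_le c
    simp only [List.length_cons]; omega
  obtain ⟨hM, v, hv, hlv⟩ := exists_longest_suffix D hij (left i a ha) (hab ▸ left j b hb)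
  rw [← hcs] at hv hlv
  obtain ⟨c, hc, hvc⟩ := cs.exists_isReduced v⁻¹
  have hv1 : v = (cs.wordProd c)⁻¹ := by rw [← hvc, inv_inv]
  have hbr : cs.wordProd (CoxeterSystem.alternatingWord i j ((coxeterMatrix D) i j)) =
      cs.wordProd (CoxeterSystem.alternatingWord j i ((coxeterMatrix D) i j)) := by
    have := cs.wordProd_braidWord_eq i j
    rwa [CoxeterSystem.braidWord, CoxeterSystem.braidWord, (coxeterMatrix D).symmetric j i] at this
  have prod1 : cs.wordProd ((CoxeterSystem.alternatingWord i j ((coxeterMatrix D) i j)).reverse ++ c)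
      = cs.wordProd (i :: a) := by
    rw [cs.wordProd_append, cs.wordProd_reverse, ← inv_inj, mul_inv_rev, inv_inv, ← hv1, ← hv]
  have prod2 : cs.wordProd ((CoxeterSystem.alternatingWord j i ((coxeterMatrix D) i j)).reverse ++ c)
      = cs.wordProd (i :: a) := by
    rw [← prod1, cs.wordProd_append, cs.wordProd_append, cs.wordProd_reverse, cs.wordProd_reverse,
      hbr]
  have hlc : cs.length v = c.length := by rw [hv1, cs.length_inv, hc.eq]
  rw [cs.length_inv] at hlv
  have red1 : cs.IsReduced ((CoxeterSystem.alternatingWord i j ((coxeterMatrix D) i j)).reverse ++ c) := by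
    rw [CoxeterSystem.IsReduced, prod1, List.length_append, List.length_reverse,
      CoxeterSystem.length_alternatingWord]
    omega
  have red2 : cs.IsReduced ((CoxeterSystem.alternatingWord j i ((coxeterMatrix D) i j)).reverse ++ c) := by
    rw [CoxeterSystem.IsReduced, prod2, List.length_append, List.length_reverse,
      CoxeterSystem.length_alternatingWord]
    omega
  have hbraid' := hbraid i j c hij hM red1 red2
  obtain ⟨m, hm⟩ := Nat.exists_eq_succ_of_ne_zero hM
  have head : ∀ x y : I, ∃ e, (CoxeterSystem.alternatingWord x y ((coxeterMatrix D) i j)).reverse ++ c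
      = y :: e := by
    intro x y
    rw [hm, CoxeterSystem.alternatingWord_succ, List.concat_eq_append, List.reverse_concat]
    exact ⟨_, rfl⟩
  obtain ⟨e1, he1⟩ := head i j
  obtain ⟨e2, he2⟩ := head j i
  rw [he1] at hbraid' red1 prod1
  rw [he2] at hbraid' red2 prod2
  rw [same i a e2 (by simp) ha red2 prod2.symm, ← hbraid']
  exact (same j b e1 (by simpa using hlen.symm) hb red1 (hab.symm.trans prod1.symm)).symm

end Weyl

end CrystalWeyl

namespace CrystalWeyl

section WeylWeights

variable {I : Type*} {h : Type*} [AddCommGroup h] [Module ℂ h] (D : CartanDatum I h)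

/-! ### Weights -/

theorem form_root_ne_zero (i : I) : D.form (D.root i) (D.root i) ≠ 0 := by
  obtain ⟨n, hn, h1⟩ := D.form_root i
  rw [h1]
  have : (n : ℂ) ≠ 0 := by exact_mod_cast hn.ne'
  simpa using this

theorem form_comm (x y : Module.Dual ℂ h) : D.form x y = D.form y x :=
  D.form_symm.eq x y

theorem form_root_right (lam : Module.Dual ℂ h) (i : I) :
    D.form lam (D.root i) = lam (D.coroot i) * (D.form (D.root i) (D.root i) / 2) := by
  have := form_root_ne_zero D i
  rw [D.apply_coroot]
  field_simp

theorem form_reflectHom (i : I) (x y : Module.Dual ℂ h) :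
    D.form (reflectHom D i x) (reflectHom D i y) = D.form x y := by
  simp only [reflectHom_apply, map_sub, map_smul, LinearMap.sub_apply, LinearMap.smul_apply,
    smul_eq_mul]
  rw [form_comm D (D.root i) y, form_root_right D x, form_root_right D y]
  ring

theorem form_act (w : WeylGroup D) (x y : Module.Dual ℂ h) :
    D.form (act D w x) (act D w y) = D.form x y := by
  induction w using (weyl D).simple_induction_left with
  | one => simp
  | mul_simple_left w i ih => rw [act_simple_mul, act_simple_mul, form_reflectHom, ih]

theorem reflectHom_mem_P (i : I) {lam : Module.Dual ℂ h} (hlam : lam ∈ D.P) :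
    reflectHom D i lam ∈ D.P := by
  obtain ⟨n, hn⟩ := D.coroot_int lam hlam i
  rw [reflectHom_apply, hn, Int.cast_smul_eq_zsmul]
  exact sub_mem hlam (zsmul_mem (D.root_mem i) n)

theorem act_mem_P (w : WeylGroup D) {lam : Module.Dual ℂ h} (hlam : lam ∈ D.P) :
    act D w lam ∈ D.P := by
  induction w using (weyl D).simple_induction_left with
  | one => simpa using hlam
  | mul_simple_left w i ih => rw [act_simple_mul]; exact reflectHom_mem_P D i ih

/-- Dominant integral weights. -/
structure Dominant (lam : Module.Dual ℂ h) : Prop where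
  mem_P : lam ∈ D.P
  nonneg : ∀ i, ∃ n : ℕ, lam (D.coroot i) = n

variable {D}

theorem Dominant.form_Qplus {lam : Module.Dual ℂ h} (hlam : Dominant D lam)
    {x : Module.Dual ℂ h} (hx : x ∈ Qplus D) : ∃ n : ℕ, D.form lam x = n := by
  induction hx using AddSubmonoid.closure_induction with
  | mem x hx =>
    obtain ⟨i, rfl⟩ := hx
    obtain ⟨n, hn⟩ := hlam.nonneg i
    obtain ⟨m, hm, h1⟩ := D.form_root i
    refine ⟨n * m.toNat, ?_⟩
    rw [form_root_right, hn, h1]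
    have : ((m.toNat : ℕ) : ℂ) = m := by
      have h2 := Int.toNat_of_nonneg hm.le
      exact_mod_cast congrArg (Int.cast : ℤ → ℂ) h2
    push_cast; rw [this]; ring
  | zero => exact ⟨0, by simp⟩
  | add x y _ _ hx hy =>
    obtain ⟨n, hn⟩ := hx
    obtain ⟨m, hm⟩ := hy
    exact ⟨n + m, by simp [hn, hm]⟩

/-- If `ℓ(s_i w) > ℓ(w)` and `λ` is dominant, then `(w λ)(α_i^∨) ≥ 0`. -/
theorem Dominant.act_coroot {lam : Module.Dual ℂ h} (hlam : Dominant D lam) {w : WeylGroup D}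
    {i : I} (hi : ¬ (weyl D).IsLeftDescent w i) : ∃ n : ℕ, act D w lam (D.coroot i) = n := by
  rw [← (weyl D).isRightDescent_inv_iff] at hi
  obtain ⟨n, hn⟩ := hlam.form_Qplus (act_root_mem_Qplus D hi)
  rw [← form_act D w, ← act_mul_apply, mul_inv_cancel, map_one, Module.End.one_apply,
    form_root_right] at hn
  obtain ⟨m, hm, h1⟩ := D.form_root i
  obtain ⟨z, hz⟩ := D.coroot_int _ (act_mem_P D w hlam.mem_P) i
  have h2 : z * m = n := by
    rw [hz, h1, mul_div_cancel_left₀ _ (two_ne_zero)] at hn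
    exact_mod_cast hn
  have h3 : 0 ≤ z := by
    by_contra hc
    push Not at hc
    have := mul_neg_of_neg_of_pos hc hm
    omega
  exact ⟨z.toNat, by rw [hz]; exact_mod_cast congrArg (Int.cast : ℤ → ℂ) (Int.toNat_of_nonneg h3).symm⟩

variable (D)

/-- An element of the Weyl group which fixes every member of a Weyl-invariant set `T` of weights
is a product of simple reflections which fix every member of `T`. -/
theorem mem_parabolic_of_fixes {T : Set (Module.Dual ℂ h)}
    (hT : ∀ i, ∀ mu ∈ T, reflectHom D i mu ∈ T) {w : WeylGroup D}
    (hw : ∀ mu ∈ T, act D w mu = mu) :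
    w ∈ parabolic D {i | ∀ mu ∈ T, mu (D.coroot i) = 0} := by
  induction hl : (weyl D).length w using Nat.strong_induction_on generalizing w with
  | _ l ih =>
  subst hl
  by_cases hw1 : w = 1
  · rw [hw1]; exact one_mem _
  obtain ⟨i, hi⟩ := (weyl D).exists_rightDescent_of_ne_one hw1
  have hiT : ∀ mu ∈ T, mu (D.coroot i) = 0 := by
    intro mu hmu
    by_contra hne
    -- `w` fixes `μ` and `s_i μ`, hence also `α_i`
    have h1 := hw _ (hT i mu hmu)
    rw [reflectHom_apply, map_sub, map_smul, hw mu hmu] at h1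
    have h2 : act D w (D.root i) = D.root i := smul_right_injective _ hne (sub_right_injective h1)
    have h3 := neg_act_root_mem_Qplus D hi
    rw [h2] at h3
    exact D.root_indep.ne_zero i (eq_zero_of_mem_Qplus_of_neg_mem D (root_mem_Qplus D i) h3)
  have h1 := (weyl D).isRightDescent_iff.1 hi
  have h2 := ih _ (by omega) (w := w * (weyl D).simple i) (fun mu hmu => by
    rw [act_mul_apply, act_simple, reflectHom_apply, hiT mu hmu, zero_smul, sub_zero, hw mu hmu]) rfl
  have h3 : (weyl D).simple i ∈ parabolic D {i | ∀ mu ∈ T, mu (D.coroot i) = 0} :=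
    Subgroup.subset_closure ⟨i, hiT, rfl⟩
  have := mul_mem h2 h3
  rwa [(weyl D).simple_mul_simple_cancel_right] at this

theorem act_root_eq_of_mem_parabolic {J : Set I} {i : I} (hi : ∀ j ∈ J, D.a j i = 0)
    {w : WeylGroup D} (hw : w ∈ parabolic D J) : act D w (D.root i) = D.root i := by
  induction hw using Subgroup.closure_induction with
  | mem x hx =>
    obtain ⟨j, hj, rfl⟩ := hx
    rw [act_simple, reflectHom_apply, D.root_coroot, hi j hj]; simp
  | one => simp
  | mul x y _ _ hx hy => rw [act_mul_apply, hy, hx]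
  | inv x _ hx =>
    conv_lhs => rw [← hx]
    exact act_inv_act D x _

/-- The action on the simple roots is faithful. -/
theorem eq_one_of_act_root_eq {w : WeylGroup D} (hw : ∀ i, act D w (D.root i) = D.root i) :
    w = 1 := by
  by_contra hw1
  obtain ⟨i, hi⟩ := (weyl D).exists_rightDescent_of_ne_one hw1
  have h3 := neg_act_root_mem_Qplus D hi
  rw [hw i] at h3
  exact D.root_indep.ne_zero i (eq_zero_of_mem_Qplus_of_neg_mem D (root_mem_Qplus D i) h3)

/-- If no vertex of `J` is joined to a vertex outside `J`, then `W_J` and `W_{I ∖ J}` meet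
trivially. -/
theorem eq_one_of_mem_parabolic_of_mem_parabolic_compl {J : Set I}
    (hJ : ∀ i ∈ J, ∀ j ∉ J, D.a i j = 0) {w : WeylGroup D} (h1 : w ∈ parabolic D J)
    (h2 : w ∈ parabolic D Jᶜ) : w = 1 := by
  refine eq_one_of_act_root_eq D fun i => ?_
  by_cases hi : i ∈ J
  · exact act_root_eq_of_mem_parabolic D (fun j hj => D.a_zero _ _ (hJ i hi j hj)) h2
  · exact act_root_eq_of_mem_parabolic D (fun j hj => hJ j hj i hi) h1

end WeylWeights

end CrystalWeyl

namespace CrystalWeyl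

section Representation

variable {I : Type*} {h : Type*} [AddCommGroup h] [Module ℂ h] {k : Type*} [Field k]

/-! ### Relations in the quantum group -/

theorem isGeneric_of_transcendental [CharZero k] {r : k} (hr : Transcendental ℚ r) :
    IsGeneric r where
  ne_zero := by
    rintro rfl
    exact hr isAlgebraic_zero
  zpow_ne_one n hn h1 := by
    have key : ∀ m : ℕ, m ≠ 0 → r ^ m ≠ 1 := fun m hm h2 =>
      hr (IsAlgebraic.of_pow (Nat.pos_of_ne_zero hm) (h2 ▸ isAlgebraic_one))
    rcases Int.natAbs_eq n with h2 | h2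
    · rw [h2, zpow_natCast] at h1; exact key _ (by omega) h1
    · rw [h2, zpow_neg, zpow_natCast, inv_eq_one] at h1
      exact key _ (by omega) h1

variable (D : CartanDatum I h) (r : k)

theorem K_mul_E (lam : halfP D) (i : I) :
    K D r lam * E D r i = qPow D r (D.form lam (D.root i)) • (E D r i * K D r lam) := by
  have := RingQuot.mkAlgHom_rel k (Rel.K_E (r := r) lam i)
  rw [map_mul, map_smul, map_mul] at this
  exact this

theorem K_mul_F (lam : halfP D) (i : I) :
    K D r lam * F D r i = qPow D r (-(D.form lam (D.root i))) • (F D r i * K D r lam) := by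
  have := RingQuot.mkAlgHom_rel k (Rel.K_F (r := r) lam i)
  rw [map_mul, map_smul, map_mul] at this
  exact this

theorem E_mul_F_of_ne {i j : I} (hij : i ≠ j) : E D r i * F D r j = F D r j * E D r i := by
  have := RingQuot.mkAlgHom_rel k (Rel.E_F (r := r) (D := D) i j hij)
  rw [map_mul, map_mul] at this
  exact this

theorem E_mul_F_self (i : I) : E D r i * F D r i - F D r i * E D r i =
    (qi D r i - (qi D r i)⁻¹)⁻¹ • (K D r (rootHalf D i) - K D r (-(rootHalf D i))) := by
  have := RingQuot.mkAlgHom_rel k (Rel.E_F_self (r := r) (D := D) i)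
  rw [map_sub, map_mul, map_mul, map_smul, map_sub] at this
  exact this

theorem K_neg_mul_K (lam : halfP D) : K D r (-lam) * K D r lam = 1 := by
  have h1 := RingQuot.mkAlgHom_rel k (Rel.K_add (r := r) (-lam) lam)
  have h2 := RingQuot.mkAlgHom_rel k (Rel.K_zero (D := D) (r := r))
  rw [neg_add_cancel, map_mul] at h1
  rw [h1, map_one] at h2
  exact h2

theorem K_mul_K_comm (lam mu : halfP D) :
    K D r lam * K D r mu = K D r mu * K D r lam := by
  have h1 := RingQuot.mkAlgHom_rel k (Rel.K_add (r := r) lam mu)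
  have h2 := RingQuot.mkAlgHom_rel k (Rel.K_add (r := r) mu lam)
  rw [map_mul] at h1 h2
  rw [add_comm, h2] at h1
  exact h1.symm

theorem commute_of_serre {R : Type*} [Ring R] [Algebra k R] {v : k} (hv : IsGeneric v) {x y : R}
    (h0 : serre v x y 1 = 0) : x * y = y * x := by
  simp only [serre, Finset.sum_range_succ, Finset.range_zero, Finset.sum_empty] at h0
  simp only [pow_zero, divPow_zero, one_mul, zero_add, Nat.sub_zero, hv.divPow_one, pow_one,
    Nat.sub_self, mul_one, neg_mul, add_neg_eq_zero] at h0
  exact h0.symm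

/-! ### Powers of `q` -/

theorem two_mul_d_ne_zero : (2 * (D.d : ℂ)) ≠ 0 := by
  have := D.d_pos
  simp; omega

theorem exists_form_eq (lam : halfP D) {be : Module.Dual ℂ h} (hbe : be ∈ D.P) :
    ∃ n : ℤ, D.form lam be = (n : ℂ) / (2 * (D.d : ℂ)) := by
  obtain ⟨n, hn⟩ := D.form_int _ lam.2 be hbe
  refine ⟨n, ?_⟩
  have h1 : (2 : ℂ) * D.form lam be = n / D.d := by
    rw [← hn]; simp [two_mul]
  rw [mul_comm (2 : ℂ), ← div_div, ← h1]; ring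

variable {r}

theorem qPow_form_add (hr : IsGeneric r) (lam : halfP D) {be ga : Module.Dual ℂ h}
    (hbe : be ∈ D.P) (hga : ga ∈ D.P) :
    qPow D r (D.form lam (be + ga)) = qPow D r (D.form lam be) * qPow D r (D.form lam ga) := by
  obtain ⟨n, hn⟩ := exists_form_eq D lam hbe
  obtain ⟨m, hm⟩ := exists_form_eq D lam hga
  rw [map_add, hn, hm, ← add_div, ← Int.cast_add, qPow_spec, qPow_spec, qPow_spec,
    zpow_add₀ hr.ne_zero]

theorem qi_eq {i : I} {n : ℤ} (hn : D.form (D.root i) (D.root i) = 2 * (n : ℂ)) :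
    qi D r i = r ^ (2 * D.d * n) := by
  have hd : (D.d : ℂ) ≠ 0 := right_ne_zero_of_mul (two_mul_d_ne_zero D)
  rw [qi, hn, ← qPow_spec D r]
  congr 1
  push_cast
  field_simp

theorem isGeneric_qi (hr : IsGeneric r) (i : I) : IsGeneric (qi D r i) := by
  obtain ⟨n, hn, h1⟩ := D.form_root i
  have hd := D.d_pos
  rw [qi_eq D h1]
  refine ⟨zpow_ne_zero _ hr.ne_zero, fun m hm => ?_⟩
  rw [← zpow_mul]
  refine hr.zpow_ne_one _ (mul_ne_zero (mul_ne_zero ?_ hn.ne') hm)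
  omega

theorem E_mul_E_comm (hr : IsGeneric r) {i j : I} (hij : D.a i j = 0) (hne : i ≠ j) :
    E D r i * E D r j = E D r j * E D r i := by
  refine commute_of_serre (isGeneric_qi D hr i) ?_
  have h0 := RingQuot.mkAlgHom_rel k (Rel.serre_E (D := D) (r := r) i j hne)
  simpa only [serre, map_divPow, hij, E, map_sum, map_mul, map_pow, map_neg, map_one, map_zero,
    sub_zero, Int.toNat_one] using h0

theorem F_mul_F_comm (hr : IsGeneric r) {i j : I} (hij : D.a i j = 0) (hne : i ≠ j) :
    F D r i * F D r j = F D r j * F D r i := by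
  refine commute_of_serre (isGeneric_qi D hr i) ?_
  have h0 := RingQuot.mkAlgHom_rel k (Rel.serre_F (D := D) (r := r) i j hne)
  simpa only [serre, map_divPow, hij, F, map_sum, map_mul, map_pow, map_neg, map_one, map_zero,
    sub_zero, Int.toNat_one] using h0

theorem qPow_form_root (i : I) {be : Module.Dual ℂ h} {m : ℤ} (hm : be (D.coroot i) = m) :
    qPow D r (D.form (D.root i) be) = qi D r i ^ m := by
  obtain ⟨n, hn, h1⟩ := D.form_root i
  have hd : (D.d : ℂ) ≠ 0 := right_ne_zero_of_mul (two_mul_d_ne_zero D)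
  rw [qi_eq D h1, ← zpow_mul, ← qPow_spec D r, form_comm, form_root_right, hm, h1]
  congr 1
  push_cast
  field_simp

/-! ### Weight spaces -/

variable (r)
variable (V : Type*) [AddCommGroup V] [Module k V] [Module (Uq D r) V]
  [IsScalarTower k (Uq D r) V]

/-- The weight space of weight `β`, for an arbitrary element `β` of `h^*`. -/
def wsp (be : Module.Dual ℂ h) : Submodule k V where
  carrier := {m | ∀ lam : halfP D,
    K D r lam • m = qPow D r (D.form (lam : Module.Dual ℂ h) be) • m}
  zero_mem' := by intro lam; simp
  add_mem' := by
    intro x y hx hy lam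
    rw [smul_add, smul_add, hx lam, hy lam]
  smul_mem' := by
    intro c x hx lam
    rw [smul_comm, hx lam, smul_comm]

/-- An element of the quantum group as an operator on the module. -/
noncomputable abbrev op : Uq D r →ₐ[k] Module.End k V := Algebra.lsmul k k V

variable {r V}

theorem op_apply (x : Uq D r) (v : V) : op D r V x v = x • v := rfl

theorem divPow_op (q : k) (x : Uq D r) (n : ℕ) (v : V) :
    divPow q (op D r V x) n v = divPow q x n • v := by
  rw [← map_divPow]; rfl

variable {D}

theorem E_smul_mem (hr : IsGeneric r) {be : Module.Dual ℂ h} (hbe : be ∈ D.P) {v : V}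
    (hv : v ∈ wsp D r V be) (i : I) : E D r i • v ∈ wsp D r V (be + D.root i) := by
  intro lam
  rw [← mul_smul, K_mul_E, smul_assoc, mul_smul, hv lam, smul_comm (E D r i), smul_smul,
    qPow_form_add D hr lam hbe (D.root_mem i), mul_comm]

theorem F_smul_mem (hr : IsGeneric r) {be : Module.Dual ℂ h} (hbe : be ∈ D.P) {v : V}
    (hv : v ∈ wsp D r V be) (i : I) : F D r i • v ∈ wsp D r V (be - D.root i) := by
  intro lam
  rw [← mul_smul, K_mul_F, smul_assoc, mul_smul, hv lam, smul_comm (F D r i), smul_smul,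
    sub_eq_add_neg, qPow_form_add D hr lam hbe (neg_mem (D.root_mem i)), map_neg, mul_comm]

theorem divPow_E_smul_mem (hr : IsGeneric r) {be : Module.Dual ℂ h} (hbe : be ∈ D.P) {v : V}
    (hv : v ∈ wsp D r V be) (q : k) (i : I) (n : ℕ) :
    divPow q (E D r i) n • v ∈ wsp D r V (be + (n : ℂ) • D.root i) := by
  rw [divPow, smul_assoc]
  refine Submodule.smul_mem _ _ ?_
  have : ∀ m : ℕ, be + (m : ℂ) • D.root i ∈ D.P := fun m => by
    rw [Nat.cast_smul_eq_nsmul]; exact add_mem hbe (nsmul_mem (D.root_mem i) m)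
  induction n with
  | zero => simpa using hv
  | succ n ih =>
    rw [pow_succ', mul_smul]
    have := E_smul_mem hr (this n) ih i
    rwa [show be + (n : ℂ) • D.root i + D.root i = be + ((n + 1 : ℕ) : ℂ) • D.root i by
      push_cast; module] at this

theorem divPow_F_smul_mem (hr : IsGeneric r) {be : Module.Dual ℂ h} (hbe : be ∈ D.P) {v : V}
    (hv : v ∈ wsp D r V be) (q : k) (i : I) (n : ℕ) :
    divPow q (F D r i) n • v ∈ wsp D r V (be - (n : ℂ) • D.root i) := by
  rw [divPow, smul_assoc]
  refine Submodule.smul_mem _ _ ?_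
  have : ∀ m : ℕ, be - (m : ℂ) • D.root i ∈ D.P := fun m => by
    rw [Nat.cast_smul_eq_nsmul]; exact sub_mem hbe (nsmul_mem (D.root_mem i) m)
  induction n with
  | zero => simpa using hv
  | succ n ih =>
    rw [pow_succ', mul_smul]
    have := F_smul_mem hr (this n) ih i
    rwa [show be - (n : ℂ) • D.root i - D.root i = be - ((n + 1 : ℕ) : ℂ) • D.root i by
      push_cast; module] at this

variable (D r V) in
/-- The `ℤ`-grading of the module by the eigenvalues of `K_{α_i}`. -/
noncomputable def grading (i : I) (n : ℤ) : Submodule k V :=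
  (op D r V (K D r (rootHalf D i))).eigenspace (qi D r i ^ n)

theorem mem_grading {i : I} {n : ℤ} {v : V} :
    v ∈ grading D r V i n ↔ K D r (rootHalf D i) • v = qi D r i ^ n • v :=
  Module.End.mem_eigenspace_iff

theorem wsp_le_grading {i : I} {be : Module.Dual ℂ h} {m : ℤ} (hm : be (D.coroot i) = m) :
    wsp D r V be ≤ grading D r V i m := fun v hv => by
  rw [mem_grading, hv, ← qPow_form_root D i hm]; rfl

theorem K_neg_smul {i : I} {n : ℤ} {v : V} (hq : IsGeneric (qi D r i))
    (hv : v ∈ grading D r V i n) :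
    K D r (-(rootHalf D i)) • v = qi D r i ^ (-n) • v := by
  have h1 := K_neg_mul_K D r (rootHalf D i)
  have h2 : K D r (-(rootHalf D i)) • (K D r (rootHalf D i) • v) = v := by
    rw [← mul_smul, h1, one_smul]
  rw [mem_grading.1 hv, smul_comm] at h2
  rw [← h2, smul_smul, ← zpow_add₀ hq.ne_zero, neg_add_cancel, zpow_zero, one_smul, h2]

theorem grading_E (hr : IsGeneric r) {i j : I} {n : ℤ} {v : V} (hv : v ∈ grading D r V i n) :
    E D r j • v ∈ grading D r V i (n + D.a i j) := by
  rw [mem_grading] at hv ⊢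
  have h1 := qPow_form_root D (r := r) i (D.root_coroot i j)
  rw [← mul_smul, K_mul_E, smul_assoc, mul_smul, hv, smul_comm (E D r j), smul_smul,
    zpow_add₀ (isGeneric_qi D hr i).ne_zero, ← h1, mul_comm]
  rfl

theorem grading_F (hr : IsGeneric r) {i j : I} {n : ℤ} {v : V} (hv : v ∈ grading D r V i n) :
    F D r j • v ∈ grading D r V i (n - D.a i j) := by
  rw [mem_grading] at hv ⊢
  have h1 := qPow_form_root D (r := r) (be := -D.root j) (m := -D.a i j) i
    (by rw [LinearMap.neg_apply, D.root_coroot]; push_cast; ring)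
  rw [← mul_smul, K_mul_F, smul_assoc, mul_smul, hv, smul_comm (F D r j), smul_smul,
    sub_eq_add_neg, zpow_add₀ (isGeneric_qi D hr i).ne_zero, ← h1, mul_comm, map_neg]
  rfl

theorem E_smul_F_smul {i : I} {n : ℤ} {v : V} (hq : IsGeneric (qi D r i))
    (hv : v ∈ grading D r V i n) :
    E D r i • F D r i • v = F D r i • E D r i • v + qz (qi D r i) n • v := by
  have h1 := E_mul_F_self D r i
  rw [sub_eq_iff_eq_add'] at h1
  rw [← mul_smul, h1, add_smul, mul_smul, smul_assoc, sub_smul, mem_grading.1 hv, K_neg_smul hq hv,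
    ← sub_smul, qz, div_eq_inv_mul, mul_smul ((qi D r i - (qi D r i)⁻¹)⁻¹)]

section Object

variable [Fintype I] [DecidableEq I]

/-- Each simple root makes an object of `𝒪^int` an integrable module over quantum `sl₂`. -/
theorem IsObjectO.quantumSl2 (hV : IsObjectO D r V) (hr : IsGeneric r) (i : I) :
    QuantumSl2 (qi D r i) (op D r V (E D r i)) (op D r V (F D r i)) (grading D r V i) where
  generic := isGeneric_qi D hr i
  E_mem {n v} hv := by
    have := grading_E (j := i) hr hv
    rwa [D.a_self] at this
  F_mem {n v} hv := by
    have := grading_F (j := i) hr hv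
    rwa [D.a_self] at this
  comm {n v} hv := E_smul_F_smul (isGeneric_qi D hr i) hv
  E_nilp v := by
    obtain ⟨n, hn⟩ := hV.E_nilp i v
    exact ⟨n, by rw [← map_pow]; exact hn⟩
  F_nilp v := by
    obtain ⟨n, hn⟩ := hV.F_nilp i v
    exact ⟨n, by rw [← map_pow]; exact hn⟩
  indep := by
    refine (op D r V (K D r (rootHalf D i))).eigenspaces_iSupIndep.comp
      (f := fun n : ℤ => qi D r i ^ n) ?_
    intro a b hab
    by_contra hne
    refine (isGeneric_qi D hr i).zpow_ne_one (a - b) (by omega) ?_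
    have h0 := (isGeneric_qi D hr i).ne_zero
    rw [zpow_sub₀ h0, div_eq_one_iff_eq (zpow_ne_zero _ h0)]
    exact hab
  span := by
    rw [eq_top_iff, ← hV.weight_span]
    refine iSup_le fun be => ?_
    obtain ⟨m, hm⟩ := D.coroot_int be be.2 i
    exact (wsp_le_grading hm).trans (le_iSup (grading D r V i) m)

theorem IsObjectO.sum_eq_zero (hV : IsObjectO D r V) {ι : Type*} {s : Finset ι}
    {be : ι → Module.Dual ℂ h} (hbe : ∀ x ∈ s, be x ∈ D.P) (hinj : Set.InjOn be s) {v : ι → V}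
    (hv : ∀ x ∈ s, v x ∈ wsp D r V (be x)) (h0 : ∑ x ∈ s, v x = 0) : ∀ x ∈ s, v x = 0 := by
  classical
  have h1 : iSupIndep (fun x : s => weightSpace D r V ⟨be x, hbe x x.2⟩) := by
    refine hV.weight_indep.comp (f := fun x : s => (⟨be x, hbe x x.2⟩ : D.P)) fun x y hxy => ?_
    exact Subtype.ext (hinj x.2 y.2 (congrArg Subtype.val hxy))
  have h2 := (iSupIndep_iff_finsetSum_eq_zero_imp_eq_zero _).1 h1 Finset.univ (fun x => v x)
    (fun x _ => hv x x.2) (by rw [← h0]; exact Finset.sum_coe_sort s v)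
  exact fun x hx => h2 ⟨x, hx⟩ (Finset.mem_univ _)

theorem IsObjectO.eq_of_mem_wsp (hV : IsObjectO D r V) {be ga : Module.Dual ℂ h}
    (hbe : be ∈ D.P) (hga : ga ∈ D.P) {v : V} (h1 : v ∈ wsp D r V be) (h2 : v ∈ wsp D r V ga)
    (hv : v ≠ 0) : be = ga := by
  by_contra hne
  have := hV.weight_indep.pairwiseDisjoint (i := ⟨be, hbe⟩) (j := ⟨ga, hga⟩)
    (fun hc => hne (congrArg Subtype.val hc))
  exact hv (Submodule.disjoint_def.1 this v h1 h2)

theorem IsObjectO.weightComp_spec (hV : IsObjectO D r V) (v : V) :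
    (∀ be : D.P, weightComp D r v be ∈ wsp D r V be) ∧ ((weightComp D r v).sum fun _ x => x) = v := by
  have hex : ∃ c : D.P →₀ V, (∀ be, c be ∈ weightSpace D r V be) ∧ (c.sum fun _ x => x) = v :=
    (Submodule.mem_iSup_iff_exists_finsupp _ _).1 (hV.weight_span ▸ Submodule.mem_top)
  rw [weightComp, dif_pos hex]
  exact hex.choose_spec

/-- The family of weight components is characterized by its sum. -/
theorem IsObjectO.weightComp_eq (hV : IsObjectO D r V) {c : D.P →₀ V}
    (hc : ∀ be : D.P, c be ∈ wsp D r V be) : weightComp D r (c.sum fun _ x => x) = c := by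
  obtain ⟨h1, h2⟩ := hV.weightComp_spec (c.sum fun _ x => x)
  have h3 : ((weightComp D r (c.sum fun _ x => x) - c).sum fun _ x => x) = 0 := by
    rw [Finsupp.sum_sub_index (by intros; rfl), h2, sub_self]
  rw [← sub_eq_zero]
  ext be
  by_contra hne
  exact hne (hV.sum_eq_zero (be := fun x : D.P => (x : Module.Dual ℂ h)) (fun x _ => x.2)
    Subtype.val_injective.injOn (fun x _ => sub_mem (h1 x) (hc x)) h3 be
    (Finsupp.mem_support_iff.2 hne))

end Object

end Representation

end CrystalWeyl

namespace CrystalWeyl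

section Lowering

variable {I : Type*} {h : Type*} [AddCommGroup h] [Module ℂ h]
  {k : Type*} [Field k] {D : CartanDatum I h} {r : k}

/-! ### Submodules generated by primitive vectors -/

theorem commute_divPow_E_divPow_F {i j : I} (hij : i ≠ j) (p q : k) (m n : ℕ) :
    Commute (divPow p (E D r i) m) (divPow q (F D r j) n) := by
  have h1 : Commute (E D r i) (F D r j) := E_mul_F_of_ne D r hij
  rw [divPow, divPow]
  exact ((h1.pow_pow m n).smul_left _).smul_right _

theorem commute_E_divPow_F {i j : I} (hij : i ≠ j) (q : k) (n : ℕ) :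
    Commute (E D r i) (divPow q (F D r j) n) := by
  have h1 : Commute (E D r i) (F D r j) := E_mul_F_of_ne D r hij
  rw [divPow]
  exact (h1.pow_right n).smul_right _

variable {V : Type*} [AddCommGroup V] [Module k V] [Module (Uq D r) V]

variable (D r) in
/-- The span of the vectors `F_{j₁} ⋯ F_{jₙ} u` with all `jₛ` in `J`. -/
def lspan (J : Set I) (u : V) : Submodule k V :=
  Submodule.span k {x | ∃ om : List I, (∀ j ∈ om, j ∈ J) ∧ x = (om.map (F D r)).prod • u}

variable {J : Set I} {u : V} {mu : Module.Dual ℂ h}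

theorem self_mem_lspan : u ∈ lspan D r J u :=
  Submodule.subset_span ⟨[], by simp, by simp⟩

variable [IsScalarTower k (Uq D r) V]

theorem F_smul_mem_lspan {j : I} (hj : j ∈ J) {y : V} (hy : y ∈ lspan D r J u) :
    F D r j • y ∈ lspan D r J u := by
  induction hy using Submodule.span_induction with
  | mem y hy =>
    obtain ⟨om, hom, rfl⟩ := hy
    refine Submodule.subset_span ⟨j :: om, ?_, by simp [mul_smul]⟩
    intro x hx
    rcases List.mem_cons.1 hx with rfl | hx
    exacts [hj, hom x hx]
  | zero => simp
  | add x y _ _ hx hy => rw [smul_add]; exact add_mem hx hy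
  | smul c x _ hx => rw [smul_comm]; exact Submodule.smul_mem _ _ hx

theorem F_word_mem_wsp (hr : IsGeneric r) (hmu : mu ∈ D.P) (hu : u ∈ wsp D r V mu) (om : List I) :
    (om.map (F D r)).prod • u ∈ wsp D r V (mu - (om.map D.root).sum) ∧
      mu - (om.map D.root).sum ∈ D.P ∧ (om.map D.root).sum ∈ Qplus D := by
  induction om with
  | nil => simpa using ⟨hu, hmu⟩
  | cons i om ih =>
    obtain ⟨h1, h2, h3⟩ := ih
    have e : mu - ((i :: om).map D.root).sum = mu - (om.map D.root).sum - D.root i := by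
      simp only [List.map_cons, List.sum_cons]; abel
    rw [e]
    refine ⟨?_, sub_mem h2 (D.root_mem i), ?_⟩
    · simp only [List.map_cons, List.prod_cons, mul_smul]
      exact F_smul_mem hr h2 h1 i
    · simp only [List.map_cons, List.sum_cons]
      exact add_mem (root_mem_Qplus D i) h3

theorem E_smul_mem_lspan (hr : IsGeneric r) (hmu : mu ∈ D.P) (hu : u ∈ wsp D r V mu)
    (hE : ∀ j ∈ J, E D r j • u = 0) {j : I} (hj : j ∈ J) {y : V} (hy : y ∈ lspan D r J u) :
    E D r j • y ∈ lspan D r J u := by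
  induction hy using Submodule.span_induction with
  | mem y hy =>
    obtain ⟨om, hom, rfl⟩ := hy
    induction om with
    | nil => simp [hE j hj]
    | cons i om ih =>
      have ih := ih fun x hx => hom x (List.mem_cons_of_mem _ hx)
      have hw : (om.map (F D r)).prod • u ∈ lspan D r J u :=
        Submodule.subset_span ⟨om, fun x hx => hom x (List.mem_cons_of_mem _ hx), rfl⟩
      simp only [List.map_cons, List.prod_cons, mul_smul]
      by_cases hij : j = i
      · subst hij
        obtain ⟨h1, h2, -⟩ := F_word_mem_wsp hr hmu hu om
        obtain ⟨m, hm⟩ := D.coroot_int _ h2 j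
        rw [E_smul_F_smul (isGeneric_qi D hr j) (wsp_le_grading hm h1)]
        exact add_mem (F_smul_mem_lspan hj ih) (Submodule.smul_mem _ _ hw)
      · rw [← mul_smul, E_mul_F_of_ne D r hij, mul_smul]
        exact F_smul_mem_lspan (hom i List.mem_cons_self) ih
  | zero => simp
  | add x y _ _ hx hy => rw [smul_add]; exact add_mem hx hy
  | smul c x _ hx => rw [smul_comm]; exact Submodule.smul_mem _ _ hx

theorem divPow_F_smul_mem_lspan {j : I} (hj : j ∈ J) {y : V} (hy : y ∈ lspan D r J u) (q : k)
    (n : ℕ) : divPow q (F D r j) n • y ∈ lspan D r J u := by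
  rw [divPow, smul_assoc]
  refine Submodule.smul_mem _ _ ?_
  induction n with
  | zero => simpa using hy
  | succ n ih => rw [pow_succ', mul_smul]; exact F_smul_mem_lspan hj ih

theorem divPow_E_smul_mem_lspan (hr : IsGeneric r) (hmu : mu ∈ D.P) (hu : u ∈ wsp D r V mu)
    (hE : ∀ j ∈ J, E D r j • u = 0) {j : I} (hj : j ∈ J) {y : V} (hy : y ∈ lspan D r J u) (q : k)
    (n : ℕ) : divPow q (E D r j) n • y ∈ lspan D r J u := by
  rw [divPow, smul_assoc]
  refine Submodule.smul_mem _ _ ?_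
  induction n with
  | zero => simpa using hy
  | succ n ih => rw [pow_succ', mul_smul]; exact E_smul_mem_lspan hr hmu hu hE hj ih

section Object

variable [Fintype I] [DecidableEq I]

/-- The weights of the module generated by a primitive vector of weight `μ` are `≤ μ`. -/
theorem sub_mem_Qplus_of_mem_lspan (hV : IsObjectO D r V) (hr : IsGeneric r) (hmu : mu ∈ D.P)
    (hu : u ∈ wsp D r V mu) {nu : Module.Dual ℂ h} (hnu : nu ∈ D.P) {y : V}
    (hy : y ∈ lspan D r J u) (hy' : y ∈ wsp D r V nu) (hy0 : y ≠ 0) : mu - nu ∈ Qplus D := by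
  by_contra hc
  have hle : lspan D r J u ≤ ⨆ be ∈ {be : D.P | mu - be ∈ Qplus D}, weightSpace D r V be := by
    refine Submodule.span_le.2 ?_
    rintro _ ⟨om, -, rfl⟩
    obtain ⟨h1, h2, h3⟩ := F_word_mem_wsp hr hmu hu om
    have h4 : (⟨_, h2⟩ : D.P) ∈ {be : D.P | mu - be ∈ Qplus D} := by simpa using h3
    exact Submodule.mem_iSup_of_mem _ (Submodule.mem_iSup_of_mem h4 h1)
  have hdis := hV.weight_indep.disjoint_biSup (x := ⟨nu, hnu⟩)
    (y := {be : D.P | mu - be ∈ Qplus D}) hc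
  exact hy0 (Submodule.disjoint_def.1 hdis y hy' (hle hy))

/-- The weights of the module generated by a primitive vector are permuted by the simple
reflections. -/
theorem exists_reflect_mem_lspan (hV : IsObjectO D r V) (hr : IsGeneric r) (hmu : mu ∈ D.P)
    (hu : u ∈ wsp D r V mu) (hE : ∀ j ∈ J, E D r j • u = 0) {nu : Module.Dual ℂ h} (hnu : nu ∈ D.P)
    {y : V} (hy : y ∈ lspan D r J u) (hy' : y ∈ wsp D r V nu) (hy0 : y ≠ 0) {j : I} (hj : j ∈ J) :
    ∃ y' ∈ lspan D r J u, y' ∈ wsp D r V (reflectHom D j nu) ∧ y' ≠ 0 := by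
  obtain ⟨m, hm⟩ := D.coroot_int nu hnu j
  have S := hV.quantumSl2 hr j
  have hg := wsp_le_grading hm hy'
  rcases Int.eq_nat_or_neg m with ⟨n, rfl | rfl⟩
  · refine ⟨_, divPow_F_smul_mem_lspan hj hy (qi D r j) n, ?_, fun h0 => hy0 ?_⟩
    · have := divPow_F_smul_mem hr hnu hy' (qi D r j) j n
      rwa [reflectHom_apply, hm]
    · exact S.divPow_F_injective hg (by rw [divPow_op]; exact h0)
  · refine ⟨_, divPow_E_smul_mem_lspan hr hmu hu hE hj hy (qi D r j) n, ?_, fun h0 => hy0 ?_⟩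
    · have := divPow_E_smul_mem hr hnu hy' (qi D r j) j n
      rw [reflectHom_apply, hm]
      rwa [show nu + (n : ℂ) • D.root j = nu - ((-(n : ℤ) : ℤ) : ℂ) • D.root j by
        push_cast; module] at this
    · exact S.divPow_E_injective hg (by rw [divPow_op]; exact h0)

theorem exists_act_mem_lspan (hV : IsObjectO D r V) (hr : IsGeneric r) (hmu : mu ∈ D.P)
    (hu : u ∈ wsp D r V mu) (hE : ∀ j, E D r j • u = 0) {nu : Module.Dual ℂ h} (hnu : nu ∈ D.P)
    {y : V} (hy : y ∈ lspan D r Set.univ u) (hy' : y ∈ wsp D r V nu) (hy0 : y ≠ 0)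
    (w : WeylGroup D) :
    ∃ y' ∈ lspan D r Set.univ u, y' ∈ wsp D r V (act D w nu) ∧ y' ≠ 0 := by
  induction w using (weyl D).simple_induction_left with
  | one => exact ⟨y, hy, by simpa using hy', hy0⟩
  | mul_simple_left w i ih =>
    obtain ⟨y', h1, h2, h3⟩ := ih
    rw [act_simple_mul]
    exact exists_reflect_mem_lspan hV hr hmu hu (fun j _ => hE j) (act_mem_P D w hnu) h1 h2 h3
      (Set.mem_univ i)

/-! ### Divided powers on weight vectors -/

section Simple

variable {be : Module.Dual ℂ h} {i : I} {x : V}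

theorem divPow_E_divPow_F_smul (hV : IsObjectO D r V) (hr : IsGeneric r) (hx : x ∈ wsp D r V be)
    {n : ℕ} (hn : be (D.coroot i) = n) (hE : E D r i • x = 0) {m : ℕ} (hm : m ≤ n) :
    divPow (qi D r i) (E D r i) m • divPow (qi D r i) (F D r i) n • x =
      divPow (qi D r i) (F D r i) (n - m) • x := by
  have := (hV.quantumSl2 hr i).divPow_E_divPow_F
    (wsp_le_grading (m := n) (by exact_mod_cast hn) hx) hE hm
  simpa only [divPow_op] using this

theorem divPow_E_divPow_F_smul_of_string (hV : IsObjectO D r V) (hr : IsGeneric r)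
    (hx : x ∈ wsp D r V be) {m j : ℕ} (hj : j ≤ m) (hn : be (D.coroot i) = (m : ℂ) - 2 * j)
    (hE : divPow (qi D r i) (E D r i) (j + 1) • x = 0) :
    divPow (qi D r i) (E D r i) m • divPow (qi D r i) (F D r i) (m - j) • x =
      divPow (qi D r i) (E D r i) j • x := by
  have S := hV.quantumSl2 hr i
  have := S.divPow_E_divPow_F_of_string hj
    (wsp_le_grading (m := (m : ℤ) - 2 * j) (by push_cast; exact hn) hx)
    ((S.divPow_eq_zero_iff _ _ _).1 (by rw [divPow_op]; exact hE))
  simpa only [divPow_op] using this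

theorem eq_of_divPow_E_smul_eq (hV : IsObjectO D r V) (hr : IsGeneric r)
    (hx : x ∈ wsp D r V be) {y : V} (hy : y ∈ wsp D r V be) {n : ℕ}
    (hn : be (D.coroot i) = -(n : ℂ))
    (hxy : divPow (qi D r i) (E D r i) n • x = divPow (qi D r i) (E D r i) n • y) : x = y := by
  rw [← sub_eq_zero]
  refine (hV.quantumSl2 hr i).divPow_E_injective
    (wsp_le_grading (m := -(n : ℤ)) (by push_cast; exact hn) (sub_mem hx hy)) ?_
  rw [divPow_op, smul_sub, hxy, sub_self]

end Simple

end Object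

/-! ### Modules over the rank two subalgebras -/

variable (D r) in
/-- A vector `u` of weight `μ` killed by `E_i` and `E_j`, where `μ(α_i^∨) = a` and
`μ(α_j^∨) = b`. -/
structure IsRankTwo (i j : I) (mu : Module.Dual ℂ h) (u : V) (a b : ℕ) : Prop where
  ne : i ≠ j
  mem_P : mu ∈ D.P
  mem_wsp : u ∈ wsp D r V mu
  E_left : E D r i • u = 0
  E_right : E D r j • u = 0
  coroot_left : mu (D.coroot i) = a
  coroot_right : mu (D.coroot j) = b

variable (D r) in
/-- The vector `v` belongs to the span of the `F_i, F_j`-words on `u` and has weight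
`μ + x α_i + y α_j`. -/
def IsVec (i j : I) (mu : Module.Dual ℂ h) (u : V) (x y : ℤ) (v : V) : Prop :=
  v ∈ lspan D r {i, j} u ∧ v ∈ wsp D r V (mu + (x : ℂ) • D.root i + (y : ℂ) • D.root j)

variable {i j : I} {a b : ℕ} {x y : ℤ} {v : V}

theorem IsRankTwo.swap (R : IsRankTwo D r i j mu u a b) : IsRankTwo D r j i mu u b a :=
  ⟨R.ne.symm, R.mem_P, R.mem_wsp, R.E_right, R.E_left, R.coroot_right, R.coroot_left⟩

theorem IsVec.swap (hv : IsVec D r i j mu u x y v) : IsVec D r j i mu u y x v := by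
  refine ⟨Set.pair_comm i j ▸ hv.1, ?_⟩
  rw [add_right_comm]; exact hv.2

namespace IsRankTwo

theorem E_mem (R : IsRankTwo D r i j mu u a b) : ∀ l ∈ ({i, j} : Set I), E D r l • u = 0 := by
  rintro l (rfl | rfl)
  exacts [R.E_left, R.E_right]

theorem weight_mem_P (R : IsRankTwo D r i j mu u a b) (x y : ℤ) :
    mu + (x : ℂ) • D.root i + (y : ℂ) • D.root j ∈ D.P := by
  rw [Int.cast_smul_eq_zsmul, Int.cast_smul_eq_zsmul]
  exact add_mem (add_mem R.mem_P (zsmul_mem (D.root_mem i) x)) (zsmul_mem (D.root_mem j) y)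

theorem self (R : IsRankTwo D r i j mu u a b) : IsVec D r i j mu u 0 0 u :=
  ⟨self_mem_lspan, by simpa using R.mem_wsp⟩

theorem F_left (R : IsRankTwo D r i j mu u a b) (hr : IsGeneric r) (hv : IsVec D r i j mu u x y v)
    (n : ℕ) : IsVec D r i j mu u (x - n) y (divPow (qi D r i) (F D r i) n • v) := by
  refine ⟨divPow_F_smul_mem_lspan (by simp) hv.1 _ _, ?_⟩
  have := divPow_F_smul_mem hr (R.weight_mem_P x y) hv.2 (qi D r i) i n
  rwa [show mu + (x : ℂ) • D.root i + (y : ℂ) • D.root j - (n : ℂ) • D.root i =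
    mu + ((x - n : ℤ) : ℂ) • D.root i + (y : ℂ) • D.root j by push_cast; module] at this

theorem F_right (R : IsRankTwo D r i j mu u a b) (hr : IsGeneric r)
    (hv : IsVec D r i j mu u x y v) (n : ℕ) :
    IsVec D r i j mu u x (y - n) (divPow (qi D r j) (F D r j) n • v) :=
  (R.swap.F_left hr hv.swap n).swap

theorem divPow_E_left (R : IsRankTwo D r i j mu u a b) (hr : IsGeneric r)
    (hv : IsVec D r i j mu u x y v) (n : ℕ) :
    IsVec D r i j mu u (x + n) y (divPow (qi D r i) (E D r i) n • v) := by
  refine ⟨divPow_E_smul_mem_lspan hr R.mem_P R.mem_wsp R.E_mem (by simp) hv.1 _ _, ?_⟩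
  have := divPow_E_smul_mem hr (R.weight_mem_P x y) hv.2 (qi D r i) i n
  rwa [show mu + (x : ℂ) • D.root i + (y : ℂ) • D.root j + (n : ℂ) • D.root i =
    mu + ((x + n : ℤ) : ℂ) • D.root i + (y : ℂ) • D.root j by push_cast; module] at this

theorem E_left' (R : IsRankTwo D r i j mu u a b) (hr : IsGeneric r)
    (hv : IsVec D r i j mu u x y v) : IsVec D r i j mu u (x + 1) y (E D r i • v) := by
  have := R.divPow_E_left hr hv 1
  rwa [(isGeneric_qi D hr i).divPow_one] at this

theorem E_right' (R : IsRankTwo D r i j mu u a b) (hr : IsGeneric r)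
    (hv : IsVec D r i j mu u x y v) : IsVec D r i j mu u x (y + 1) (E D r j • v) :=
  (R.swap.E_left' hr hv.swap).swap

theorem coroot_i (R : IsRankTwo D r i j mu u a b) (x y : ℤ) :
    (mu + (x : ℂ) • D.root i + (y : ℂ) • D.root j) (D.coroot i) =
      ((a + 2 * x + D.a i j * y : ℤ) : ℂ) := by
  simp only [LinearMap.add_apply, LinearMap.smul_apply, D.root_coroot, D.a_self, R.coroot_left,
    smul_eq_mul]
  push_cast; ring

variable (D r) in
/-- The weight `μ + x α_i + y α_j` occurs in the span of the `F_i, F_j`-words on `u`. -/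
def Occurs (i j : I) (mu : Module.Dual ℂ h) (u : V) (x y : ℤ) : Prop := ∃ v : V, v ≠ 0 ∧ IsVec D r i j mu u x y v

theorem Occurs.swap (ho : Occurs D r i j mu u x y) : Occurs D r j i mu u y x :=
  ho.imp fun _ hv => ⟨hv.1, hv.2.swap⟩

theorem eq_zero_of_not_occurs (hv : IsVec D r i j mu u x y v) (hn : ¬ Occurs D r i j mu u x y) :
    v = 0 := by
  by_contra h0
  exact hn ⟨v, h0, hv⟩

theorem E_left_divPow_F_right (R : IsRankTwo D r i j mu u a b) (n p : ℕ) (v : V) :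
    divPow (qi D r i) (E D r i) n • divPow (qi D r j) (F D r j) p • v =
      divPow (qi D r j) (F D r j) p • divPow (qi D r i) (E D r i) n • v := by
  rw [← mul_smul, (commute_divPow_E_divPow_F R.ne _ _ _ _).eq, mul_smul]

theorem E_left_smul_F_right (R : IsRankTwo D r i j mu u a b) (hv : E D r i • v = 0) (p : ℕ) :
    E D r i • divPow (qi D r j) (F D r j) p • v = 0 := by
  rw [← mul_smul, (commute_E_divPow_F R.ne _ _).eq, mul_smul, hv, smul_zero]

/-- `E_i` kills a vector when the weight it would be raised to does not occur. -/
theorem E_left_eq_zero (R : IsRankTwo D r i j mu u a b) (hr : IsGeneric r)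
    (hv : IsVec D r i j mu u x y v) (ho : ¬ Occurs D r i j mu u (x + 1) y) : E D r i • v = 0 :=
  eq_zero_of_not_occurs (R.E_left' hr hv) ho

theorem E_right_eq_zero (R : IsRankTwo D r i j mu u a b) (hr : IsGeneric r)
    (hv : IsVec D r i j mu u x y v) (ho : ¬ Occurs D r i j mu u x (y + 1)) : E D r j • v = 0 :=
  eq_zero_of_not_occurs (R.E_right' hr hv) ho

section Object

variable [Fintype I] [DecidableEq I]

theorem reflect_left (R : IsRankTwo D r i j mu u a b) (hV : IsObjectO D r V) (hr : IsGeneric r)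
    (ho : Occurs D r i j mu u x y) : Occurs D r i j mu u (-x - a - D.a i j * y) y := by
  obtain ⟨v, hv0, hv⟩ := ho
  obtain ⟨y', h1, h2, h3⟩ := exists_reflect_mem_lspan hV hr R.mem_P R.mem_wsp R.E_mem
    (R.weight_mem_P x y) hv.1 hv.2 hv0 (j := i) (by simp)
  refine ⟨y', h3, h1, ?_⟩
  rw [reflectHom_add_left, R.coroot_left] at h2
  push_cast
  exact h2

theorem reflect_right (R : IsRankTwo D r i j mu u a b) (hV : IsObjectO D r V) (hr : IsGeneric r)
    (ho : Occurs D r i j mu u x y) : Occurs D r i j mu u x (-y - b - D.a j i * x) :=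
  (R.swap.reflect_left hV hr ho.swap).swap

theorem nonpos_left (R : IsRankTwo D r i j mu u a b) (hV : IsObjectO D r V) (hr : IsGeneric r)
    (ho : Occurs D r i j mu u x y) : x ≤ 0 := by
  obtain ⟨v, hv0, hv⟩ := ho
  have h1 := sub_mem_Qplus_of_mem_lspan hV hr R.mem_P R.mem_wsp (R.weight_mem_P x y) hv.1 hv.2 hv0
  obtain ⟨n, hn⟩ := coord_of_mem_Qplus D i h1
  have h2 : mu - (mu + (x : ℂ) • D.root i + (y : ℂ) • D.root j) =
      -((x : ℂ) • D.root i) - (y : ℂ) • D.root j := by abel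
  rw [h2, map_sub, map_neg, map_smul, map_smul, coord_root_self, coord_root_of_ne D R.ne.symm] at hn
  have h3 : -x = n := by
    have : (-(x : ℂ)) = n := by rw [← hn]; simp
    exact_mod_cast this
  omega

theorem nonpos_right (R : IsRankTwo D r i j mu u a b) (hV : IsObjectO D r V) (hr : IsGeneric r)
    (ho : Occurs D r i j mu u x y) : y ≤ 0 :=
  R.swap.nonpos_left hV hr ho.swap

/-! #### Raising words in `F_i` and `F_j` -/

theorem peel_left (R : IsRankTwo D r i j mu u a b) (hV : IsObjectO D r V) (hr : IsGeneric r)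
    (hv : IsVec D r i j mu u x y v) (hE : E D r i • v = 0) {n m p : ℕ} (hm : n = m + p)
    (hn : a + 2 * x + D.a i j * y = n) :
    divPow (qi D r i) (E D r i) m • divPow (qi D r i) (F D r i) n • v =
      divPow (qi D r i) (F D r i) p • v := by
  rw [divPow_E_divPow_F_smul hV hr hv.2 (by rw [R.coroot_i, hn]; simp) hE (by omega), hm,
    Nat.add_sub_cancel_left]

theorem peel_all_left (R : IsRankTwo D r i j mu u a b) (hV : IsObjectO D r V) (hr : IsGeneric r)
    (hv : IsVec D r i j mu u x y v) (hE : E D r i • v = 0) {n : ℕ}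
    (hn : a + 2 * x + D.a i j * y = n) :
    divPow (qi D r i) (E D r i) n • divPow (qi D r i) (F D r i) n • v = v := by
  rw [R.peel_left hV hr hv hE (p := 0) (by omega) hn, divPow_zero, one_smul]

theorem peel_all_right (R : IsRankTwo D r i j mu u a b) (hV : IsObjectO D r V) (hr : IsGeneric r)
    (hv : IsVec D r i j mu u x y v) (hE : E D r j • v = 0) {n : ℕ}
    (hn : b + 2 * y + D.a j i * x = n) :
    divPow (qi D r j) (E D r j) n • divPow (qi D r j) (F D r j) n • v = v :=
  R.swap.peel_all_left hV hr hv.swap hE hn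

/-- `E_i^{(s+t)} F_i^{(t)} F_j^{(p)} F_i^{(s+n)} v = F_j^{(p)} F_i^{(n)} v` when the vector
`F_j^{(p)} F_i^{(s+n)} v` lies on an `i`-string of length `s + t`, `s` steps below its top. -/
theorem move_left (R : IsRankTwo D r i j mu u a b) (hV : IsObjectO D r V) (hr : IsGeneric r)
    (hv : IsVec D r i j mu u x y v) (hE : E D r i • v = 0) (s : ℕ) {l m p t n : ℕ}
    (hl : l = s + n) (hmt : m = s + t) (hn : a + 2 * x + D.a i j * y = l)
    (hm : a + 2 * (x - l) + D.a i j * (y - p) = m - 2 * s)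
    (ho : ¬ Occurs D r i j mu u (x - l + (s + 1)) (y - p)) :
    divPow (qi D r i) (E D r i) m • divPow (qi D r i) (F D r i) t •
      divPow (qi D r j) (F D r j) p • divPow (qi D r i) (F D r i) l • v =
      divPow (qi D r j) (F D r j) p • divPow (qi D r i) (F D r i) n • v := by
  have h1 := R.F_right hr (R.F_left hr hv l) p
  have ht : t = m - s := by omega
  rw [ht, divPow_E_divPow_F_smul_of_string hV hr h1.2 (by omega),
    R.E_left_divPow_F_right, R.peel_left hV hr hv hE hl hn]
  · rw [R.coroot_i, hm]; push_cast; ring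
  · have := R.divPow_E_left hr h1 (s + 1)
    push_cast at this
    exact eq_zero_of_not_occurs this ho

theorem move_right (R : IsRankTwo D r i j mu u a b) (hV : IsObjectO D r V) (hr : IsGeneric r)
    (hv : IsVec D r i j mu u x y v) (hE : E D r j • v = 0) (s : ℕ) {l m p t n : ℕ}
    (hl : l = s + n) (hmt : m = s + t) (hn : b + 2 * y + D.a j i * x = l)
    (hm : b + 2 * (y - l) + D.a j i * (x - p) = m - 2 * s)
    (ho : ¬ Occurs D r i j mu u (x - p) (y - l + (s + 1))) :
    divPow (qi D r j) (E D r j) m • divPow (qi D r j) (F D r j) t •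
      divPow (qi D r i) (F D r i) p • divPow (qi D r j) (F D r j) l • v =
      divPow (qi D r i) (F D r i) p • divPow (qi D r j) (F D r j) n • v :=
  R.swap.move_left hV hr hv.swap hE s hl hmt hn hm fun hc => ho hc.swap

/-- `E_i^{(n)}` is injective on the vectors of weight `-n` at `α_i^∨`. -/
theorem cancel_left (R : IsRankTwo D r i j mu u a b) (hV : IsObjectO D r V) (hr : IsGeneric r)
    {x' y' : ℤ} {v' : V} (hv : IsVec D r i j mu u x y v) (hv' : IsVec D r i j mu u x' y' v')
    (hx : x' = x) (hy : y' = y) {n : ℕ} (hn : a + 2 * x + D.a i j * y = -n)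
    (heq : divPow (qi D r i) (E D r i) n • v = divPow (qi D r i) (E D r i) n • v') : v = v' := by
  subst hx hy
  exact eq_of_divPow_E_smul_eq hV hr hv.2 hv'.2 (by rw [R.coroot_i, hn]; simp) heq

theorem cancel_right (R : IsRankTwo D r i j mu u a b) (hV : IsObjectO D r V) (hr : IsGeneric r)
    {x' y' : ℤ} {v' : V} (hv : IsVec D r i j mu u x y v) (hv' : IsVec D r i j mu u x' y' v')
    (hx : x' = x) (hy : y' = y) {n : ℕ} (hn : b + 2 * y + D.a j i * x = -n)
    (heq : divPow (qi D r j) (E D r j) n • v = divPow (qi D r j) (E D r j) n • v') : v = v' :=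
  R.swap.cancel_left hV hr hv.swap hv'.swap hy hx hn heq

end Object

end IsRankTwo

end Lowering

end CrystalWeyl

namespace CrystalWeyl

section RankTwo

/-! ### Verma identities in rank two -/

variable {I : Type*} {h : Type*} [AddCommGroup h] [Module ℂ h]
  {k : Type*} [Field k] {D : CartanDatum I h} {r : k}
  {V : Type*} [AddCommGroup V] [Module (Uq D r) V] {i j : I}

/-- The identity for the type `A₁ × A₁`. -/
theorem divPow_F_smul_comm (hr : IsGeneric r) (hij : D.a i j = 0) (hne : i ≠ j) (a b : ℕ) (u : V) :
    divPow (qi D r i) (F D r i) a • divPow (qi D r j) (F D r j) b • u =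
      divPow (qi D r j) (F D r j) b • divPow (qi D r i) (F D r i) a • u := by
  have h1 := F_mul_F_comm D hr hij hne
  have h2 : Commute (divPow (qi D r i) (F D r i) a) (divPow (qi D r j) (F D r j) b) := by
    rw [divPow, divPow]
    exact ((Commute.pow_pow h1 a b).smul_left _).smul_right _
  rw [← mul_smul, h2.eq, mul_smul]

variable [Module k V] [IsScalarTower k (Uq D r) V] [Fintype I] [DecidableEq I] {a b : ℕ} {u : V}
  {mu : Module.Dual ℂ h}

namespace IsRankTwo

/-- The identity for the type `A₂`. As for the other types, the two sides have the same weight, on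
which divided powers of `E_i` are injective; applying those that strip the letters of the left-hand
side one by one reduces the equation to a tautology. -/
theorem verma_A2 (R : IsRankTwo D r i j mu u a b) (hV : IsObjectO D r V) (hr : IsGeneric r)
    (hij : D.a i j = -1) (hji : D.a j i = -1) :
    divPow (qi D r i) (F D r i) b • divPow (qi D r j) (F D r j) (a + b) •
      divPow (qi D r i) (F D r i) a • u =
    divPow (qi D r j) (F D r j) a • divPow (qi D r i) (F D r i) (a + b) •
      divPow (qi D r j) (F D r j) b • u := by
  have v1 := R.F_left hr R.self a
  have v2 := R.F_right hr v1 (a + b)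
  have v3 := R.F_left hr v2 b
  have w1 := R.F_right hr R.self b
  have w2 := R.F_left hr w1 (a + b)
  have w3 := R.F_right hr w2 a
  -- the inner words are extremal: a raised weight, reflected back along the word, is not below `μ`
  have ev1 := R.swap.E_left_smul_F_right R.E_right a
  have ew1 := R.E_left_smul_F_right R.E_left b
  have ev2 := R.E_left_eq_zero hr v2 (fun ho => by
    have ho := R.reflect_left hV hr (R.reflect_right hV hr ho)
    have p1 := R.nonpos_left hV hr ho
    have p2 := R.nonpos_right hV hr ho
    simp only [hij, hji] at p1 p2
    omega)
  -- strip the letters of the left-hand side from the outside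
  refine R.cancel_left hV hr v3 w3 (n := b) (by omega) (by omega) (by rw [hij]; omega) ?_
  rw [R.peel_all_left hV hr v2 ev2 (by rw [hij]; omega), R.E_left_divPow_F_right,
    R.peel_left hV hr w1 ew1 (p := a) (by omega) (by rw [hij]; omega)]
  refine R.cancel_right hV hr v2 (R.F_right hr (R.F_left hr w1 a) a) (n := a + b)
    (by omega) (by omega) (by rw [hji]; omega) ?_
  rw [R.peel_all_right hV hr v1 ev1 (by rw [hji]; omega),
    R.move_right hV hr R.self R.E_right b (n := 0) (by omega) (by omega) (by omega)
      (by rw [hji]; omega) (fun ho => by have := R.nonpos_right hV hr ho; omega),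
    divPow_zero, one_smul]

/-- The identity for the type `B₂`. -/
theorem verma_B2 (R : IsRankTwo D r i j mu u a b) (hV : IsObjectO D r V) (hr : IsGeneric r)
    (hij : D.a i j = -1) (hji : D.a j i = -2) :
    divPow (qi D r i) (F D r i) a • divPow (qi D r j) (F D r j) (2 * a + b) •
      divPow (qi D r i) (F D r i) (a + b) • divPow (qi D r j) (F D r j) b • u =
    divPow (qi D r j) (F D r j) b • divPow (qi D r i) (F D r i) (a + b) •
      divPow (qi D r j) (F D r j) (2 * a + b) • divPow (qi D r i) (F D r i) a • u := by
  have v1 := R.F_right hr R.self b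
  have v2 := R.F_left hr v1 (a + b)
  have v3 := R.F_right hr v2 (2 * a + b)
  have v4 := R.F_left hr v3 a
  have w1 := R.F_left hr R.self a
  have w2 := R.F_right hr w1 (2 * a + b)
  have w3 := R.F_left hr w2 (a + b)
  have w4 := R.F_right hr w3 b
  -- the inner words are extremal: a raised weight, reflected back along the word, is not below `μ`
  have ev1 := R.E_left_smul_F_right R.E_left b
  have ew1 := R.swap.E_left_smul_F_right R.E_right a
  have ev2 := R.E_right_eq_zero hr v2 (fun ho => by
    have ho := R.reflect_right hV hr (R.reflect_left hV hr ho)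
    have p1 := R.nonpos_left hV hr ho
    have p2 := R.nonpos_right hV hr ho
    simp only [hij, hji] at p1 p2
    omega)
  have ev3 := R.E_left_eq_zero hr v3 (fun ho => by
    have ho := R.reflect_right hV hr (R.reflect_left hV hr (R.reflect_right hV hr ho))
    have p1 := R.nonpos_left hV hr ho
    have p2 := R.nonpos_right hV hr ho
    simp only [hij, hji] at p1 p2
    omega)
  have ew2 := R.E_left_eq_zero hr w2 (fun ho => by
    have ho := R.reflect_left hV hr (R.reflect_right hV hr ho)
    have p1 := R.nonpos_left hV hr ho
    have p2 := R.nonpos_right hV hr ho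
    simp only [hij, hji] at p1 p2
    omega)
  -- strip the letters of the left-hand side from the outside
  refine R.cancel_left hV hr v4 w4 (n := a) (by omega) (by omega) (by rw [hij]; omega) ?_
  rw [R.peel_all_left hV hr v3 ev3 (by rw [hij]; omega), R.E_left_divPow_F_right,
    R.peel_left hV hr w2 ew2 (p := b) (by omega) (by rw [hij]; omega)]
  refine R.cancel_right hV hr v3 (R.F_right hr (R.F_left hr w2 b) b) (n := 2 * a + b)
    (by omega) (by omega) (by rw [hji]; omega) ?_
  rw [R.peel_all_right hV hr v2 ev2 (by rw [hji]; omega),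
    R.move_right hV hr w1 ew1 (2 * a) (n := b) (by omega) (by omega) (by rw [hji]; omega)
      (by rw [hji]; omega) (fun ho => by
        have ho := R.reflect_right hV hr (R.reflect_left hV hr ho)
        have p1 := R.nonpos_left hV hr ho
        have p2 := R.nonpos_right hV hr ho
        simp only [hij, hji] at p1 p2
        omega)]
  refine R.cancel_left hV hr v2 (R.F_left hr (R.F_right hr w1 b) b) (n := a + b)
    (by omega) (by omega) (by rw [hij]; omega) ?_
  rw [R.peel_all_left hV hr v1 ev1 (by rw [hij]; omega),
    R.move_left hV hr R.self R.E_left a (n := 0) (by omega) (by omega) (by omega)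
      (by rw [hij]; omega) (fun ho => by have := R.nonpos_left hV hr ho; omega),
    divPow_zero, one_smul]

/-- The identity for the type `G₂`. -/
theorem verma_G2 (R : IsRankTwo D r i j mu u a b) (hV : IsObjectO D r V) (hr : IsGeneric r)
    (hij : D.a i j = -1) (hji : D.a j i = -3) :
    divPow (qi D r i) (F D r i) a • divPow (qi D r j) (F D r j) (3 * a + b) •
      divPow (qi D r i) (F D r i) (2 * a + b) • divPow (qi D r j) (F D r j) (3 * a + 2 * b) •
      divPow (qi D r i) (F D r i) (a + b) • divPow (qi D r j) (F D r j) b • u =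
    divPow (qi D r j) (F D r j) b • divPow (qi D r i) (F D r i) (a + b) •
      divPow (qi D r j) (F D r j) (3 * a + 2 * b) • divPow (qi D r i) (F D r i) (2 * a + b) •
      divPow (qi D r j) (F D r j) (3 * a + b) • divPow (qi D r i) (F D r i) a • u := by
  have v1 := R.F_right hr R.self b
  have v2 := R.F_left hr v1 (a + b)
  have v3 := R.F_right hr v2 (3 * a + 2 * b)
  have v4 := R.F_left hr v3 (2 * a + b)
  have v5 := R.F_right hr v4 (3 * a + b)
  have v6 := R.F_left hr v5 a
  have w1 := R.F_left hr R.self a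
  have w2 := R.F_right hr w1 (3 * a + b)
  have w3 := R.F_left hr w2 (2 * a + b)
  have w4 := R.F_right hr w3 (3 * a + 2 * b)
  have w5 := R.F_left hr w4 (a + b)
  have w6 := R.F_right hr w5 b
  -- the inner words are extremal: a raised weight, reflected back along the word, is not below `μ`
  have ev1 := R.E_left_smul_F_right R.E_left b
  have ew1 := R.swap.E_left_smul_F_right R.E_right a
  have ev2 := R.E_right_eq_zero hr v2 (fun ho => by
    have ho := R.reflect_right hV hr (R.reflect_left hV hr ho)
    have p1 := R.nonpos_left hV hr ho
    have p2 := R.nonpos_right hV hr ho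
    simp only [hij, hji] at p1 p2
    omega)
  have ev3 := R.E_left_eq_zero hr v3 (fun ho => by
    have ho := R.reflect_right hV hr (R.reflect_left hV hr (R.reflect_right hV hr ho))
    have p1 := R.nonpos_left hV hr ho
    have p2 := R.nonpos_right hV hr ho
    simp only [hij, hji] at p1 p2
    omega)
  have ev4 := R.E_right_eq_zero hr v4 (fun ho => by
    have ho := R.reflect_right hV hr (R.reflect_left hV hr (R.reflect_right hV hr
      (R.reflect_left hV hr ho)))
    have p1 := R.nonpos_left hV hr ho
    have p2 := R.nonpos_right hV hr ho
    simp only [hij, hji] at p1 p2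
    omega)
  have ev5 := R.E_left_eq_zero hr v5 (fun ho => by
    have ho := R.reflect_right hV hr (R.reflect_left hV hr (R.reflect_right hV hr
      (R.reflect_left hV hr (R.reflect_right hV hr ho))))
    have p1 := R.nonpos_left hV hr ho
    have p2 := R.nonpos_right hV hr ho
    simp only [hij, hji] at p1 p2
    omega)
  have ew2 := R.E_left_eq_zero hr w2 (fun ho => by
    have ho := R.reflect_left hV hr (R.reflect_right hV hr ho)
    have p1 := R.nonpos_left hV hr ho
    have p2 := R.nonpos_right hV hr ho
    simp only [hij, hji] at p1 p2
    omega)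
  have ew3 := R.E_right_eq_zero hr w3 (fun ho => by
    have ho := R.reflect_left hV hr (R.reflect_right hV hr (R.reflect_left hV hr ho))
    have p1 := R.nonpos_left hV hr ho
    have p2 := R.nonpos_right hV hr ho
    simp only [hij, hji] at p1 p2
    omega)
  have ew4 := R.E_left_eq_zero hr w4 (fun ho => by
    have ho := R.reflect_left hV hr (R.reflect_right hV hr (R.reflect_left hV hr
      (R.reflect_right hV hr ho)))
    have p1 := R.nonpos_left hV hr ho
    have p2 := R.nonpos_right hV hr ho
    simp only [hij, hji] at p1 p2
    omega)
  -- strip the letters of the left-hand side from the outside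
  refine R.cancel_left hV hr v6 w6 (n := a) (by omega) (by omega) (by rw [hij]; omega) ?_
  rw [R.peel_all_left hV hr v5 ev5 (by rw [hij]; omega), R.E_left_divPow_F_right,
    R.peel_left hV hr w4 ew4 (p := b) (by omega) (by rw [hij]; omega)]
  refine R.cancel_right hV hr v5 (R.F_right hr (R.F_left hr w4 b) b) (n := 3 * a + b)
    (by omega) (by omega) (by rw [hji]; omega) ?_
  rw [R.peel_all_right hV hr v4 ev4 (by rw [hji]; omega),
    R.move_right hV hr w3 ew3 (3 * a) (n := 2 * b) (by omega) (by omega) (by rw [hji]; omega)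
      (by rw [hji]; omega) (fun ho => by
        have ho := R.reflect_right hV hr (R.reflect_left hV hr (R.reflect_right hV hr
          (R.reflect_left hV hr ho)))
        have p1 := R.nonpos_left hV hr ho
        have p2 := R.nonpos_right hV hr ho
        simp only [hij, hji] at p1 p2
        omega)]
  refine R.cancel_left hV hr v4 (R.F_left hr (R.F_right hr w3 (2 * b)) b) (n := 2 * a + b)
    (by omega) (by omega) (by rw [hij]; omega) ?_
  rw [R.peel_all_left hV hr v3 ev3 (by rw [hij]; omega),
    R.move_left hV hr w2 ew2 (2 * a) (n := b) (by omega) (by omega) (by rw [hij]; omega)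
      (by rw [hij]; omega) (fun ho => by
        have ho := R.reflect_right hV hr (R.reflect_left hV hr (R.reflect_right hV hr ho))
        have p1 := R.nonpos_left hV hr ho
        have p2 := R.nonpos_right hV hr ho
        simp only [hij, hji] at p1 p2
        omega)]
  refine R.cancel_right hV hr v3 (R.F_right hr (R.F_left hr w2 b) (2 * b)) (n := 3 * a + 2 * b)
    (by omega) (by omega) (by rw [hji]; omega) ?_
  rw [R.peel_all_right hV hr v2 ev2 (by rw [hji]; omega),
    R.move_right hV hr w1 ew1 (3 * a) (n := b) (by omega) (by omega) (by rw [hji]; omega)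
      (by rw [hji]; omega) (fun ho => by
        have ho := R.reflect_right hV hr (R.reflect_left hV hr ho)
        have p1 := R.nonpos_left hV hr ho
        have p2 := R.nonpos_right hV hr ho
        simp only [hij, hji] at p1 p2
        omega)]
  refine R.cancel_left hV hr v2 (R.F_left hr (R.F_right hr w1 b) b) (n := a + b)
    (by omega) (by omega) (by rw [hij]; omega) ?_
  rw [R.peel_all_left hV hr v1 ev1 (by rw [hij]; omega),
    R.move_left hV hr R.self R.E_left a (n := 0) (by omega) (by omega) (by omega)
      (by rw [hij]; omega) (fun ho => by have := R.nonpos_left hV hr ho; omega),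
    divPow_zero, one_smul]

end IsRankTwo

end RankTwo

end CrystalWeyl

namespace CrystalWeyl

section Extremal

/-! ### Extremal vectors -/

variable {I : Type*} {h : Type*} [AddCommGroup h] [Module ℂ h]
  {k : Type*} [Field k] {D : CartanDatum I h} {r : k}

theorem reflectWord_cons (i : I) (om : List I) (lam : Module.Dual ℂ h) :
    reflectWord D (i :: om) lam = reflectHom D i (reflectWord D om lam) := rfl

theorem reflectWord_mem_P {lam : Module.Dual ℂ h} (hlam : lam ∈ D.P) (om : List I) :
    reflectWord D om lam ∈ D.P := by
  rw [reflectWord_eq]; exact act_mem_P D _ hlam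

theorem corootPairing_eq {lam : Module.Dual ℂ h} {i : I} {n : ℤ} (hn : lam (D.coroot i) = n) :
    corootPairing D lam i = n := by
  simp [corootPairing, hn]

theorem corootPairing_reflectWord_cons {lam : Module.Dual ℂ h} (hlam : lam ∈ D.P) (i j : I)
    (om : List I) :
    corootPairing D (reflectWord D (i :: om) lam) j =
      corootPairing D (reflectWord D om lam) j -
        corootPairing D (reflectWord D om lam) i * D.a j i := by
  have hm := reflectWord_mem_P hlam om
  apply corootPairing_eq
  rw [reflectWord_cons, reflectHom_apply, LinearMap.sub_apply, LinearMap.smul_apply,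
    D.root_coroot, smul_eq_mul, ← corootPairing_spec D hm i, ← corootPairing_spec D hm j]
  push_cast; ring

theorem not_isLeftDescent_of_isReduced_cons {i : I} {om : List I}
    (hom : (weyl D).IsReduced (i :: om)) : ¬ (weyl D).IsLeftDescent ((weyl D).wordProd om) i := by
  have h1 := hom.eq
  rw [(weyl D).wordProd_cons, List.length_cons] at h1
  have h2 := (weyl D).length_wordProd_le om
  rw [CoxeterSystem.IsLeftDescent]
  omega

theorem isReduced_of_cons {i : I} {om : List I} (hom : (weyl D).IsReduced (i :: om)) :
    (weyl D).IsReduced om := by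
  simpa using hom.drop 1

theorem isReduced_of_append {l om : List I} (hom : (weyl D).IsReduced (l ++ om)) :
    (weyl D).IsReduced om := by
  simpa using hom.drop l.length

theorem isReduced_cons_of_not_isLeftDescent {i : I} {om : List I} (hom : (weyl D).IsReduced om)
    (hi : ¬ (weyl D).IsLeftDescent ((weyl D).wordProd om) i) : (weyl D).IsReduced (i :: om) := by
  rw [CoxeterSystem.IsReduced, (weyl D).wordProd_cons,
    (weyl D).not_isLeftDescent_iff.1 hi, hom.eq, List.length_cons]

variable {V : Type*} [AddCommGroup V] [Module (Uq D r) V]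

theorem monomialF_cons_smul {lam : Module.Dual ℂ h} {i : I} {om : List I} {n : ℕ}
    (hn : corootPairing D (reflectWord D om lam) i = n) (u : V) :
    monomialF D r lam (i :: om) • u =
      divPow (qi D r i) (F D r i) n • monomialF D r lam om • u := by
  rw [monomialF, hn, Int.toNat_natCast, mul_smul]

variable [Module k V] [IsScalarTower k (Uq D r) V] {lam : Module.Dual ℂ h} {u : V} {om : List I}
  {i : I} [Fintype I] [DecidableEq I]

theorem dominant_of_isHighest (hV : IsObjectO D r V) (hr : IsGeneric r) (hlam : lam ∈ D.P)
    (hu : u ∈ wsp D r V lam) (hE : IsHighest D r u) (hu0 : u ≠ 0) : Dominant D lam := by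
  refine ⟨hlam, fun i => ?_⟩
  obtain ⟨m, hm⟩ := D.coroot_int lam hlam i
  obtain ⟨n, rfl, -⟩ := (hV.quantumSl2 hr i).highest_weight (wsp_le_grading hm hu) (hE i) hu0
  exact ⟨n, by simpa using hm⟩

omit [Fintype I] [DecidableEq I] in
theorem exists_corootPairing (hd : Dominant D lam)
    (hi : ¬ (weyl D).IsLeftDescent ((weyl D).wordProd om) i) :
    ∃ n : ℕ, act D ((weyl D).wordProd om) lam (D.coroot i) = n ∧
      corootPairing D (reflectWord D om lam) i = n := by
  obtain ⟨n, hn⟩ := hd.act_coroot hi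
  refine ⟨n, hn, corootPairing_eq ?_⟩
  rw [reflectWord_eq, hn]; simp

omit [Fintype I] [DecidableEq I] in
theorem monomialF_smul_mem (hr : IsGeneric r) (hd : Dominant D lam) (hu : u ∈ wsp D r V lam)
    (hom : (weyl D).IsReduced om) :
    monomialF D r lam om • u ∈ lspan D r Set.univ u ∧
      monomialF D r lam om • u ∈ wsp D r V (act D ((weyl D).wordProd om) lam) := by
  induction om with
  | nil => simpa [monomialF] using ⟨self_mem_lspan, hu⟩
  | cons i om ih =>
    obtain ⟨h1, h2⟩ := ih (isReduced_of_cons hom)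
    obtain ⟨n, hn, hn'⟩ := exists_corootPairing hd (not_isLeftDescent_of_isReduced_cons hom)
    rw [monomialF_cons_smul hn', (weyl D).wordProd_cons, act_simple_mul, reflectHom_apply, hn]
    exact ⟨divPow_F_smul_mem_lspan (Set.mem_univ i) h1 _ _,
      divPow_F_smul_mem hr (act_mem_P D _ hd.mem_P) h2 _ i n⟩

theorem monomialF_smul_ne_zero (hV : IsObjectO D r V) (hr : IsGeneric r) (hd : Dominant D lam)
    (hu : u ∈ wsp D r V lam) (hu0 : u ≠ 0) (hom : (weyl D).IsReduced om) :
    monomialF D r lam om • u ≠ 0 := by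
  induction om with
  | nil => simpa [monomialF] using hu0
  | cons i om ih =>
    have hom' := isReduced_of_cons hom
    obtain ⟨n, hn, hn'⟩ := exists_corootPairing hd (not_isLeftDescent_of_isReduced_cons hom)
    rw [monomialF_cons_smul hn']
    refine fun h0 => ih hom' ((hV.quantumSl2 hr i).divPow_F_injective (n := n)
      (wsp_le_grading (by rw [hn]; simp) (monomialF_smul_mem hr hd hu hom').2) ?_)
    rw [divPow_op]; exact h0

/-- `E_i` kills the extremal vector attached to `w` if `ℓ(s_i w) > ℓ(w)`: its image would have
weight `wλ + α_i`, so `λ + w⁻¹α_i`, with `w⁻¹α_i` positive, would be a weight. -/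
theorem E_smul_monomialF_smul (hV : IsObjectO D r V) (hr : IsGeneric r) (hd : Dominant D lam)
    (hu : u ∈ wsp D r V lam) (hE : IsHighest D r u) (hom : (weyl D).IsReduced om)
    (hi : ¬ (weyl D).IsLeftDescent ((weyl D).wordProd om) i) :
    E D r i • monomialF D r lam om • u = 0 := by
  by_contra h0
  obtain ⟨h1, h2⟩ := monomialF_smul_mem hr hd hu hom
  have hP := act_mem_P D ((weyl D).wordProd om) hd.mem_P
  have h3 := E_smul_mem_lspan hr hd.mem_P hu (fun j _ => hE j) (Set.mem_univ i) h1
  have h4 := E_smul_mem hr hP h2 i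
  obtain ⟨y, hy1, hy2, hy0⟩ := exists_act_mem_lspan hV hr hd.mem_P hu hE
    (add_mem hP (D.root_mem i)) h3 h4 h0 ((weyl D).wordProd om)⁻¹
  rw [map_add, act_inv_act] at hy2
  have h5 := sub_mem_Qplus_of_mem_lspan hV hr hd.mem_P hu
    (add_mem hd.mem_P (act_mem_P D _ (D.root_mem i))) hy1 hy2 hy0
  rw [sub_add_cancel_left] at h5
  rw [← (weyl D).isRightDescent_inv_iff] at hi
  exact act_root_ne_zero D _ i
    (eq_zero_of_mem_Qplus_of_neg_mem D (act_root_mem_Qplus D hi) h5)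

omit [Fintype I] [DecidableEq I] in
theorem isReduced_reverse_alternatingWord_append {i j : I} (hM : coxeterMatrix D i j ≠ 0)
    {c : List I} (hc : (weyl D).IsReduced
      ((CoxeterSystem.alternatingWord i j (coxeterMatrix D i j)).reverse ++ c))
    (hc' : (weyl D).IsReduced
      ((CoxeterSystem.alternatingWord j i (coxeterMatrix D i j)).reverse ++ c)) :
    (weyl D).IsReduced (i :: c) ∧ (weyl D).IsReduced (j :: c) := by
  obtain ⟨m, hm⟩ := Nat.exists_eq_succ_of_ne_zero hM
  rw [hm, CoxeterSystem.alternatingWord_succ', List.reverse_cons, List.append_assoc] at hc hc'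
  have h1 := isReduced_of_append hc
  have h2 := isReduced_of_append hc'
  split_ifs at h1 h2
  exacts [⟨h2, h1⟩, ⟨h1, h2⟩]

/-- The vector `F_{𝐢,λ} u` does not depend on the reduced word `𝐢`: by the rank two identities it
is unchanged by braid moves. -/
theorem monomialF_smul_eq (hV : IsObjectO D r V) (hr : IsGeneric r) (hd : Dominant D lam)
    (hu : u ∈ wsp D r V lam) (hE : IsHighest D r u) {om om' : List I}
    (hom : (weyl D).IsReduced om) (hom' : (weyl D).IsReduced om')
    (heq : (weyl D).wordProd om = (weyl D).wordProd om') :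
    monomialF D r lam om • u = monomialF D r lam om' • u := by
  refine eq_of_wordProd_eq D (fun om => monomialF D r lam om • u) ?_ ?_ hom hom' heq
  · intro i a b _ _ hab hG
    simp only [monomialF, mul_smul, reflectWord_eq, hab]
    simp only [hG]
  · intro i j c hij hM hc1 hc2
    obtain ⟨hic, hjc⟩ := isReduced_reverse_alternatingWord_append hM hc1 hc2
    have hc := isReduced_of_cons hic
    have hi := not_isLeftDescent_of_isReduced_cons hic
    have hj := not_isLeftDescent_of_isReduced_cons hjc
    obtain ⟨a, ha, ha'⟩ := exists_corootPairing hd hi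
    obtain ⟨b, hb, hb'⟩ := exists_corootPairing hd hj
    have R : IsRankTwo D r i j (act D ((weyl D).wordProd c) lam) (monomialF D r lam c • u) a b :=
      ⟨hij, act_mem_P D _ hd.mem_P, (monomialF_smul_mem hr hd hu hc).2,
        E_smul_monomialF_smul hV hr hd hu hE hc hi, E_smul_monomialF_smul hV hr hd hu hE hc hj,
        ha, hb⟩
    -- `hcp` computes the exponents of both words from `a` and `b`
    have hcp := corootPairing_reflectWord_cons (D := D) hd.mem_P
    rcases cartan_cases D hij with ⟨h1, h2, h3⟩ | ⟨h1, h2, h3⟩ | ⟨h1, h2, h3⟩ | ⟨h1, h2, h3⟩ |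
      ⟨h1, h2, h3⟩ | ⟨h1, h2, h3⟩ | ⟨-, h3⟩
    · rw [h3]
      change monomialF D r lam (j :: i :: c) • u = monomialF D r lam (i :: j :: c) • u
      rw [monomialF_cons_smul (n := b) (by simp only [hcp, h1, h2, D.a_self, ha', hb']; omega),
        monomialF_cons_smul ha',
        monomialF_cons_smul (n := a) (by simp only [hcp, h1, h2, D.a_self, ha', hb']; omega),
        monomialF_cons_smul hb']
      exact (divPow_F_smul_comm hr h1 hij a b _).symm
    · rw [h3]
      change monomialF D r lam (j :: i :: j :: c) • u = monomialF D r lam (i :: j :: i :: c) • u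
      rw [monomialF_cons_smul (n := a) (by simp only [hcp, h1, h2, D.a_self, ha', hb']; omega),
        monomialF_cons_smul (n := a + b) (by simp only [hcp, h1, h2, D.a_self, ha', hb']; omega),
        monomialF_cons_smul hb',
        monomialF_cons_smul (n := b) (by simp only [hcp, h1, h2, D.a_self, ha', hb']; omega),
        monomialF_cons_smul (n := a + b) (by simp only [hcp, h1, h2, D.a_self, ha', hb']; omega),
        monomialF_cons_smul ha']
      exact (R.verma_A2 hV hr h1 h2).symm
    · rw [h3]
      change monomialF D r lam (j :: i :: j :: i :: c) • u =
        monomialF D r lam (i :: j :: i :: j :: c) • u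
      rw [monomialF_cons_smul (n := b) (by simp only [hcp, h1, h2, D.a_self, ha', hb']; omega),
        monomialF_cons_smul (n := a + b) (by simp only [hcp, h1, h2, D.a_self, ha', hb']; omega),
        monomialF_cons_smul (n := 2 * a + b)
          (by simp only [hcp, h1, h2, D.a_self, ha', hb']; omega),
        monomialF_cons_smul ha',
        monomialF_cons_smul (n := a) (by simp only [hcp, h1, h2, D.a_self, ha', hb']; omega),
        monomialF_cons_smul (n := 2 * a + b)
          (by simp only [hcp, h1, h2, D.a_self, ha', hb']; omega),
        monomialF_cons_smul (n := a + b) (by simp only [hcp, h1, h2, D.a_self, ha', hb']; omega),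
        monomialF_cons_smul hb']
      exact (R.verma_B2 hV hr h1 h2).symm
    · rw [h3]
      change monomialF D r lam (j :: i :: j :: i :: c) • u =
        monomialF D r lam (i :: j :: i :: j :: c) • u
      rw [monomialF_cons_smul (n := b) (by simp only [hcp, h1, h2, D.a_self, ha', hb']; omega),
        monomialF_cons_smul (n := 2 * b + a)
          (by simp only [hcp, h1, h2, D.a_self, ha', hb']; omega),
        monomialF_cons_smul (n := b + a) (by simp only [hcp, h1, h2, D.a_self, ha', hb']; omega),
        monomialF_cons_smul ha',
        monomialF_cons_smul (n := a) (by simp only [hcp, h1, h2, D.a_self, ha', hb']; omega),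
        monomialF_cons_smul (n := b + a) (by simp only [hcp, h1, h2, D.a_self, ha', hb']; omega),
        monomialF_cons_smul (n := 2 * b + a)
          (by simp only [hcp, h1, h2, D.a_self, ha', hb']; omega),
        monomialF_cons_smul hb']
      exact R.swap.verma_B2 hV hr h2 h1
    · rw [h3]
      change monomialF D r lam (j :: i :: j :: i :: j :: i :: c) • u =
        monomialF D r lam (i :: j :: i :: j :: i :: j :: c) • u
      rw [monomialF_cons_smul (n := b) (by simp only [hcp, h1, h2, D.a_self, ha', hb']; omega),
        monomialF_cons_smul (n := a + b) (by simp only [hcp, h1, h2, D.a_self, ha', hb']; omega),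
        monomialF_cons_smul (n := 3 * a + 2 * b)
          (by simp only [hcp, h1, h2, D.a_self, ha', hb']; omega),
        monomialF_cons_smul (n := 2 * a + b)
          (by simp only [hcp, h1, h2, D.a_self, ha', hb']; omega),
        monomialF_cons_smul (n := 3 * a + b)
          (by simp only [hcp, h1, h2, D.a_self, ha', hb']; omega),
        monomialF_cons_smul ha',
        monomialF_cons_smul (n := a) (by simp only [hcp, h1, h2, D.a_self, ha', hb']; omega),
        monomialF_cons_smul (n := 3 * a + b)
          (by simp only [hcp, h1, h2, D.a_self, ha', hb']; omega),
        monomialF_cons_smul (n := 2 * a + b)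
          (by simp only [hcp, h1, h2, D.a_self, ha', hb']; omega),
        monomialF_cons_smul (n := 3 * a + 2 * b)
          (by simp only [hcp, h1, h2, D.a_self, ha', hb']; omega),
        monomialF_cons_smul (n := a + b) (by simp only [hcp, h1, h2, D.a_self, ha', hb']; omega),
        monomialF_cons_smul hb']
      exact (R.verma_G2 hV hr h1 h2).symm
    · rw [h3]
      change monomialF D r lam (j :: i :: j :: i :: j :: i :: c) • u =
        monomialF D r lam (i :: j :: i :: j :: i :: j :: c) • u
      rw [monomialF_cons_smul (n := b) (by simp only [hcp, h1, h2, D.a_self, ha', hb']; omega),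
        monomialF_cons_smul (n := 3 * b + a)
          (by simp only [hcp, h1, h2, D.a_self, ha', hb']; omega),
        monomialF_cons_smul (n := 2 * b + a)
          (by simp only [hcp, h1, h2, D.a_self, ha', hb']; omega),
        monomialF_cons_smul (n := 3 * b + 2 * a)
          (by simp only [hcp, h1, h2, D.a_self, ha', hb']; omega),
        monomialF_cons_smul (n := b + a) (by simp only [hcp, h1, h2, D.a_self, ha', hb']; omega),
        monomialF_cons_smul ha',
        monomialF_cons_smul (n := a) (by simp only [hcp, h1, h2, D.a_self, ha', hb']; omega),
        monomialF_cons_smul (n := b + a) (by simp only [hcp, h1, h2, D.a_self, ha', hb']; omega),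
        monomialF_cons_smul (n := 3 * b + 2 * a)
          (by simp only [hcp, h1, h2, D.a_self, ha', hb']; omega),
        monomialF_cons_smul (n := 2 * b + a)
          (by simp only [hcp, h1, h2, D.a_self, ha', hb']; omega),
        monomialF_cons_smul (n := 3 * b + a)
          (by simp only [hcp, h1, h2, D.a_self, ha', hb']; omega),
        monomialF_cons_smul hb']
      exact R.swap.verma_G2 hV hr h2 h1
    · exact absurd h3 hM

/-! #### The operators `σ^i` permute the extremal vectors -/

omit [Module k V] [IsScalarTower k (Uq D r) V] [Fintype I] [DecidableEq I] in
theorem reducedWord_spec (w : WeylGroup D) :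
    (weyl D).IsReduced (reducedWord D w) ∧ (weyl D).wordProd (reducedWord D w) = w :=
  ⟨((weyl D).exists_isReduced w).choose_spec.1, ((weyl D).exists_isReduced w).choose_spec.2.symm⟩

variable {la : D.P}

theorem monomialF_smul_eq_extremal (hV : IsObjectO D r V) (hr : IsGeneric r)
    (hd : Dominant D (la : Module.Dual ℂ h)) (hu : u ∈ wsp D r V la) (hE : IsHighest D r u)
    (hom : (weyl D).IsReduced om) :
    monomialF D r (la : Module.Dual ℂ h) om • u = extremal D r la u ((weyl D).wordProd om) :=
  monomialF_smul_eq hV hr hd hu hE hom (reducedWord_spec _).1 (reducedWord_spec _).2.symm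

omit [Fintype I] [DecidableEq I] in
theorem extremal_mem (hr : IsGeneric r) (hd : Dominant D (la : Module.Dual ℂ h))
    (hu : u ∈ wsp D r V la) (w : WeylGroup D) :
    extremal D r la u w ∈ lspan D r Set.univ u ∧ extremal D r la u w ∈ wsp D r V (act D w la) := by
  obtain ⟨h1, h2⟩ := reducedWord_spec w
  have := monomialF_smul_mem hr hd hu h1
  rwa [h2] at this

theorem extremal_ne_zero (hV : IsObjectO D r V) (hr : IsGeneric r)
    (hd : Dominant D (la : Module.Dual ℂ h)) (hu : u ∈ wsp D r V la) (hu0 : u ≠ 0)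
    (w : WeylGroup D) : extremal D r la u w ≠ 0 :=
  monomialF_smul_ne_zero hV hr hd hu hu0 (reducedWord_spec w).1

theorem sigma_extremal (hV : IsObjectO D r V) (hr : IsGeneric r)
    (hd : Dominant D (la : Module.Dual ℂ h)) (hu : u ∈ wsp D r V la) (hE : IsHighest D r u) (i : I)
    (w : WeylGroup D) :
    (hV.quantumSl2 hr i).sigma (extremal D r la u w) =
      extremal D r la u ((weyl D).simple i * w) := by
  have key : ∀ w : WeylGroup D, ¬ (weyl D).IsLeftDescent w i →
      (hV.quantumSl2 hr i).sigma (extremal D r la u w) =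
        extremal D r la u ((weyl D).simple i * w) := by
    intro w hi
    obtain ⟨om, hom, rfl⟩ := (weyl D).exists_isReduced w
    obtain ⟨n, hn, hn'⟩ := exists_corootPairing hd hi
    have h1 := isReduced_cons_of_not_isLeftDescent hom hi
    rw [← (weyl D).wordProd_cons, ← monomialF_smul_eq_extremal hV hr hd hu hE h1,
      ← monomialF_smul_eq_extremal hV hr hd hu hE hom, monomialF_cons_smul hn',
      (hV.quantumSl2 hr i).sigma_highest (n := n)
        (wsp_le_grading (by rw [hn]; simp) (monomialF_smul_mem hr hd hu hom).2)
        (E_smul_monomialF_smul hV hr hd hu hE hom hi), divPow_op]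
  by_cases hi : (weyl D).IsLeftDescent w i
  · have := key _ ((weyl D).isLeftDescent_iff_not_isLeftDescent_mul.1 hi)
    rw [(weyl D).simple_mul_simple_cancel_left] at this
    rw [← this, (hV.quantumSl2 hr i).sigma_sigma]
  · exact key w hi

end Extremal

end CrystalWeyl

namespace CrystalWeyl

namespace QuantumSl2

variable {k : Type*} [Field k] {V : Type*} [AddCommGroup V] [Module k V]
variable {q : k} {E F : Module.End k V} {Wt : ℤ → Submodule k V}

/-! ### Triviality of `σ^i` -/

theorem eq_zero_of_mem_lowest (S : QuantumSl2 q E F Wt) {l : ℕ} (hl : 0 < l) {u : V}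
    (hu : u ∈ lowest F Wt l) (h0 : F (E u) = 0) : u = 0 :=
  S.flip.eq_zero_of_E_F_eq_zero (h := l) (by exact_mod_cast hl) hu.1 h0

/-- If `F = 0`, then only strings of length zero occur. If `σ = 1`, a lowest weight vector of weight
`-l < 0` would be equal to the top `E^{(l)} u` of its string. -/
theorem sigma_eq_one_iff (S : QuantumSl2 q E F Wt) : S.sigma = 1 ↔ F = 0 := by
  constructor
  · intro h1
    refine S.ext_strings fun m j u hu => ?_
    rcases Nat.eq_zero_or_pos (m + j) with h0 | h0
    · obtain ⟨rfl, rfl⟩ : m = 0 ∧ j = 0 := by omega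
      simpa using hu.2
    · have h2 : u = divPow q E (m + j) u := by
        have := S.sigma_string (m := 0) (j := m + j) (by simpa using hu)
        simpa [h1] using this
      suffices hz : u = 0 by simp [hz]
      by_contra hu0
      obtain ⟨n, hn, hn', -⟩ := S.lowest_weight hu.1 hu.2 hu0
      obtain rfl : n = m + j := by omega
      refine hu0 (S.eq_zero_of_mem_lowest h0 hu ?_)
      rw [h2, S.E_divPow, (S.divPow_eq_zero_iff _ _ _).2 hn', smul_zero, map_zero]
  · intro hF
    apply LinearEquiv.toLinearMap_injective
    refine S.ext_strings fun m j u hu => ?_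
    rcases Nat.eq_zero_or_pos (m + j) with h0 | h0
    · obtain ⟨rfl, rfl⟩ : m = 0 ∧ j = 0 := by omega
      exact S.sigma_string hu
    · have hz := S.eq_zero_of_mem_lowest h0 hu (by simp [hF])
      simp [hz]

end QuantumSl2

section Inert

variable {I : Type*} {h : Type*} [AddCommGroup h] [Module ℂ h]
  {k : Type*} [Field k] {D : CartanDatum I h} {r : k}

/-! ### Indices acting trivially on a submodule -/

variable (D) in
/-- The indices `i` such that `α_i^∨` vanishes on the Weyl group orbit of `λ`. -/
def inert (lam : Module.Dual ℂ h) : Set I := {i | ∀ w, act D w lam (D.coroot i) = 0}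

theorem cartan_eq_zero_of_mem_inert {lam : Module.Dual ℂ h} {i j : I} (hi : i ∈ inert D lam)
    (hj : j ∉ inert D lam) : D.a i j = 0 := by
  simp only [inert, Set.mem_ofPred_eq, not_forall] at hj
  obtain ⟨w, hw⟩ := hj
  have h1 := hi ((weyl D).simple j * w)
  rw [act_simple_mul, reflectHom_apply, LinearMap.sub_apply, hi w, LinearMap.smul_apply,
    D.root_coroot, zero_sub, neg_eq_zero, smul_eq_mul] at h1
  exact_mod_cast (mul_eq_zero.1 h1).resolve_left hw

variable {V : Type*} [AddCommGroup V] [Module k V] [Module (Uq D r) V] [IsScalarTower k (Uq D r) V]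

variable (D r V) in
/-- The vectors on which the quantum `sl₂` attached to `i` acts trivially. -/
noncomputable def trivialPart (i : I) : Submodule k V :=
  grading D r V i 0 ⊓ (LinearMap.ker (op D r V (E D r i)) ⊓ LinearMap.ker (op D r V (F D r i)))

theorem mem_trivialPart {i : I} {m : V} : m ∈ trivialPart D r V i ↔
    m ∈ grading D r V i 0 ∧ E D r i • m = 0 ∧ F D r i • m = 0 := Iff.rfl

/-- If `J` is a union of connected components of the Dynkin diagram, then the vectors on which
all `i ∈ J` act trivially form a `U_q(g)`-submodule. -/
theorem smul_mem_trivialPart (hr : IsGeneric r) {J : Set I}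
    (hJ : ∀ i ∈ J, ∀ j ∉ J, D.a i j = 0) (x : Uq D r) {m : V}
    (hm : ∀ i ∈ J, m ∈ trivialPart D r V i) : ∀ i ∈ J, x • m ∈ trivialPart D r V i := by
  obtain ⟨y, rfl⟩ := RingQuot.mkAlgHom_surjective k (Rel D r) x
  induction y using FreeAlgebra.induction generalizing m with
  | grade0 c =>
    intro i hi
    rw [AlgHom.commutes, algebraMap_smul]
    exact Submodule.smul_mem _ c (hm i hi)
  | grade1 g =>
    intro i hi
    obtain ⟨h1, h2, h3⟩ := mem_trivialPart.1 (hm i hi)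
    cases g with
    | E j =>
      change E D r j • m ∈ _
      by_cases hj : j ∈ J
      · rw [(mem_trivialPart.1 (hm j hj)).2.1]; exact zero_mem _
      · have hij := hJ i hi j hj
        have hne : i ≠ j := fun he => hj (he ▸ hi)
        have h4 := grading_E (j := j) hr h1
        rw [hij, add_zero] at h4
        refine mem_trivialPart.2 ⟨h4, ?_, ?_⟩
        · rw [← mul_smul, E_mul_E_comm D hr hij hne, mul_smul]
          exact (congrArg _ h2).trans (smul_zero _)
        · rw [← mul_smul, ← E_mul_F_of_ne D r hne.symm, mul_smul]
          exact (congrArg _ h3).trans (smul_zero _)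
    | F j =>
      change F D r j • m ∈ _
      by_cases hj : j ∈ J
      · rw [(mem_trivialPart.1 (hm j hj)).2.2]; exact zero_mem _
      · have hij := hJ i hi j hj
        have hne : i ≠ j := fun he => hj (he ▸ hi)
        have h4 := grading_F (j := j) hr h1
        rw [hij, sub_zero] at h4
        refine mem_trivialPart.2 ⟨h4, ?_, ?_⟩
        · rw [← mul_smul, E_mul_F_of_ne D r hne, mul_smul]
          exact (congrArg _ h2).trans (smul_zero _)
        · rw [← mul_smul, F_mul_F_comm D hr hij hne, mul_smul]
          exact (congrArg _ h3).trans (smul_zero _)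
    | K lam =>
      change K D r lam • m ∈ _
      have hq : ∀ x : ℂ, qPow D r x ≠ 0 := fun x => zpow_ne_zero _ hr.ne_zero
      refine mem_trivialPart.2 ⟨?_, ?_, ?_⟩
      · rw [mem_grading] at h1 ⊢
        rw [← mul_smul, K_mul_K_comm, mul_smul, h1, smul_comm]
      · have h4 : K D r lam • E D r i • m = 0 := (congrArg _ h2).trans (smul_zero _)
        rw [← mul_smul, K_mul_E, smul_assoc, mul_smul] at h4
        exact (smul_eq_zero.1 h4).resolve_left (hq _)
      · have h4 : K D r lam • F D r i • m = 0 := (congrArg _ h3).trans (smul_zero _)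
        rw [← mul_smul, K_mul_F, smul_assoc, mul_smul] at h4
        exact (smul_eq_zero.1 h4).resolve_left (hq _)
  | mul a b ha hb =>
    rw [map_mul, mul_smul]
    exact ha (hb hm)
  | add a b ha hb =>
    intro i hi
    rw [map_add, add_smul]
    exact add_mem (ha hm i hi) (hb hm i hi)

variable [Fintype I] [DecidableEq I]

theorem isHighest_weightComp (hV : IsObjectO D r V) (hr : IsGeneric r) {v : V}
    (hv : IsHighest D r v) (la : D.P) : IsHighest D r (weightComp D r v la) := by
  intro i
  obtain ⟨h1, h2⟩ := hV.weightComp_spec v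
  by_cases hla : la ∈ (weightComp D r v).support
  · have h3 : ∑ be ∈ (weightComp D r v).support, E D r i • weightComp D r v be = 0 := by
      rw [← Finset.smul_sum]
      rw [Finsupp.sum] at h2
      rw [h2, hv i]
    refine hV.sum_eq_zero (be := fun x : D.P => (x : Module.Dual ℂ h) + D.root i)
      (fun x _ => add_mem x.2 (D.root_mem i)) ?_
      (fun x _ => E_smul_mem hr x.2 (h1 x) i) h3 la hla
    exact fun x _ y _ hxy => Subtype.ext (add_right_cancel hxy)
  · rw [Finsupp.notMem_support_iff.1 hla, smul_zero]

omit [Fintype I] [DecidableEq I] in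
/-- The operators `F_{𝐢,λ}` are homogeneous. -/
theorem exists_monomialF_smul_mem (hr : IsGeneric r) (lam : Module.Dual ℂ h) (om : List I) :
    ∃ c ∈ D.P, ∀ be ∈ D.P, ∀ x ∈ wsp D r V be, monomialF D r lam om • x ∈ wsp D r V (be - c) := by
  induction om with
  | nil => exact ⟨0, zero_mem _, fun be _ x hx => by simpa [monomialF] using hx⟩
  | cons i om ih =>
    obtain ⟨c, hc, h1⟩ := ih
    refine ⟨c + ((corootPairing D (reflectWord D om lam) i).toNat : ℂ) • D.root i, ?_, ?_⟩
    · rw [Nat.cast_smul_eq_nsmul]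
      exact add_mem hc (nsmul_mem (D.root_mem i) _)
    · intro be hbe x hx
      rw [monomialF, mul_smul, ← sub_sub]
      exact divPow_F_smul_mem hr (sub_mem hbe hc) (h1 be hbe x hx) _ _ _

theorem F_smul_monomialF_smul_eq_zero (hV : IsObjectO D r V) (hr : IsGeneric r) {v : V} {i : I}
    (hi : i ∈ JGen D r v) {la : D.P} (hla : la ∈ (weightComp D r v).support)
    (lam : Module.Dual ℂ h) (om : List I) :
    F D r i • monomialF D r lam om • weightComp D r v la = 0 := by
  obtain ⟨h1, h2⟩ := hV.weightComp_spec v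
  obtain ⟨c, hc, h3⟩ := exists_monomialF_smul_mem (D := D) (V := V) hr lam om
  have h4 : ∑ be ∈ (weightComp D r v).support,
      F D r i • monomialF D r lam om • weightComp D r v be = 0 := by
    rw [← Finset.smul_sum, ← Finset.smul_sum]
    rw [Finsupp.sum] at h2
    rw [h2, hi]
  refine hV.sum_eq_zero (be := fun x : D.P => (x : Module.Dual ℂ h) - c - D.root i)
    (fun x _ => sub_mem (sub_mem x.2 hc) (D.root_mem i)) ?_
    (fun x _ => F_smul_mem hr (sub_mem x.2 hc) (h3 _ x.2 _ (h1 x)) i) h4 la hla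
  exact fun x _ y _ hxy => Subtype.ext (sub_left_injective (sub_left_injective hxy))

/-- Some extremal vector is moved by `F_i` unless `α_i^∨` vanishes on the orbit of `λ`. -/
theorem exists_F_smul_extremal_ne_zero (hV : IsObjectO D r V) (hr : IsGeneric r) {la : D.P} {u : V}
    (hd : Dominant D (la : Module.Dual ℂ h)) (hu : u ∈ wsp D r V la) (hu0 : u ≠ 0) {i : I}
    (hi : i ∉ inert D (la : Module.Dual ℂ h)) : ∃ w, F D r i • extremal D r la u w ≠ 0 := by
  obtain ⟨w, n, hn0, hn⟩ : ∃ w, ∃ n : ℕ, n ≠ 0 ∧ act D w la (D.coroot i) = n := by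
    simp only [inert, Set.mem_ofPred_eq, not_forall] at hi
    obtain ⟨w, hw⟩ := hi
    obtain ⟨m, hm⟩ := D.coroot_int _ (act_mem_P D w la.2) i
    have hm0 : m ≠ 0 := fun h0 => hw (by rw [hm, h0, Int.cast_zero])
    rcases Int.eq_nat_or_neg m with ⟨n, rfl | rfl⟩
    · exact ⟨w, n, by simpa using hm0, by simpa using hm⟩
    · refine ⟨(weyl D).simple i * w, n, by simpa using hm0, ?_⟩
      rw [act_simple_mul, reflectHom_apply, LinearMap.sub_apply, LinearMap.smul_apply, hm,
        D.root_coroot, D.a_self, smul_eq_mul]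
      push_cast; ring
  refine ⟨w, fun h0 => extremal_ne_zero hV hr hd hu hu0 w ?_⟩
  have S := hV.quantumSl2 hr i
  refine S.divPow_F_injective (n := n)
    (wsp_le_grading (by rw [hn]; simp) (extremal_mem hr hd hu w).2) ?_
  rw [S.divPow_eq_zero_iff]
  obtain ⟨p, rfl⟩ := Nat.exists_eq_succ_of_ne_zero hn0
  rw [pow_succ, Module.End.mul_apply, op_apply, h0, map_zero]

theorem mem_trivialPart_of_isHighest (hV : IsObjectO D r V) (hr : IsGeneric r)
    {lam : Module.Dual ℂ h} {u : V} (hu : u ∈ wsp D r V lam) (hE : IsHighest D r u) {i : I}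
    (hi : lam (D.coroot i) = 0) : u ∈ trivialPart D r V i := by
  have h1 : u ∈ grading D r V i 0 := wsp_le_grading (by simpa using hi) hu
  refine mem_trivialPart.2 ⟨h1, hE i, ?_⟩
  by_cases hu0 : u = 0
  · rw [hu0, smul_zero]
  · obtain ⟨n, hn, h2, -⟩ := (hV.quantumSl2 hr i).highest_weight h1 (hE i) hu0
    obtain rfl : n = 0 := by omega
    simpa using h2

/-- `F_i` kills `U_q(g) v` exactly when `α_i^∨` vanishes on the orbits of all weights of `v`: if it
does not vanish, `F_i` is nonzero on an extremal vector; the set of indices for which it vanishes is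
a union of components of the Dynkin diagram, and these act trivially. -/
theorem mem_JGen_iff (hV : IsObjectO D r V) (hr : IsGeneric r) {v : V} (hv : IsHighest D r v)
    {i : I} : i ∈ JGen D r v ↔
      ∀ la ∈ (weightComp D r v).support, i ∈ inert D (la : Module.Dual ℂ h) := by
  obtain ⟨h1, h2⟩ := hV.weightComp_spec v
  have hH := isHighest_weightComp hV hr hv
  constructor
  · intro hi la hla
    by_contra hc
    have h0 := Finsupp.mem_support_iff.1 hla
    obtain ⟨w, hw⟩ := exists_F_smul_extremal_ne_zero hV hr
      (dominant_of_isHighest hV hr la.2 (h1 la) (hH la) h0) (h1 la) h0 hc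
    exact hw (F_smul_monomialF_smul_eq_zero hV hr hi hla _ _)
  · intro hi x
    have h3 := smul_mem_trivialPart (V := V) (m := v) hr
      (J := {i | ∀ la ∈ (weightComp D r v).support, i ∈ inert D (la : Module.Dual ℂ h)}) ?_ x ?_ i hi
    · exact (mem_trivialPart.1 h3).2.2
    · intro i hi j hj
      simp only [Set.mem_ofPred_eq, not_forall] at hj
      obtain ⟨la, hla, hj⟩ := hj
      exact cartan_eq_zero_of_mem_inert (hi la hla) hj
    · intro i hi
      rw [← h2]
      refine Submodule.sum_mem _ fun la hla => ?_
      exact mem_trivialPart_of_isHighest hV hr (h1 la) (hH la) (by simpa using hi la hla 1)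

theorem cartan_eq_zero_of_mem_JGen (hV : IsObjectO D r V) (hr : IsGeneric r) {v : V}
    (hv : IsHighest D r v) : ∀ i ∈ JGen D r v, ∀ j ∉ JGen D r v, D.a i j = 0 := by
  intro i hi j hj
  rw [mem_JGen_iff hV hr hv] at hi hj
  push Not at hj
  obtain ⟨la, hla, hj⟩ := hj
  exact cartan_eq_zero_of_mem_inert (hi la hla) hj

/-! ### Existence of highest weight vectors -/

theorem exists_E_word_smul_eq_zero (hV : IsObjectO D r V) (m : V) :
    ∃ N : ℕ, ∀ om : List I, N ≤ om.length → (om.map (E D r)).prod • m = 0 := by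
  obtain ⟨N, hN⟩ := hV.bounded m
  refine ⟨N, fun om hom => hN (fun i => om.count i) ?_ _ (Submodule.subset_span ⟨om, ?_, rfl⟩)⟩
  · rw [← Multiset.coe_card, ← Multiset.sum_count_eq_card (s := Finset.univ) (by simp)] at hom
    simpa only [Multiset.coe_count] using hom
  · simp

/-- Every nonzero vector can be raised by the `E_j`, `j ∈ C`, to a nonzero vector killed by all of
them. -/
theorem exists_E_word_smul_ne_zero (hV : IsObjectO D r V) (C : Set I) {m : V} (hm : m ≠ 0) :
    ∃ om : List I, (∀ j ∈ om, j ∈ C) ∧ (om.map (E D r)).prod • m ≠ 0 ∧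
      ∀ j ∈ C, E D r j • (om.map (E D r)).prod • m = 0 := by
  by_contra! hc
  obtain ⟨N, hN⟩ := exists_E_word_smul_eq_zero hV m
  have key : ∀ n : ℕ, ∃ om : List I, om.length = n ∧ (∀ j ∈ om, j ∈ C) ∧
      (om.map (E D r)).prod • m ≠ 0 := by
    intro n
    induction n with
    | zero => exact ⟨[], rfl, by simp, by simpa using hm⟩
    | succ n ih =>
      obtain ⟨om, rfl, h1, h2⟩ := ih
      obtain ⟨j, hj, h3⟩ := hc om h1 h2
      refine ⟨j :: om, rfl, ?_, by simpa [mul_smul] using h3⟩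
      simpa using ⟨hj, h1⟩
  obtain ⟨om, h1, -, h2⟩ := key N
  exact h2 (hN om h1.ge)

omit [Fintype I] [DecidableEq I] in
theorem E_word_mem_wsp (hr : IsGeneric r) {mu : Module.Dual ℂ h} {u : V} (hmu : mu ∈ D.P)
    (hu : u ∈ wsp D r V mu) (om : List I) :
    (om.map (E D r)).prod • u ∈ wsp D r V (mu + (om.map D.root).sum) ∧
      mu + (om.map D.root).sum ∈ D.P := by
  induction om with
  | nil => simpa using ⟨hu, hmu⟩
  | cons i om ih =>
    have e : mu + ((i :: om).map D.root).sum = mu + (om.map D.root).sum + D.root i := by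
      simp only [List.map_cons, List.sum_cons]; abel
    rw [e, List.map_cons, List.prod_cons, mul_smul]
    exact ⟨E_smul_mem hr ih.2 ih.1 i, add_mem ih.2 (D.root_mem i)⟩

/-- If `F_i` is nonzero on `V` and `i ∈ C`, then some weight vector killed by all `E_j`, `j ∈ C`,
has a weight which is nonzero on some `α_j^∨`, `j ∈ C`. -/
theorem exists_primitive (hV : IsObjectO D r V) (hr : IsGeneric r) {C : Set I} {i : I} (hiC : i ∈ C)
    (hi : i ∉ JV D r V) : ∃ mu ∈ D.P, ∃ y ∈ wsp D r V mu, y ≠ 0 ∧ (∀ j ∈ C, E D r j • y = 0) ∧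
      ∃ j ∈ C, mu (D.coroot j) ≠ 0 := by
  by_contra! hc
  have hF : ∀ mu ∈ D.P, ∀ y ∈ wsp D r V mu, (∀ j ∈ C, E D r j • y = 0) → ∀ j ∈ C,
      F D r j • y = 0 := by
    intro mu hmu y hy hE j hj
    by_cases hy0 : y = 0
    · rw [hy0, smul_zero]
    have h1 : y ∈ grading D r V j 0 :=
      wsp_le_grading (by simpa using hc mu hmu y hy hy0 hE j hj) hy
    obtain ⟨n, hn, h2, -⟩ := (hV.quantumSl2 hr j).highest_weight h1 (hE j hj) hy0
    obtain rfl : n = 0 := by omega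
    simpa using h2
  refine hi fun x => ?_
  have hx : x ∈ ⨆ be, weightSpace D r V be := hV.weight_span ▸ Submodule.mem_top
  suffices hle : ⨆ be, weightSpace D r V be ≤ LinearMap.ker (op D r V (F D r i)) from hle hx
  refine iSup_le fun be m hm => ?_
  change F D r i • m = 0
  by_cases hm0 : m = 0
  · rw [hm0, smul_zero]
  -- raise `m` to a primitive vector, on which every `F_j`, `j ∈ C`, vanishes by `hF`; a last raising
  -- step `E_j` would start from a vector of weight `-2` killed by `F_j E_j`, which is impossible
  obtain ⟨om, h1, h2, h3⟩ := exists_E_word_smul_ne_zero hV C hm0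
  cases om with
  | nil => exact hF be be.2 m hm (by simpa using h3) i hiC
  | cons j om =>
    exfalso
    have hj : j ∈ C := h1 j (by simp)
    obtain ⟨h4, h4'⟩ := E_word_mem_wsp hr be.2 hm (j :: om)
    obtain ⟨h5, h5'⟩ := E_word_mem_wsp hr be.2 hm om
    have h6 := hF _ h4' _ h4 h3 j hj
    have h7 := hc _ h4' _ h4 h2 h3 j hj
    have S := hV.quantumSl2 hr j
    simp only [List.map_cons, List.sum_cons, List.prod_cons, mul_smul] at h2 h6 h7
    refine h2 ?_
    have h8 : ((be : Module.Dual ℂ h) + (om.map D.root).sum) (D.coroot j) = ((-2 : ℤ) : ℂ) := by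
      simp only [LinearMap.add_apply, D.root_coroot, D.a_self] at h7 ⊢
      push_cast at h7 ⊢
      linear_combination h7
    rw [S.flip.eq_zero_of_E_F_eq_zero (h := 2) (by norm_num) (wsp_le_grading h8 h5) h6, smul_zero]

/-- The connected component of `i` in the Dynkin diagram. -/
def component (D : CartanDatum I h) (i : I) : Set I :=
  {j | Relation.ReflTransGen (fun a b => D.a a b ≠ 0) i j}

omit [Fintype I] [DecidableEq I] in
theorem cartan_eq_zero_of_mem_component {i a b : I} (ha : a ∈ component D i)
    (hb : b ∉ component D i) : D.a a b = 0 := by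
  by_contra h0
  exact hb (ha.tail h0)

omit [Fintype I] [DecidableEq I] in
theorem mem_inert_of_mem_component {lam : Module.Dual ℂ h} {i j : I} (hj : j ∈ component D i)
    (hi : i ∈ inert D lam) : j ∈ inert D lam := by
  induction hj with
  | refl => exact hi
  | tail _ hab ih =>
    by_contra hc
    exact hab (cartan_eq_zero_of_mem_inert ih hc)

/-- Every `i` with `F_i ≠ 0` on `V` is detected by the weight of some highest weight vector. -/
theorem exists_isHighest_notMem_inert (hV : IsObjectO D r V) (hr : IsGeneric r) {i : I}
    (hi : i ∉ JV D r V) : ∃ la : D.P, (∃ z ∈ wsp D r V la, z ≠ 0 ∧ IsHighest D r z) ∧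
      i ∉ inert D (la : Module.Dual ℂ h) := by
  obtain ⟨mu, hmu, y, hy, hy0, hE, j, hj, hj0⟩ :=
    exists_primitive hV hr (C := component D i) Relation.ReflTransGen.refl hi
  -- the `E_b` with `b` outside the component commute with those inside and do not change `α_j^∨`
  obtain ⟨om, h1, h2, h3⟩ := exists_E_word_smul_ne_zero hV (component D i)ᶜ hy0
  obtain ⟨h4, h5⟩ := E_word_mem_wsp hr hmu hy om
  refine ⟨⟨_, h5⟩, ⟨_, h4, h2, fun l => ?_⟩, fun hc => hj0 ?_⟩
  · by_cases hl : l ∈ component D i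
    · have hcomm : Commute (E D r l) (om.map (E D r)).prod := by
        refine Commute.list_prod_right _ _ fun x hx => ?_
        obtain ⟨b, hb, rfl⟩ := List.mem_map.1 hx
        exact E_mul_E_comm D hr (cartan_eq_zero_of_mem_component hl (h1 b hb))
          fun he => h1 b hb (he ▸ hl)
      rw [← mul_smul, hcomm.eq, mul_smul, hE l hl, smul_zero]
    · exact h3 l hl
  · have h6 := mem_inert_of_mem_component hj hc 1
    have h7 : ∀ om : List I, (∀ b ∈ om, b ∈ (component D i)ᶜ) →
        (om.map D.root).sum (D.coroot j) = 0 := by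
      intro om hom
      induction om with
      | nil => simp
      | cons b om ih =>
        rw [List.map_cons, List.sum_cons, LinearMap.add_apply, D.root_coroot,
          ih fun x hx => hom x (List.mem_cons_of_mem _ hx),
          cartan_eq_zero_of_mem_component hj (hom b List.mem_cons_self)]
        simp
    simpa [h7 om h1] using h6

/-- A sum of highest weight vectors of sufficiently many distinct weights is moved by every `F_i`
that does not vanish on `V`. -/
theorem exists_JGen_eq_JV [Nontrivial V] (hV : IsObjectO D r V) (hr : IsGeneric r) :
    ∃ v : V, IsHighest D r v ∧ v ≠ 0 ∧ JGen D r v = JV D r V := by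
  classical
  have hex : ∃ la : D.P, ∃ z ∈ wsp D r V la, z ≠ 0 ∧ IsHighest D r z := by
    obtain ⟨x, hx⟩ := exists_ne (0 : V)
    obtain ⟨h1, h2⟩ := hV.weightComp_spec x
    obtain ⟨be, hbe⟩ : ∃ be, weightComp D r x be ≠ 0 := by
      by_contra! hc
      refine hx ?_
      rw [← h2, show weightComp D r x = 0 from Finsupp.ext hc, Finsupp.sum_zero_index]
    obtain ⟨om, -, h3, h4⟩ := exists_E_word_smul_ne_zero hV Set.univ hbe
    obtain ⟨h5, h6⟩ := E_word_mem_wsp hr be.2 (h1 be) om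
    exact ⟨⟨_, h6⟩, _, h5, h3, fun j => h4 j (Set.mem_univ j)⟩
  obtain ⟨la0, hla0⟩ := hex
  have hf : ∀ i : I, ∃ la : D.P, (∃ z ∈ wsp D r V la, z ≠ 0 ∧ IsHighest D r z) ∧
      (i ∉ JV D r V → i ∉ inert D (la : Module.Dual ℂ h)) := by
    intro i
    by_cases hi : i ∈ JV D r V
    · exact ⟨la0, hla0, fun h => absurd hi h⟩
    · obtain ⟨la, h1, h2⟩ := exists_isHighest_notMem_inert hV hr hi
      exact ⟨la, h1, fun _ => h2⟩
  choose f hf1 hf2 using hf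
  set T : Finset D.P := insert la0 (Finset.univ.image f) with hT
  have hz : ∀ la ∈ T, ∃ z ∈ wsp D r V (la : Module.Dual ℂ h), z ≠ 0 ∧ IsHighest D r z := by
    intro la hla
    rcases Finset.mem_insert.1 hla with rfl | hla
    · exact hla0
    · obtain ⟨i, -, rfl⟩ := Finset.mem_image.1 hla
      exact hf1 i
  choose z hz1 hz2 hz3 using hz
  -- one highest weight vector for each weight of `T`; the weights being distinct, none cancels
  set c : D.P →₀ V := Finsupp.indicator T z with hc
  have hcT : ∀ la, (hla : la ∈ T) → c la = z la hla := fun la hla =>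
    Finsupp.indicator_of_mem hla z
  have hcN : ∀ la, la ∉ T → c la = 0 := fun la hla => Finsupp.indicator_of_notMem hla z
  have hcw : ∀ be : D.P, c be ∈ wsp D r V (be : Module.Dual ℂ h) := by
    intro be
    by_cases hbe : be ∈ T
    · rw [hcT be hbe]; exact hz1 be hbe
    · rw [hcN be hbe]; exact zero_mem _
  have hsupp : ∀ la ∈ T, la ∈ c.support := fun la hla => by
    rw [Finsupp.mem_support_iff, hcT la hla]; exact hz2 la hla
  have hw := hV.weightComp_eq hcw
  set v : V := c.sum fun _ x => x with hv
  have hH : IsHighest D r v := by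
    intro i
    rw [hv, Finsupp.sum, Finset.smul_sum]
    refine Finset.sum_eq_zero fun la _ => ?_
    by_cases hla : la ∈ T
    · rw [hcT la hla]; exact hz3 la hla i
    · rw [hcN la hla, smul_zero]
  refine ⟨v, hH, ?_, ?_⟩
  · intro h0
    have h1 : weightComp D r v = 0 := by
      have := hV.weightComp_eq (c := 0) fun be => zero_mem _
      rwa [Finsupp.sum_zero_index, ← h0] at this
    have h2 := hsupp la0 (Finset.mem_insert_self _ _)
    rw [← hw, h1] at h2
    simp at h2
  · apply Set.Subset.antisymm
    · intro i hi
      by_contra hi'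
      rw [mem_JGen_iff hV hr hH, hw] at hi
      exact hf2 i hi' (hi _ (hsupp _ (Finset.mem_insert_of_mem
        (Finset.mem_image_of_mem f (Finset.mem_univ i)))))
    · exact fun i hi x => hi _

end Inert

end CrystalWeyl

namespace CrystalWeyl

section Action

variable {I : Type*} {h : Type*} [AddCommGroup h] [Module ℂ h]
  {k : Type*} [Field k] {D : CartanDatum I h} {r : k}
  {V : Type*} [AddCommGroup V] [Module k V] [Module (Uq D r) V] [IsScalarTower k (Uq D r) V]
  [Fintype I] [DecidableEq I]

/-! ### The operators `σ^i` -/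

/-- The operator `σ^i`, which reverses the strings of the quantum `sl₂` attached to `i`. -/
noncomputable def sigmaOp (hV : IsObjectO D r V) (hr : IsGeneric r) (i : I) : V ≃ₗ[k] V :=
  (hV.quantumSl2 hr i).sigma

variable (hV : IsObjectO D r V) (hr : IsGeneric r)

omit [Fintype I] [DecidableEq I] in
theorem mem_lowest_iff (i : I) (l : ℕ) (u : V) :
    u ∈ QuantumSl2.lowest (op D r V (F D r i)) (grading D r V i) l ↔
      F D r i • u = 0 ∧ K D r (rootHalf D i) • u = (qi D r i ^ l)⁻¹ • u := by
  rw [QuantumSl2.lowest, Submodule.mem_inf, mem_grading, zpow_neg, zpow_natCast, and_comm]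
  rfl

theorem isSigma_sigmaOp (i : I) : IsSigma D r i (sigmaOp hV hr i : V →ₗ[k] V) := by
  intro l n hn u hF hK
  obtain ⟨j, rfl⟩ := Nat.exists_eq_add_of_le hn
  have := (hV.quantumSl2 hr i).sigma_string ((mem_lowest_iff i (n + j) u).2 ⟨hF, hK⟩)
  rw [divPow_op, divPow_op] at this
  rw [Nat.add_sub_cancel_left]
  exact this

theorem eq_sigmaOp_of_isSigma {i : I} {f : V →ₗ[k] V} (hf : IsSigma D r i f) :
    f = (sigmaOp hV hr i : V →ₗ[k] V) := by
  refine (hV.quantumSl2 hr i).ext_strings fun m j u hu => ?_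
  obtain ⟨hF, hK⟩ := (mem_lowest_iff i _ u).1 hu
  rw [divPow_op]
  exact (hf _ m (Nat.le_add_right m j) u hF hK).trans
    (isSigma_sigmaOp hV hr i _ m (Nat.le_add_right m j) u hF hK).symm

theorem sigmaOp_mul_self (i : I) : sigmaOp hV hr i * sigmaOp hV hr i = 1 :=
  LinearEquiv.ext (hV.quantumSl2 hr i).sigma_sigma

theorem sigmaOp_eq_one_iff (i : I) : sigmaOp hV hr i = 1 ↔ i ∈ JV D r V := by
  rw [sigmaOp, (hV.quantumSl2 hr i).sigma_eq_one_iff, LinearMap.ext_iff]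
  rfl

/-! ### The actions on the set of extremal vectors -/

variable {v : V} (hv : IsHighest D r v) {la : D.P}

section

variable (hla : la ∈ (weightComp D r v).support)

include hV hr hv hla

theorem dominant_of_mem_support : Dominant D (la : Module.Dual ℂ h) :=
  dominant_of_isHighest hV hr la.2 ((hV.weightComp_spec v).1 la) (isHighest_weightComp hV hr hv la)
    (Finsupp.mem_support_iff.1 hla)

theorem monomialF_smul_weightComp {om : List I} (hom : (weyl D).IsReduced om) :
    monomialF D r (la : Module.Dual ℂ h) om • weightComp D r v la =
      extremalComp D r v la ((weyl D).wordProd om) :=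
  monomialF_smul_eq_extremal hV hr (dominant_of_mem_support hV hr hv hla)
    ((hV.weightComp_spec v).1 la) (isHighest_weightComp hV hr hv la) hom

theorem sigmaOp_extremalComp (i : I) (w : WeylGroup D) :
    sigmaOp hV hr i (extremalComp D r v la w) =
      extremalComp D r v la ((weyl D).simple i * w) :=
  sigma_extremal hV hr (dominant_of_mem_support hV hr hv hla)
    ((hV.weightComp_spec v).1 la) (isHighest_weightComp hV hr hv la) i w

theorem extremalComp_mem_wsp (w : WeylGroup D) :
    extremalComp D r v la w ∈ wsp D r V (act D w la) :=
  (extremal_mem hr (dominant_of_mem_support hV hr hv hla) ((hV.weightComp_spec v).1 la) w).2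

theorem extremalComp_ne_zero (w : WeylGroup D) : extremalComp D r v la w ≠ 0 :=
  extremal_ne_zero hV hr (dominant_of_mem_support hV hr hv hla) ((hV.weightComp_spec v).1 la)
    (Finsupp.mem_support_iff.1 hla) w

theorem word_extremalComp (om : List I) (w : WeylGroup D) :
    (om.map (sigmaOp hV hr)).prod (extremalComp D r v la w) =
      extremalComp D r v la ((weyl D).wordProd om * w) := by
  induction om with
  | nil => simp
  | cons i om ih =>
    rw [List.map_cons, List.prod_cons, LinearEquiv.mul_apply, ih, sigmaOp_extremalComp hV hr hv hla,
      (weyl D).wordProd_cons, mul_assoc]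

/-- If `F_i` kills `U_q(g) v`, then `σ^i` fixes the vectors `[v(λ)]_w`: they have
`α_i`-weight zero. -/
theorem sigmaOp_extremalComp_of_mem_JGen {i : I} (hi : i ∈ JGen D r v) (w : WeylGroup D) :
    sigmaOp hV hr i (extremalComp D r v la w) = extremalComp D r v la w := by
  have h1 := (mem_JGen_iff hV hr hv).1 hi la hla w
  have h2 : extremalComp D r v la w ∈
      QuantumSl2.lowest (op D r V (F D r i)) (grading D r V i) (0 + 0) :=
    ⟨wsp_le_grading (by simpa using h1) (extremalComp_mem_wsp hV hr hv hla w),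
      F_smul_monomialF_smul_eq_zero hV hr hi hla _ _⟩
  have h3 := (hV.quantumSl2 hr i).sigma_string h2
  rw [divPow_zero] at h3
  exact h3

end

/-- A lift of `w` to a product of the `σ^i`. -/
noncomputable def sigmaLift (w : WeylGroup D) : V ≃ₗ[k] V :=
  ((reducedWord D w).map (sigmaOp hV hr)).prod

include hv in
theorem sigmaLift_extremalComp (hla : la ∈ (weightComp D r v).support) (w u : WeylGroup D) :
    sigmaLift hV hr w (extremalComp D r v la u) = extremalComp D r v la (w * u) := by
  rw [sigmaLift, word_extremalComp hV hr hv hla, (reducedWord_spec w).2]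

include hv in
theorem sigmaLift_mem (w : WeylGroup D) {x : V} (hx : x ∈ extremalSet D r v) :
    sigmaLift hV hr w x ∈ extremalSet D r v := by
  obtain ⟨la, hla, u, rfl⟩ := hx
  exact ⟨la, hla, w * u, sigmaLift_extremalComp hV hr hv hla w u⟩

include hv in
theorem sigmaLift_mul (w u : WeylGroup D) {x : V} (hx : x ∈ extremalSet D r v) :
    sigmaLift hV hr (w * u) x = sigmaLift hV hr w (sigmaLift hV hr u x) := by
  obtain ⟨la, hla, t, rfl⟩ := hx
  simp only [sigmaLift_extremalComp hV hr hv hla, mul_assoc]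

include hv in
theorem sigmaLift_one {x : V} (hx : x ∈ extremalSet D r v) : sigmaLift hV hr 1 x = x := by
  obtain ⟨la, hla, t, rfl⟩ := hx
  rw [sigmaLift_extremalComp hV hr hv hla, one_mul]

/-- The action of the Weyl group on `[v]_W`. It is defined through the lifts `sigmaLift`, so that no
choice of a presentation `x = [v(λ)]_u` is involved. -/
noncomputable def weylAction : WeylGroup D →* Equiv.Perm (extremalSet D r v) where
  toFun w :=
    { toFun := fun x => ⟨sigmaLift hV hr w x, sigmaLift_mem hV hr hv w x.2⟩
      invFun := fun x => ⟨sigmaLift hV hr w⁻¹ x, sigmaLift_mem hV hr hv w⁻¹ x.2⟩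
      left_inv := fun x => Subtype.ext <| by
        change sigmaLift hV hr w⁻¹ (sigmaLift hV hr w x) = x
        rw [← sigmaLift_mul hV hr hv _ _ x.2, inv_mul_cancel, sigmaLift_one hV hr hv x.2]
      right_inv := fun x => Subtype.ext <| by
        change sigmaLift hV hr w (sigmaLift hV hr w⁻¹ x) = x
        rw [← sigmaLift_mul hV hr hv _ _ x.2, mul_inv_cancel, sigmaLift_one hV hr hv x.2] }
  map_one' := Equiv.ext fun x => Subtype.ext (sigmaLift_one hV hr hv x.2)
  map_mul' w u := Equiv.ext fun x => Subtype.ext (sigmaLift_mul hV hr hv w u x.2)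

theorem weylAction_extremalComp (w u : WeylGroup D) (x : extremalSet D r v)
    (hla : la ∈ (weightComp D r v).support) (hx : (x : V) = extremalComp D r v la u) :
    (weylAction hV hr hv w x : V) = extremalComp D r v la (w * u) := by
  change sigmaLift hV hr w x = _
  rw [hx, sigmaLift_extremalComp hV hr hv hla]

include hv in
theorem exists_weyl_of_mem_closure {g : V ≃ₗ[k] V}
    (hg : g ∈ Subgroup.closure (Set.range (sigmaOp hV hr))) :
    ∃ w : WeylGroup D, ∀ la ∈ (weightComp D r v).support, ∀ u,
      g (extremalComp D r v la u) = extremalComp D r v la (w * u) := by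
  induction hg using Subgroup.closure_induction with
  | mem g hg =>
    obtain ⟨i, rfl⟩ := hg
    exact ⟨_, fun la hla u => sigmaOp_extremalComp hV hr hv hla i u⟩
  | one => exact ⟨1, fun la _ u => by rw [one_mul]; rfl⟩
  | mul a b _ _ ha hb =>
    obtain ⟨w, hw⟩ := ha
    obtain ⟨w', hw'⟩ := hb
    exact ⟨w * w', fun la hla u => by
      rw [LinearEquiv.mul_apply, hw' la hla, hw la hla, mul_assoc]⟩
  | inv a _ ha =>
    obtain ⟨w, hw⟩ := ha
    refine ⟨w⁻¹, fun la hla u => ?_⟩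
    have h1 := hw la hla (w⁻¹ * u)
    rw [mul_inv_cancel_left] at h1
    rw [← h1, ← LinearEquiv.mul_apply, inv_mul_cancel]
    rfl

include hv in
theorem smul_mem_extremalSet {g : V ≃ₗ[k] V}
    (hg : g ∈ Subgroup.closure (Set.range (sigmaOp hV hr))) {x : V}
    (hx : x ∈ extremalSet D r v) : g x ∈ extremalSet D r v := by
  obtain ⟨w, hw⟩ := exists_weyl_of_mem_closure hV hr hv hg
  obtain ⟨la, hla, u, rfl⟩ := hx
  exact ⟨la, hla, w * u, hw la hla u⟩

/-- The action of the group generated by the `σ^i` on `[v]_W`. -/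
noncomputable def sigmaAction :
    Subgroup.closure (Set.range (sigmaOp hV hr)) →* Equiv.Perm (extremalSet D r v) where
  toFun g :=
    { toFun := fun x => ⟨(g : V ≃ₗ[k] V) x, smul_mem_extremalSet hV hr hv g.2 x.2⟩
      invFun := fun x => ⟨(g⁻¹ : V ≃ₗ[k] V) x, smul_mem_extremalSet hV hr hv (inv_mem g.2) x.2⟩
      left_inv := fun x => Subtype.ext <| by
        change ((g⁻¹ : V ≃ₗ[k] V) * (g : V ≃ₗ[k] V)) x = x
        rw [inv_mul_cancel]; rfl
      right_inv := fun x => Subtype.ext <| by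
        change ((g : V ≃ₗ[k] V) * (g⁻¹ : V ≃ₗ[k] V)) x = x
        rw [mul_inv_cancel]; rfl }
  map_one' := rfl
  map_mul' _ _ := rfl

/-- `σ^i` as an element of the group generated by all of them. -/
noncomputable def sigmaGen (i : I) : Subgroup.closure (Set.range (sigmaOp hV hr)) :=
  ⟨sigmaOp hV hr i, Subgroup.subset_closure ⟨i, rfl⟩⟩

theorem sigmaAction_sigmaGen (i : I) :
    sigmaAction hV hr hv (sigmaGen hV hr i) = weylAction hV hr hv ((weyl D).simple i) := by
  ext x
  obtain ⟨x, la, hla, u, rfl⟩ := x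
  rw [weylAction_extremalComp hV hr hv _ u _ hla rfl]
  exact sigmaOp_extremalComp hV hr hv hla i u

theorem closure_sigmaGen : Subgroup.closure (Set.range (sigmaGen hV hr)) = ⊤ := by
  rw [← Subgroup.closure_closure_coe_preimage]
  congr 1
  ext ⟨g, hg⟩
  simp [sigmaGen, Subtype.ext_iff]

theorem weylAction_simple_of_mem_JGen {i : I} (hi : i ∈ JGen D r v) :
    weylAction hV hr hv ((weyl D).simple i) = 1 := by
  ext x
  obtain ⟨x, la, hla, u, rfl⟩ := x
  rw [weylAction_extremalComp hV hr hv _ u _ hla rfl, ← sigmaOp_extremalComp hV hr hv hla,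
    sigmaOp_extremalComp_of_mem_JGen hV hr hv hla hi]
  rfl

/-- An element of `W` acting trivially fixes all weights `uλ`, hence lies in a parabolic
subgroup. -/
theorem ker_weylAction : (weylAction hV hr hv).ker = parabolic D (JGen D r v) := by
  apply le_antisymm
  · intro w hw
    have h1 := mem_parabolic_of_fixes D (w := w)
      (T := {mu | ∃ la ∈ (weightComp D r v).support, ∃ u, mu = act D u la}) ?_ ?_
    · refine Subgroup.closure_mono (Set.image_mono fun i hi => ?_) h1
      rw [mem_JGen_iff hV hr hv]
      exact fun la hla u => hi _ ⟨la, hla, u, rfl⟩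
    · rintro i _ ⟨la, hla, u, rfl⟩
      exact ⟨la, hla, _, (act_simple_mul D i u la).symm⟩
    · rintro _ ⟨la, hla, u, rfl⟩
      have h2 := weylAction_extremalComp hV hr hv w u ⟨_, la, hla, u, rfl⟩ hla rfl
      rw [(MonoidHom.mem_ker).1 hw] at h2
      have h3 := extremalComp_mem_wsp hV hr hv hla (w * u)
      rw [← h2] at h3
      have h4 := hV.eq_of_mem_wsp (act_mem_P D _ la.2) (act_mem_P D _ la.2) h3
        (extremalComp_mem_wsp hV hr hv hla u) (extremalComp_ne_zero hV hr hv hla u)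
      rw [← act_mul_apply, h4]
  · refine (Subgroup.closure_le _).2 ?_
    rintro _ ⟨i, hi, rfl⟩
    exact weylAction_simple_of_mem_JGen hV hr hv hi

theorem injOn_weylAction :
    Set.InjOn (weylAction hV hr hv) (parabolic D (JGen D r v)ᶜ) := by
  intro w hw u hu hwu
  have h1 : w⁻¹ * u ∈ (weylAction hV hr hv).ker := by
    rw [MonoidHom.mem_ker, map_mul, map_inv, hwu, inv_mul_cancel]
  rw [ker_weylAction hV hr hv] at h1
  exact inv_mul_eq_one.1 (eq_one_of_mem_parabolic_of_mem_parabolic_compl D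
    (cartan_eq_zero_of_mem_JGen hV hr hv) h1 (mul_mem (inv_mem hw) hu))

omit [Fintype I] [DecidableEq I] in
theorem closure_range_simple : Subgroup.closure (Set.range (weyl D).simple) = ⊤ :=
  (weyl D).subgroup_closure_range_simple

theorem range_sigmaAction : (sigmaAction hV hr hv).range = (weylAction hV hr hv).range := by
  rw [MonoidHom.range_eq_map, MonoidHom.range_eq_map, ← closure_sigmaGen, ← closure_range_simple,
    MonoidHom.map_closure, MonoidHom.map_closure, ← Set.range_comp, ← Set.range_comp]
  congr 2
  ext1 i
  exact sigmaAction_sigmaGen hV hr hv i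

theorem map_parabolic_weylAction :
    (parabolic D (JGen D r v)ᶜ).map (weylAction hV hr hv) = (sigmaAction hV hr hv).range := by
  rw [range_sigmaAction]
  apply le_antisymm
  · rintro _ ⟨w, -, rfl⟩
    exact ⟨w, rfl⟩
  · rw [MonoidHom.range_eq_map, ← closure_range_simple, MonoidHom.map_closure,
      Subgroup.closure_le]
    rintro _ ⟨_, ⟨i, rfl⟩, rfl⟩
    by_cases hi : i ∈ JGen D r v
    · rw [weylAction_simple_of_mem_JGen hV hr hv hi]
      exact one_mem _
    · exact ⟨_, Subgroup.subset_closure ⟨i, hi, rfl⟩, rfl⟩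

/-! ### The homomorphism `ψ_V` -/

include hv in
/-- If `J(U_q(g) v) = J(V)`, then the action of the `σ^i` on `[v]_W` determines a homomorphism to
the Weyl group, since `W_{I ∖ J(V)}` acts faithfully. -/
theorem exists_psi (hJ : JGen D r v = JV D r V) :
    ∃ ψ : Subgroup.closure (Set.range (sigmaOp hV hr)) →* WeylGroup D,
      (∀ i ∈ JV D r V, ψ (sigmaGen hV hr i) = 1) ∧
      (∀ i ∉ JV D r V, ψ (sigmaGen hV hr i) = (weyl D).simple i) ∧
      ∀ g, ψ g ∈ parabolic D (JV D r V)ᶜ := by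
  have hmap := map_parabolic_weylAction hV hr hv
  have hinj := injOn_weylAction hV hr hv
  rw [hJ] at hmap hinj
  have hex : ∀ g, ∃ w ∈ parabolic D (JV D r V)ᶜ,
      weylAction hV hr hv w = sigmaAction hV hr hv g := by
    intro g
    have h1 : sigmaAction hV hr hv g ∈ (sigmaAction hV hr hv).range := ⟨g, rfl⟩
    rw [← hmap] at h1
    exact h1
  choose f hf1 hf2 using hex
  refine ⟨MonoidHom.mk' f fun a b => ?_, fun i hi => ?_, fun i hi => ?_, hf1⟩
  · refine hinj (hf1 _) (mul_mem (hf1 a) (hf1 b)) ?_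
    rw [hf2, map_mul, map_mul, hf2, hf2]
  · refine hinj (hf1 _) (one_mem _) ?_
    have h1 : sigmaGen hV hr i = 1 := Subtype.ext ((sigmaOp_eq_one_iff hV hr i).2 hi)
    rw [hf2, h1, map_one, map_one]
  · refine hinj (hf1 _) (Subgroup.subset_closure ⟨i, hi, rfl⟩) ?_
    rw [hf2, sigmaAction_sigmaGen]

omit [Fintype I] [DecidableEq I] in
theorem simple_ne_one (D : CartanDatum I h) (i : I) : (weyl D).simple i ≠ 1 := by
  intro h1
  have h2 := (weyl D).length_simple i
  rw [h1, (weyl D).length_one] at h2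
  exact zero_ne_one h2

end Action

end CrystalWeyl


theorem mainTheorem6 {I : Type*} [Fintype I] [DecidableEq I]
    {h : Type*} [AddCommGroup h] [Module ℂ h] [FiniteDimensional ℂ h]
    (D : CrystalWeyl.CartanDatum I h)
    {k : Type*} [Field k] [CharZero k] (r : k) (hr : Transcendental ℚ r)
    (V : Type*) [AddCommGroup V] [Module k V] [Module (CrystalWeyl.Uq D r) V]
    [IsScalarTower k (CrystalWeyl.Uq D r) V] [Nontrivial V]
    (hV : CrystalWeyl.IsObjectO D r V) :
    ∃ σ : I → (V ≃ₗ[k] V),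
      -- existence and uniqueness of the operators, which are involutions
      (∀ i, CrystalWeyl.IsSigma D r i (σ i : V →ₗ[k] V) ∧
        ∀ f : V →ₗ[k] V, CrystalWeyl.IsSigma D r i f → f = (σ i : V →ₗ[k] V)) ∧
      (∀ i, σ i * σ i = 1) ∧
      (∀ i, σ i = 1 ↔ i ∈ CrystalWeyl.JV D r V) ∧
      ∃ ψ : Subgroup.closure (Set.range σ) →* CrystalWeyl.WeylGroup D,
        -- the homomorphism and its image
        (∀ i, i ∈ CrystalWeyl.JV D r V →
          ψ ⟨σ i, Subgroup.subset_closure ⟨i, rfl⟩⟩ = 1) ∧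
        (∀ i, i ∉ CrystalWeyl.JV D r V →
          ψ ⟨σ i, Subgroup.subset_closure ⟨i, rfl⟩⟩ = (CrystalWeyl.weyl D).simple i) ∧
        ψ.range = CrystalWeyl.parabolic D (CrystalWeyl.JV D r V)ᶜ ∧
        (Function.Surjective ψ ↔ CrystalWeyl.JV D r V = ∅) ∧
        -- the action on extremal vectors
        (∀ v : V, CrystalWeyl.IsHighest D r v → v ≠ 0 →
          (∀ lam ∈ (CrystalWeyl.weightComp D r v).support, ∀ om : List I,
            (CrystalWeyl.weyl D).IsReduced om →
            CrystalWeyl.monomialF D r (lam : Module.Dual ℂ h) om •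
                CrystalWeyl.weightComp D r v lam =
              CrystalWeyl.extremalComp D r v lam ((CrystalWeyl.weyl D).wordProd om)) ∧
          (∀ lam ∈ (CrystalWeyl.weightComp D r v).support,
            ∀ (i : I) (w : CrystalWeyl.WeylGroup D),
            σ i (CrystalWeyl.extremalComp D r v lam w) =
              CrystalWeyl.extremalComp D r v lam ((CrystalWeyl.weyl D).simple i * w)) ∧
          ∃ (act : CrystalWeyl.WeylGroup D →*
                Equiv.Perm (CrystalWeyl.extremalSet D r v))
            (ξ : Subgroup.closure (Set.range σ) →*
                Equiv.Perm (CrystalWeyl.extremalSet D r v)),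
            (∀ (w u : CrystalWeyl.WeylGroup D) (x : CrystalWeyl.extremalSet D r v),
              ∀ lam ∈ (CrystalWeyl.weightComp D r v).support,
              (x : V) = CrystalWeyl.extremalComp D r v lam u →
              (act w x : V) = CrystalWeyl.extremalComp D r v lam (w * u)) ∧
            (∀ (g : Subgroup.closure (Set.range σ)) (x : CrystalWeyl.extremalSet D r v),
              (ξ g x : V) = (g : V ≃ₗ[k] V) (x : V)) ∧
            ξ = act.comp ψ ∧
            act.ker = CrystalWeyl.parabolic D (CrystalWeyl.JGen D r v) ∧
            ξ.range = act.range ∧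
            Set.InjOn act (CrystalWeyl.parabolic D (CrystalWeyl.JGen D r v)ᶜ) ∧
            (CrystalWeyl.parabolic D (CrystalWeyl.JGen D r v)ᶜ).map act = ξ.range) ∧
        (∃ v : V, CrystalWeyl.IsHighest D r v ∧ v ≠ 0 ∧
          CrystalWeyl.JGen D r v = CrystalWeyl.JV D r V) := by
  have hr' := CrystalWeyl.isGeneric_of_transcendental hr
  obtain ⟨v₀, hv₀, hv₀', hJ⟩ := CrystalWeyl.exists_JGen_eq_JV hV hr'
  obtain ⟨ψ, hψ1, hψs, hψ⟩ := CrystalWeyl.exists_psi hV hr' hv₀ hJ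
  have hdis : ∀ i ∈ CrystalWeyl.JV D r V, ∀ j ∉ CrystalWeyl.JV D r V, D.a i j = 0 :=
    hJ ▸ CrystalWeyl.cartan_eq_zero_of_mem_JGen hV hr' hv₀
  have hrange : ψ.range = CrystalWeyl.parabolic D (CrystalWeyl.JV D r V)ᶜ := by
    apply le_antisymm
    · rintro _ ⟨g, rfl⟩
      exact hψ g
    · refine (Subgroup.closure_le _).2 ?_
      rintro _ ⟨i, hi, rfl⟩
      exact ⟨_, hψs i hi⟩
  refine ⟨CrystalWeyl.sigmaOp hV hr', fun i => ⟨CrystalWeyl.isSigma_sigmaOp hV hr' i,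
    fun f hf => CrystalWeyl.eq_sigmaOp_of_isSigma hV hr' hf⟩,
    CrystalWeyl.sigmaOp_mul_self hV hr', CrystalWeyl.sigmaOp_eq_one_iff hV hr',
    ψ, hψ1, hψs, hrange, ⟨fun hs => ?_, fun h0 => ?_⟩, fun v hv hv0 => ⟨?_, ?_, ?_⟩,
    v₀, hv₀, hv₀', hJ⟩
  · by_contra hne
    obtain ⟨i, hi⟩ := Set.nonempty_iff_ne_empty.2 hne
    rw [← MonoidHom.range_eq_top, hrange] at hs
    -- `s_i` lies in two parabolic subgroups which commute and intersect trivially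
    exact CrystalWeyl.simple_ne_one D i
      (CrystalWeyl.eq_one_of_mem_parabolic_of_mem_parabolic_compl D hdis
        (Subgroup.subset_closure ⟨i, hi, rfl⟩) (hs ▸ Subgroup.mem_top _))
  · rw [← MonoidHom.range_eq_top, hrange, h0, Set.compl_empty, CrystalWeyl.parabolic,
      Set.image_univ, CrystalWeyl.closure_range_simple]
  · exact fun lam hlam om hom => CrystalWeyl.monomialF_smul_weightComp hV hr' hv hlam hom
  · exact fun lam hlam i w => CrystalWeyl.sigmaOp_extremalComp hV hr' hv hlam i w
  · refine ⟨CrystalWeyl.weylAction hV hr' hv, CrystalWeyl.sigmaAction hV hr' hv,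
      fun w u x lam hlam hx => CrystalWeyl.weylAction_extremalComp hV hr' hv w u x hlam hx,
      fun g x => rfl, ?_, CrystalWeyl.ker_weylAction hV hr' hv,
      CrystalWeyl.range_sigmaAction hV hr' hv, CrystalWeyl.injOn_weylAction hV hr' hv,
      CrystalWeyl.map_parabolic_weylAction hV hr' hv⟩
    refine MonoidHom.eq_of_eqOn_dense (CrystalWeyl.closure_sigmaGen hV hr') ?_
    rintro _ ⟨i, rfl⟩
    rw [MonoidHom.comp_apply]
    by_cases hi : i ∈ CrystalWeyl.JV D r V
    · have h1 : CrystalWeyl.sigmaGen hV hr' i = 1 :=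
        Subtype.ext ((CrystalWeyl.sigmaOp_eq_one_iff hV hr' i).2 hi)
      rw [h1, map_one, map_one, map_one]
    · rw [CrystalWeyl.sigmaAction_sigmaGen]
      exact congrArg _ (hψs i hi).symm
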